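/- **Setting.** Let $\rho_{AB}$ be a density operator on a finite-dimensional space $\mathcal H_A\otimes\mathcal H_B$ with marginals $\rho_A,\rho_B$. Let $\{\bar\Lambda^A_u\}_{u\in\mathcal U}$ and $\{\bar\Lambda^B_v\}_{v\in\mathcal V}$ be POVMs on $\mathcal H_A,\mathcal H_B$, and let $P_{Z|U,V}$ be a stochastic map into $\mathcal Z$; the sets $\mathcal U,\mathcal V,\mathcal Z$ are finite. Put $\lambda^A_u=\mathrm{Tr}(\bar\Lambda^A_u\rho_A)$, $\hat\rho^A_u=\frac1{\lambda^A_u}\sqrt{\rho_A}\,\bar\Lambda^A_u\sqrt{\rho_A}$, define $\lambda^B_v,\hat\rho^B_v$ likewise, and put $\lambda^{AB}_{uv}=\mathrm{Tr}((\bar\Lambda^A_u\otimes\bar\Lambda^B_v)\rho_{AB})$. For sequences write $\lambda^A_{u^n}=\prod_i\lambda^A_{u_i}$ and $\hat\rho^A_{u^n}=\bigotimes_i\hat\rho^A_{u_i}$. Let $$\sigma_3=\sum_{u,v,z}\sqrt{\rho_{AB}}(\bar\Lambda^A_u\otimes\bar\Lambda^B_v)\sqrt{\rho_{AB}}\otimes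 P_{Z|U,V}(z|u,v)\,|u\rangle\langle u|\otimes|v\rangle\langle v|\otimes|z\rangle\langle z| ,$$ and let $I(U;V)_{\sigma_3}=S(\sigma_3^U)+S(\sigma_3^V)-S(\sigma_3^{UV})$, with $S$ the von Neumann entropy (base 2). **Typicality.** For $\delta>0$, $\mathcal T_\delta^{(n)}(U)$, $\mathcal T_\delta^{(n)}(V)$, $\mathcal T_\delta^{(n)}(UV)$ are the strongly $\delta$-typical sets of $\{\lambda^A_u\}$, $\{\lambda^B_v\}$, $\{\lambda^{AB}_{uv}\}$: the empirical frequency of each letter is within $\delta$ of its probability, and letters of probability $0$ do not occur. Let $1-\varepsilon=\sum_{u^n\in\mathcal T_\delta^{(n)}(U)}\lambda^A_{u^n}$. Let $\Pi_{\rho_A}$ be the $\delta$-typical projector of $\rho_A^{\otimes n}$ (onto the span of the product eigenvectors whose eigenvalue lies in $[2^{-n(S(\rho_A)+\delta)},2^{-n(S(\rho_A)-\delta)}]$), and let $\Pi_{u^n}$ be the strong conditionally $\delta$-typical projector of $\hat\rho^A_{u^n}$ (for each letter $u$, the typical projector of the power of $\hat\rho^A_u$ carried by the positions $i$ with $u_i=u$).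 Let $\hat\Pi^A$ be the projector onto the eigenvectors of $\sum_{u^n\in\mathcal T_\delta^{(n)}(U)}\frac{\lambda^A_{u^n}}{1-\varepsilon}\Pi_{\rho_A}\Pi_{u^n}\hat\rho^A_{u^n}\Pi_{u^n}\Pi_{\rho_A}$ with eigenvalue larger than $\varepsilon2^{-n(S(\rho_A)+\delta)}$, and put $\Lambda^A_{u^n}=\hat\Pi^A\Pi_{\rho_A}\Pi_{u^n}\hat\rho^A_{u^n}\Pi_{u^n}\Pi_{\rho_A}\hat\Pi^A$. Define $\varepsilon'$ and $\Lambda^B_{v^n}$ likewise. **Random code.** Let $\tilde R_1\ge R_1\ge0$, $\tilde R_2\ge R_2\ge0$, $\eta\in(0,1)$ and $N_1,N_2\ge1$. Write $2^{nR}$ for $\lfloor2^{nR}\rfloor$ when it is a number of codewords or bins. For $\mu_1\in[1,N_1]$ draw $2^{n\tilde R_1}$ codewords $U^{n,(\mu_1)}(l)$ with the law $\lambda^A_{u^n}/(1-\varepsilon)$ on $\mathcal T_\delta^{(n)}(U)$, and give each $u^n$ a uniform bin index in $[1,2^{nR_1}]$. For $\mu_2\in[1,N_2]$ do the same with $V$,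 $\tilde R_2$, $R_2$. All choices are independent. Put $$A^{(\mu_1)}_{u^n}=\gamma^{(\mu_1)}_{u^n}\sqrt{\rho_A^{\otimes n}}^{\,-1}\Lambda^A_{u^n}\sqrt{\rho_A^{\otimes n}}^{\,-1},\qquad \gamma^{(\mu_1)}_{u^n}=\frac{1-\varepsilon}{1+\eta}\,2^{-n\tilde R_1}\,\#\{l:U^{n,(\mu_1)}(l)=u^n\}$$ (inverse on the support), and define $B^{(\mu_2)}_{v^n}$ likewise. Fix an arbitrary default pair $(u_0^n,v_0^n)$. For $\mu=(\mu_1,\mu_2)$, if $u^n$ and $v^n$ are both codewords, then $e^{(\mu)}(u^n,v^n)$ is the only pair of codewords in $\mathcal T_\delta^{(n)}(UV)$ with the same two bin indices as $(u^n,v^n)$, if there is exactly one such pair, and $(u_0^n,v_0^n)$ otherwise. If $u^n$ or $v^n$ is not a codeword, $e^{(\mu)}(u^n,v^n)=(u_0^n,v_0^n)$. The binning error is $$S_2=\sum_{z^n}\Big\|\frac1{N_1N_2}\sum_{\mu_1,\mu_2}\sum_{u^n,v^n}\sqrt{\rho_{AB}^{\otimes n}}\big(A^{(\mu_1)}_{u^n}\otimes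 B^{(\mu_2)}_{v^n}\big)\sqrt{\rho_{AB}^{\otimes n}}\,\big(P^n_{Z|U,V}(z^n|u^n,v^n)-P^n_{Z|U,V}(z^n|e^{(\mu)}(u^n,v^n))\big)\Big\|_1 ,$$ the inner sum being over $u^n\in\mathcal T_\delta^{(n)}(U)$, $v^n\in\mathcal T_\delta^{(n)}(V)$. **Proposition (Mutual Packing).** There exist nondecreasing functions $\epsilon_{S_2}(\delta)$ and $\delta_{S_2}(\delta)$ of $\delta>0$, tending to $0$ as $\delta\searrow0$, such that for all rates as above with $$(\tilde R_1-R_1)+(\tilde R_2-R_2)<I(U;V)_{\sigma_3},$$ for all sufficiently small $\delta>0$ and all sufficiently large $n$ (uniformly in $N_1$, $N_2$, $\eta$ and the default pair), $$\mathbb P\big(S_2>\epsilon_{S_2}(\delta)\big)\le\delta_{S_2}(\delta).$$ -/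

import Mathlib

open scoped Kronecker ComplexOrder

noncomputable section

namespace MutualPacking

/-! ### States, measurements, entropies -/

/-- A density operator on `ℂ^κ`. -/
def IsDensity {κ : Type*} [Fintype κ] (ρ : Matrix κ κ ℂ) : Prop :=
  ρ.PosSemidef ∧ ρ.trace = 1

/-- A POVM on `ℂ^κ` with outcomes in the finite set `X`. -/
def IsPOVM {κ X : Type*} [Fintype κ] [DecidableEq κ] [Fintype X] (M : X → Matrix κ κ ℂ) : Prop :=
  (∀ x, (M x).PosSemidef) ∧ ∑ x, M x = 1

/-- A stochastic map `P(z | u, v)`. -/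
def IsStochastic {U V Z : Type*} [Fintype Z] (P : U → V → Z → ℝ) : Prop :=
  ∀ u v, (∀ z, 0 ≤ P u v z) ∧ ∑ z, P u v z = 1

/-- The operator square root, by functional calculus. -/
def opSqrt {κ : Type*} [Fintype κ] [DecidableEq κ] (M : Matrix κ κ ℂ) : Matrix κ κ ℂ :=
  cfc Real.sqrt M

/-- The inverse of the operator square root, taken on the support (`0⁻¹ = 0` on the kernel). -/
def opInvSqrt {κ : Type*} [Fintype κ] [DecidableEq κ] (M : Matrix κ κ ℂ) : Matrix κ κ ℂ :=
  cfc (fun x : ℝ => (Real.sqrt x)⁻¹) M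

/-- The trace norm `Tr √(X† X)`. -/
def traceNorm {κ : Type*} [Fintype κ] [DecidableEq κ] (X : Matrix κ κ ℂ) : ℝ :=
  (opSqrt (X.conjTranspose * X)).trace.re

/-- The von Neumann entropy `- Tr (ρ log₂ ρ)`. -/
def entropy {κ : Type*} [Fintype κ] [DecidableEq κ] (ρ : Matrix κ κ ℂ) : ℝ :=
  (cfc (fun x : ℝ => -(x * Real.logb 2 x)) ρ).trace.re

/-- The reduced operator on the first factor. -/
def reduceFst {κ τ : Type*} [Fintype τ] (ρ : Matrix (κ × τ) (κ × τ) ℂ) : Matrix κ κ ℂ :=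
  Matrix.of fun i j => ∑ t, ρ (i, t) (j, t)

/-- The reduced operator on the second factor. -/
def reduceSnd {κ τ : Type*} [Fintype κ] (ρ : Matrix (κ × τ) (κ × τ) ℂ) : Matrix τ τ ℂ :=
  Matrix.of fun i j => ∑ k, ρ (k, i) (k, j)

/-- Quantum mutual information `S(ρ_1) + S(ρ_2) - S(ρ_12)` of a bipartite state. -/
def mutualInfo {κ τ : Type*} [Fintype κ] [DecidableEq κ] [Fintype τ] [DecidableEq τ]
    (ρ : Matrix (κ × τ) (κ × τ) ℂ) : ℝ :=
  entropy (reduceFst ρ) + entropy (reduceSnd ρ) - entropy ρ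

/-- The auxiliary state
`σ₃ = ∑_{u,v,z} √ρ (M_u ⊗ M'_v) √ρ ⊗ P(z|u,v) |u⟩⟨u| ⊗ |v⟩⟨v| ⊗ |z⟩⟨z|` on `R ⊗ ((U ⊗ V) ⊗ Z)`,
with `R` a copy of `A ⊗ B`. -/
def sigma3 {a b U V Z : Type*} [Fintype a] [DecidableEq a] [Fintype b] [DecidableEq b]
    [Fintype U] [DecidableEq U] [Fintype V] [DecidableEq V] [Fintype Z] [DecidableEq Z]
    (ρ : Matrix (a × b) (a × b) ℂ) (MA : U → Matrix a a ℂ) (MB : V → Matrix b b ℂ)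
    (P : U → V → Z → ℝ) :
    Matrix ((a × b) × ((U × V) × Z)) ((a × b) × ((U × V) × Z)) ℂ :=
  ∑ u, ∑ v, ∑ z, (opSqrt ρ * (MA u ⊗ₖ MB v) * opSqrt ρ) ⊗ₖ
    ((P u v z : ℂ) • Matrix.single ((u, v), z) ((u, v), z) 1)

/-- `I(U;V)_{σ₃}`: the mutual information of the reduction of `σ₃` to `U ⊗ V`. -/
def mutualInfoUV {a b U V Z : Type*} [Fintype a] [DecidableEq a] [Fintype b] [DecidableEq b]
    [Fintype U] [DecidableEq U] [Fintype V] [DecidableEq V] [Fintype Z] [DecidableEq Z]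
    (ρ : Matrix (a × b) (a × b) ℂ) (MA : U → Matrix a a ℂ) (MB : V → Matrix b b ℂ)
    (P : U → V → Z → ℝ) : ℝ :=
  mutualInfo (reduceFst (reduceSnd (sigma3 ρ MA MB P)))

/-! ### `n`-fold products -/

/-- The operator `M_1 ⊗ ⋯ ⊗ M_n` on the space with basis `κ^n`. -/
def tensorSeq {κ : Type*} {n : ℕ} (M : Fin n → Matrix κ κ ℂ) :
    Matrix (Fin n → κ) (Fin n → κ) ℂ :=
  Matrix.of fun i j => ∏ k, M k (i k) (j k)

/-- The `n`-fold tensor power. -/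
def tensorPow {κ : Type*} (n : ℕ) (M : Matrix κ κ ℂ) : Matrix (Fin n → κ) (Fin n → κ) ℂ :=
  tensorSeq fun _ => M

/-- The `n`-fold tensor power of an operator on `A ⊗ B`, as an operator on `A^n ⊗ B^n`. -/
def tensorPowPair {a b : Type*} (n : ℕ) (M : Matrix (a × b) (a × b) ℂ) :
    Matrix ((Fin n → a) × (Fin n → b)) ((Fin n → a) × (Fin n → b)) ℂ :=
  Matrix.of fun i j => ∏ k, M (i.1 k, i.2 k) (j.1 k, j.2 k)

/-- The product distribution `p(x_1) ⋯ p(x_n)`. -/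
def seqProb {X : Type*} {n : ℕ} (p : X → ℝ) (x : Fin n → X) : ℝ := ∏ k, p (x k)

/-- The `n`-letter stochastic map `∏ P(z_k | u_k, v_k)`. -/
def seqStoch {U V Z : Type*} {n : ℕ} (P : U → V → Z → ℝ)
    (w : (Fin n → U) × (Fin n → V)) (z : Fin n → Z) : ℝ :=
  ∏ k, P (w.1 k) (w.2 k) (z k)

open scoped Classical in
/-- The (strongly) `δ`-typical sequences of length `n` for the distribution `p`. -/
def typicalSet {X : Type*} [Fintype X] (p : X → ℝ) (δ : ℝ) (n : ℕ) : Finset (Fin n → X) :=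
  Finset.univ.filter fun x => ∀ s : X,
    |((Finset.univ.filter fun k => x k = s).card : ℝ) / n - p s| ≤ δ ∧
      (p s = 0 → ∀ k, x k ≠ s)

/-- The probability `1 - ε` of the typical set under the product distribution. -/
def typicalMass {X : Type*} [Fintype X] (p : X → ℝ) (δ : ℝ) (n : ℕ) : ℝ :=
  ∑ x ∈ typicalSet p δ n, seqProb p x

open scoped Classical in
/-- The pruned distribution: the product distribution conditioned on the typical set. -/
def prunedProb {X : Type*} [Fintype X] (p : X → ℝ) (δ : ℝ) {n : ℕ} (x : Fin n → X) : ℝ :=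
  if x ∈ typicalSet p δ n then seqProb p x / typicalMass p δ n else 0

/-! ### Typical projectors -/

open scoped Classical in
/-- The unitary whose columns are an orthonormal eigenbasis of the Hermitian matrix `M`. -/
def eigVec {κ : Type*} [Fintype κ] [DecidableEq κ] (M : Matrix κ κ ℂ) : Matrix κ κ ℂ :=
  if h : M.IsHermitian then (h.eigenvectorUnitary : Matrix κ κ ℂ) else 1

open scoped Classical in
/-- The corresponding eigenvalues of the Hermitian matrix `M`. -/
def eigVal {κ : Type*} [Fintype κ] [DecidableEq κ] (M : Matrix κ κ ℂ) : κ → ℝ :=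
  if h : M.IsHermitian then h.eigenvalues else 0

/-- The eigenvalue labels `y_i`, `i ∈ I`, are `δ`-typical for the state `ρ`:
`2^{-m(S(ρ)+δ)} ≤ ∏_{i ∈ I} (eigenvalue y_i of ρ) ≤ 2^{-m(S(ρ)-δ)}` with `m = |I|`, that is, the
sample entropy is within `δ` of `S(ρ)`. -/
def EigTypical {κ : Type*} [Fintype κ] [DecidableEq κ] (ρ : Matrix κ κ ℂ) (δ : ℝ) {n : ℕ}
    (I : Finset (Fin n)) (y : Fin n → κ) : Prop :=
  (2 : ℝ) ^ (-((I.card : ℝ) * (entropy ρ + δ))) ≤ ∏ i ∈ I, eigVal ρ (y i) ∧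
    ∏ i ∈ I, eigVal ρ (y i) ≤ (2 : ℝ) ^ (-((I.card : ℝ) * (entropy ρ - δ)))

open scoped Classical in
/-- The `δ`-typical projector of `ρ^{⊗n}`. -/
def typProj {κ : Type*} [Fintype κ] [DecidableEq κ] (ρ : Matrix κ κ ℂ) (δ : ℝ) (n : ℕ) :
    Matrix (Fin n → κ) (Fin n → κ) ℂ :=
  tensorPow n (eigVec ρ) *
    Matrix.diagonal (fun y => if EigTypical ρ δ Finset.univ y then 1 else 0) *
    (tensorPow n (eigVec ρ)).conjTranspose

open scoped Classical in
/-- The strong conditionally `δ`-typical projector of the state `τ_{x_1} ⊗ ⋯ ⊗ τ_{x_n}`: for every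
letter `s`, the positions `i` with `x_i = s` carry the typical projector of a power of `τ_s`. -/
def condTypProj {κ X : Type*} [Fintype κ] [DecidableEq κ] (τ : X → Matrix κ κ ℂ) (δ : ℝ) {n : ℕ}
    (x : Fin n → X) : Matrix (Fin n → κ) (Fin n → κ) ℂ :=
  tensorSeq (fun k => eigVec (τ (x k))) *
    Matrix.diagonal (fun y => if ∀ s : X,
      EigTypical (τ s) δ (Finset.univ.filter fun k => x k = s) y then 1 else 0) *
    (tensorSeq (fun k => eigVec (τ (x k)))).conjTranspose

/-! ### The approximating operators of one party -/

section OneParty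

variable {κ X : Type*} [Fintype κ] [DecidableEq κ] [Fintype X]

/-- `λ_x = Tr (M_x ρ)`. -/
def outcomeProb (ρ : Matrix κ κ ℂ) (M : X → Matrix κ κ ℂ) (x : X) : ℝ :=
  (M x * ρ).trace.re

/-- The canonical ensemble state `√ρ M_x √ρ / λ_x`. -/
def canonState (ρ : Matrix κ κ ℂ) (M : X → Matrix κ κ ℂ) (x : X) : Matrix κ κ ℂ :=
  ((outcomeProb ρ M x)⁻¹ : ℂ) • (opSqrt ρ * M x * opSqrt ρ)

/-- `Π_ρ Π_{x^n} ρ̂_{x^n} Π_{x^n} Π_ρ`. -/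
def projState (ρ : Matrix κ κ ℂ) (M : X → Matrix κ κ ℂ) (δ : ℝ) {n : ℕ} (x : Fin n → X) :
    Matrix (Fin n → κ) (Fin n → κ) ℂ :=
  typProj ρ δ n * condTypProj (canonState ρ M) δ x *
    tensorSeq (fun k => canonState ρ M (x k)) *
    condTypProj (canonState ρ M) δ x * typProj ρ δ n

/-- The average of the operators `projState` under the pruned distribution. -/
def avgProjState (ρ : Matrix κ κ ℂ) (M : X → Matrix κ κ ℂ) (δ : ℝ) (n : ℕ) :
    Matrix (Fin n → κ) (Fin n → κ) ℂ :=
  ∑ x ∈ typicalSet (outcomeProb ρ M) δ n,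
    (prunedProb (outcomeProb ρ M) δ x : ℂ) • projState ρ M δ x

open scoped Classical in
/-- The cut-off projector: the spectral projector of `avgProjState` onto the eigenvalues larger
than `ε 2^{-n(S(ρ)+δ)}`, where `1 - ε` is the probability of the typical set. -/
def cutProj (ρ : Matrix κ κ ℂ) (M : X → Matrix κ κ ℂ) (δ : ℝ) (n : ℕ) :
    Matrix (Fin n → κ) (Fin n → κ) ℂ :=
  cfc (fun t : ℝ => if (1 - typicalMass (outcomeProb ρ M) δ n) *
      (2 : ℝ) ^ (-((n : ℝ) * (entropy ρ + δ))) < t then (1 : ℝ) else 0) (avgProjState ρ M δ n)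

/-- `Λ_{x^n} = Π̂ Π_ρ Π_{x^n} ρ̂_{x^n} Π_{x^n} Π_ρ Π̂`. -/
def approxOp (ρ : Matrix κ κ ℂ) (M : X → Matrix κ κ ℂ) (δ : ℝ) {n : ℕ} (x : Fin n → X) :
    Matrix (Fin n → κ) (Fin n → κ) ℂ :=
  cutProj ρ M δ n * projState ρ M δ x * cutProj ρ M δ n

open scoped Classical in
/-- The coefficient `(1-ε)/(1+η) · (1/L) · #{l : c(l) = x^n}` of the codebook `c` of size `L`. -/
def codeCoeff (p : X → ℝ) (δ η : ℝ) {n L : ℕ} (c : Fin L → Fin n → X) (x : Fin n → X) : ℝ :=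
  typicalMass p δ n / (1 + η) * ((L : ℝ)⁻¹ * (Finset.univ.filter fun l => c l = x).card)

/-- The operator `A_{x^n} = γ_{x^n} √(ρ^{⊗n})⁻¹ Λ_{x^n} √(ρ^{⊗n})⁻¹` built from the codebook `c`. -/
def codeOp (ρ : Matrix κ κ ℂ) (M : X → Matrix κ κ ℂ) (δ η : ℝ) {n L : ℕ}
    (c : Fin L → Fin n → X) (x : Fin n → X) : Matrix (Fin n → κ) (Fin n → κ) ℂ :=
  (codeCoeff (outcomeProb ρ M) δ η c x : ℂ) •
    (opInvSqrt (tensorPow n ρ) * approxOp ρ M δ x * opInvSqrt (tensorPow n ρ))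

end OneParty

/-! ### Random codebooks, random binning, decoder -/

/-- The integer `⌊2^{nR}⌋`. -/
def rateSize (n : ℕ) (R : ℝ) : ℕ := ⌊(2 : ℝ) ^ ((n : ℝ) * R)⌋₊

/-- The random choices of one party: for each of the `N` values of the common randomness a codebook
of `L` codewords of length `n`, and a bin index in `Fin K` for every sequence. -/
abbrev Choices (X : Type*) (n N L K : ℕ) : Type _ :=
  (Fin N → Fin L → Fin n → X) × (Fin N → (Fin n → X) → Fin K)

/-- The probability of a choice: all codewords are independent with the pruned distribution, all
bin indices are uniform, and everything is independent. -/
def choiceProb {X : Type*} [Fintype X] [DecidableEq X] (p : X → ℝ) (δ : ℝ) {n N L K : ℕ}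
    (ω : Choices X n N L K) : ℝ :=
  (∏ μ, ∏ l, prunedProb p δ (ω.1 μ l)) * ∏ _μ : Fin N, ∏ _x : Fin n → X, (K : ℝ)⁻¹

section Decoder

variable {U V : Type*} [Fintype U] [DecidableEq U] [Fintype V] [DecidableEq V]
  {n L₁ L₂ K₁ K₂ : ℕ}

/-- The pair `(u^n, v^n)` belongs to the codebook `𝒞`, i.e. `u^n` and `v^n` are codewords. -/
def InCode (cU : Fin L₁ → Fin n → U) (cV : Fin L₂ → Fin n → V)
    (w : (Fin n → U) × (Fin n → V)) : Prop :=
  (∃ l, cU l = w.1) ∧ ∃ k, cV k = w.2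

open scoped Classical in
/-- The decoder: on the bin indices `(i, j)` it returns the jointly typical codeword pair in the
bin pair if there is exactly one, and the default pair `w₀` otherwise. -/
def decode (q : U × V → ℝ) (δ : ℝ) (cU : Fin L₁ → Fin n → U) (cV : Fin L₂ → Fin n → V)
    (binU : (Fin n → U) → Fin K₁) (binV : (Fin n → V) → Fin K₂)
    (w₀ : (Fin n → U) × (Fin n → V)) (i : Fin K₁) (j : Fin K₂) : (Fin n → U) × (Fin n → V) :=
  if h : ∃! w : (Fin n → U) × (Fin n → V), InCode cU cV w ∧
      (fun k => (w.1 k, w.2 k)) ∈ typicalSet q δ n ∧ binU w.1 = i ∧ binV w.2 = j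
  then h.choose else w₀

open scoped Classical in
/-- The map `e`: a codeword pair is sent to the decoder's output on its bin indices, any other pair
to the default pair. -/
def reconstruct (q : U × V → ℝ) (δ : ℝ) (cU : Fin L₁ → Fin n → U) (cV : Fin L₂ → Fin n → V)
    (binU : (Fin n → U) → Fin K₁) (binV : (Fin n → V) → Fin K₂)
    (w₀ w : (Fin n → U) × (Fin n → V)) : (Fin n → U) × (Fin n → V) :=
  if InCode cU cV w then decode q δ cU cV binU binV w₀ (binU w.1) (binV w.2) else w₀

end Decoder

/-! ### The binning error -/

section BinningError

variable {a b U V Z : Type*} [Fintype a] [DecidableEq a] [Fintype b] [DecidableEq b]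
  [Fintype U] [DecidableEq U] [Fintype V] [DecidableEq V] [Fintype Z]

/-- `λ^{AB}_{uv} = Tr ((M_u ⊗ M'_v) ρ)`. -/
def jointProb (ρ : Matrix (a × b) (a × b) ℂ) (MA : U → Matrix a a ℂ) (MB : V → Matrix b b ℂ) :
    U × V → ℝ :=
  outcomeProb ρ fun w => MA w.1 ⊗ₖ MB w.2

/-- The binning error
`S₂ = ∑_{z^n} ‖ (N₁N₂)⁻¹ ∑_{μ₁,μ₂} ∑_{u^n,v^n} √(ρ^{⊗n}) (A_{u^n} ⊗ B_{v^n}) √(ρ^{⊗n})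
  (P(z^n|u^n,v^n) - P(z^n|e(u^n,v^n))) ‖₁` as a function of the random choices, the inner sum being
over typical `u^n` and typical `v^n`. -/
def binningError (ρ : Matrix (a × b) (a × b) ℂ) (MA : U → Matrix a a ℂ) (MB : V → Matrix b b ℂ)
    (P : U → V → Z → ℝ) (δ η : ℝ) {n N₁ N₂ L₁ L₂ K₁ K₂ : ℕ}
    (w₀ : (Fin n → U) × (Fin n → V)) (ωA : Choices U n N₁ L₁ K₁) (ωB : Choices V n N₂ L₂ K₂) : ℝ :=
  ∑ z : Fin n → Z, traceNorm (((N₁ : ℂ) * (N₂ : ℂ))⁻¹ • ∑ μ₁ : Fin N₁, ∑ μ₂ : Fin N₂,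
    ∑ u ∈ typicalSet (outcomeProb (reduceFst ρ) MA) δ n,
    ∑ v ∈ typicalSet (outcomeProb (reduceSnd ρ) MB) δ n,
      ((seqStoch P (u, v) z - seqStoch P (reconstruct (jointProb ρ MA MB) δ (ωA.1 μ₁) (ωB.1 μ₂)
          (ωA.2 μ₁) (ωB.2 μ₂) w₀ (u, v)) z : ℝ) : ℂ) •
        (opSqrt (tensorPowPair n ρ) *
          (codeOp (reduceFst ρ) MA δ η (ωA.1 μ₁) u ⊗ₖ codeOp (reduceSnd ρ) MB δ η (ωB.1 μ₂) v) *
          opSqrt (tensorPowPair n ρ)))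

open scoped Classical in
/-- `ℙ(S₂ > t)` for codebooks of sizes `L₁`, `L₂` and numbers of bins `K₁`, `K₂`. -/
def binningErrorProb (ρ : Matrix (a × b) (a × b) ℂ) (MA : U → Matrix a a ℂ)
    (MB : V → Matrix b b ℂ) (P : U → V → Z → ℝ) (δ η : ℝ) (n N₁ N₂ L₁ L₂ K₁ K₂ : ℕ)
    (w₀ : (Fin n → U) × (Fin n → V)) (t : ℝ) : ℝ :=
  ∑ ωA : Choices U n N₁ L₁ K₁, ∑ ωB : Choices V n N₂ L₂ K₂,
    if t < binningError ρ MA MB P δ η w₀ ωA ωB then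
      choiceProb (outcomeProb (reduceFst ρ) MA) δ ωA *
        choiceProb (outcomeProb (reduceSnd ρ) MB) δ ωB
    else 0

end BinningError

end MutualPacking

end

noncomputable section

namespace MutualPacking

set_option linter.unusedSectionVars false

/-! ### Positive operators and functional calculus -/

section LinearAlgebra

open scoped MatrixOrder

variable {κ : Type*} [Fintype κ] [DecidableEq κ]

/-! All operators summed inside the trace norm are positive up to real coefficients. The triangle
inequality therefore bounds the binning error by twice the average trace weight of the codeword
pairs (u, v) with e(u, v) ≠ (u, v) (`traceNorm_sum_le`, `binningError_le`). The quantum states now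
enter only through the nonnegative numbers `overlap`, and what remains is the expectation over a
classical random binning code, followed by Markov's inequality.

A codeword pair can fail to be recovered only if it is not jointly typical, or if another jointly
typical codeword pair shares its bins (`failure_le`). For the second event, a fixed sequence of one
party is jointly typical with an independent sequence of the other with probability about 2^{-nI}
(`sum_typical_snd_le`, `sum_typical_fst_le`). A bin holds about 2^{n(R̃-R)} codewords, so the
expected number of competitors is exponentially small under the rate condition
(`expect_failure_le`), and the total overlap weight is at most 1 (`sum_overlap_le_one`).

The first event needs the overlap weight of the pairs that are not jointly typical. With the true
POVMs the weight of a pair would be λ^{AB}_{uv}, and the law of large numbers would suffice. The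
approximating operators need not be close to the POVM elements for this: an upper bound up to a
constant is enough. It comes from CσC ≤ 2σ + 2(1-C)σ(1-C) for a projector C (`trace_pinch_le`).
Removing Π̂ and Π_ρ this way costs a factor 4 per party and an error linear in the discarded weight,
while Π_{u^n} commutes with its state and is removed for free. The parties are treated one at a
time, the other party being absorbed into an operator dominated by a marginal of the state
(`exists_reduced_effect`, `sum_seqProb_mul_trace_dressedOp_le`, `sum_overlap_mul_le`).

For fixed small δ the resulting bound on the expectation tends to 0 as n grows and involves neither
N₁, N₂, η nor the default pair. It is thus eventually below δ², and the identity serves for both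
functions of δ. -/

theorem continuousOn_spectrum (M : Matrix κ κ ℂ) (f : ℝ → ℝ) : ContinuousOn f (spectrum ℝ M) :=
  M.finite_real_spectrum.continuousOn f

theorem cfc_mul_matrix (M : Matrix κ κ ℂ) (f g : ℝ → ℝ) :
    cfc f M * cfc g M = cfc (fun x => f x * g x) M :=
  (cfc_mul f g M (continuousOn_spectrum M f) (continuousOn_spectrum M g)).symm

theorem conjTranspose_cfc (M : Matrix κ κ ℂ) (f : ℝ → ℝ) :
    (cfc f M).conjTranspose = cfc f M :=
  (cfc_predicate (R := ℝ) (p := IsSelfAdjoint) f M : IsSelfAdjoint _)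

theorem cfc_nonneg_matrix {M : Matrix κ κ ℂ} {f : ℝ → ℝ} (h : ∀ x ∈ spectrum ℝ M, 0 ≤ f x) :
    0 ≤ cfc f M := cfc_nonneg h

theorem cfc_le_matrix {M : Matrix κ κ ℂ} {f g : ℝ → ℝ} (h : ∀ x ∈ spectrum ℝ M, f x ≤ g x) :
    cfc f M ≤ cfc g M :=
  cfc_mono h (continuousOn_spectrum M f) (continuousOn_spectrum M g)

theorem nonneg_of_mem_spectrum {M : Matrix κ κ ℂ} (hM : 0 ≤ M) :
    ∀ x ∈ spectrum ℝ M, 0 ≤ x := fun _ hx => spectrum_nonneg_of_nonneg hM hx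

theorem isSelfAdjoint_of_nonneg {M : Matrix κ κ ℂ} (hM : 0 ≤ M) : IsSelfAdjoint M :=
  .of_nonneg hM

theorem conjTranspose_of_nonneg {M : Matrix κ κ ℂ} (hM : 0 ≤ M) : M.conjTranspose = M :=
  isSelfAdjoint_of_nonneg hM

theorem conj_nonneg {τ : Type*} [Fintype τ] [DecidableEq τ] {M : Matrix κ κ ℂ} (hM : 0 ≤ M)
    (C : Matrix τ κ ℂ) : 0 ≤ C * M * C.conjTranspose :=
  ((Matrix.nonneg_iff_posSemidef.1 hM).mul_mul_conjTranspose_same C).nonneg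

theorem conj_le_conj {τ : Type*} [Fintype τ] [DecidableEq τ] {M N : Matrix κ κ ℂ} (h : M ≤ N)
    (C : Matrix τ κ ℂ) : C * M * C.conjTranspose ≤ C * N * C.conjTranspose := by
  have := conj_nonneg (sub_nonneg.2 h) C
  rwa [Matrix.mul_sub, Matrix.sub_mul, sub_nonneg] at this

theorem opSqrt_nonneg (M : Matrix κ κ ℂ) : 0 ≤ opSqrt M :=
  cfc_nonneg_matrix fun _ _ => Real.sqrt_nonneg _

theorem opSqrt_mul_self {M : Matrix κ κ ℂ} (hM : 0 ≤ M) : opSqrt M * opSqrt M = M := by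
  rw [opSqrt, cfc_mul_matrix]
  conv_rhs => rw [← cfc_id ℝ M (isSelfAdjoint_of_nonneg hM)]
  exact cfc_congr fun x hx => Real.mul_self_sqrt (nonneg_of_mem_spectrum hM x hx)

theorem conjTranspose_opSqrt (M : Matrix κ κ ℂ) : (opSqrt M).conjTranspose = opSqrt M :=
  conjTranspose_cfc _ _

theorem exists_eq_conjTranspose_mul_self {M : Matrix κ κ ℂ} (hM : 0 ≤ M) :
    ∃ C : Matrix κ κ ℂ, M = C.conjTranspose * C :=
  ⟨opSqrt M, by rw [conjTranspose_opSqrt, opSqrt_mul_self hM]⟩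

theorem trace_re_nonneg {M : Matrix κ κ ℂ} (hM : 0 ≤ M) : 0 ≤ M.trace.re :=
  (Complex.nonneg_iff.1 (Matrix.nonneg_iff_posSemidef.1 hM).trace_nonneg).1

theorem trace_mul_re_nonneg {M N : Matrix κ κ ℂ} (hM : 0 ≤ M) (hN : 0 ≤ N) :
    0 ≤ (M * N).trace.re := by
  obtain ⟨C, rfl⟩ := exists_eq_conjTranspose_mul_self hM
  rw [Matrix.mul_assoc, Matrix.trace_mul_comm]
  exact trace_re_nonneg (conj_nonneg hN C)

theorem trace_mul_re_mono_right {M N N' : Matrix κ κ ℂ} (hM : 0 ≤ M) (h : N ≤ N') :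
    (M * N).trace.re ≤ (M * N').trace.re := by
  have := trace_mul_re_nonneg hM (sub_nonneg.2 h)
  rwa [Matrix.mul_sub, Matrix.trace_sub, Complex.sub_re, sub_nonneg] at this

theorem trace_mul_re_mono_left {M M' N : Matrix κ κ ℂ} (hN : 0 ≤ N) (h : M ≤ M') :
    (M * N).trace.re ≤ (M' * N).trace.re := by
  rw [Matrix.trace_mul_comm M, Matrix.trace_mul_comm M']
  exact trace_mul_re_mono_right hN h

theorem trace_mul_re_le_of_le_one {M E : Matrix κ κ ℂ} (hM : 0 ≤ M) (hE : E ≤ 1) :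
    (M * E).trace.re ≤ M.trace.re := by
  simpa using trace_mul_re_mono_right hM hE

theorem trace_real_smul_re (c : ℝ) (M : Matrix κ κ ℂ) :
    ((c : ℂ) • M).trace.re = c * M.trace.re := by
  simp [Matrix.trace_smul]

/-- For self-adjoint X one has |X| = sgn(X) X, and -1 ≤ sgn(X) ≤ 1 bounds the trace of sgn(X)
against each positive term by the trace of that term. -/
theorem traceNorm_sum_le {ι : Type*} (s : Finset ι) (c : ι → ℝ) (T : ι → Matrix κ κ ℂ)
    (hT : ∀ i ∈ s, 0 ≤ T i) :
    traceNorm (∑ i ∈ s, (c i : ℂ) • T i) ≤ ∑ i ∈ s, |c i| * (T i).trace.re := by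
  set X := ∑ i ∈ s, (c i : ℂ) • T i with hXdef
  have hX : IsSelfAdjoint X := by
    refine isSelfAdjoint_sum s fun i hi => ?_
    refine IsSelfAdjoint.smul ?_ (isSelfAdjoint_of_nonneg (hT i hi))
    simp [isSelfAdjoint_iff]
  set g : ℝ → ℝ := fun x => if 0 ≤ x then 1 else -1 with hg
  have h1 : opSqrt (X.conjTranspose * X) = cfc g X * X := by
    have e1 : X.conjTranspose * X = cfc (fun x : ℝ => x * x) X := by
      have : X.conjTranspose = X := hX
      rw [this]
      conv_lhs => rw [← cfc_id ℝ X hX]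
      rw [cfc_mul_matrix]; rfl
    have e2 : cfc g X * X = cfc (fun x : ℝ => g x * x) X := by
      conv_lhs => rw [← cfc_id ℝ X hX]
      rw [cfc_id ℝ X hX]
      nth_rw 2 [← cfc_id ℝ X hX]
      rw [cfc_mul_matrix]; rfl
    rw [opSqrt, e1, e2, ← cfc_comp' Real.sqrt (fun x : ℝ => x * x) X
      (Real.continuous_sqrt.continuousOn) (continuousOn_spectrum X _)]
    congr 1
    ext x
    rw [Real.sqrt_mul_self_eq_abs]
    simp only [hg]
    split_ifs with h
    · simp [abs_of_nonneg h]
    · simp [abs_of_neg (not_le.1 h)]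
  have hg1 : cfc g X ≤ 1 := by
    rw [← cfc_one ℝ X hX]
    refine cfc_le_matrix fun x _ => ?_
    simp only [hg, Pi.one_apply]; split_ifs <;> norm_num
  have hg2 : -1 ≤ cfc g X := by
    rw [← cfc_one ℝ X hX, ← cfc_neg]
    refine cfc_le_matrix fun x _ => ?_
    simp only [hg, Pi.one_apply]; split_ifs <;> norm_num
  rw [traceNorm, h1]
  have h2 : (cfc g X * X).trace.re = ∑ i ∈ s, c i * (cfc g X * T i).trace.re := by
    conv_lhs => rw [hXdef, Matrix.mul_sum, Matrix.trace_sum, Complex.re_sum]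
    refine Finset.sum_congr rfl fun i _ => ?_
    rw [Matrix.mul_smul, trace_real_smul_re]
  rw [h2]
  refine Finset.sum_le_sum fun i hi => ?_
  have hle : |(cfc g X * T i).trace.re| ≤ (T i).trace.re := by
    rw [abs_le]
    constructor
    · simpa using trace_mul_re_mono_left (hT i hi) hg2
    · simpa using trace_mul_re_mono_left (hT i hi) hg1
  calc c i * (cfc g X * T i).trace.re ≤ |c i * (cfc g X * T i).trace.re| := le_abs_self _
    _ = |c i| * |(cfc g X * T i).trace.re| := abs_mul _ _
    _ ≤ _ := mul_le_mul_of_nonneg_left hle (abs_nonneg _)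

/-- With D = 1 - C the parallelogram identity reads (1-D)σ(1-D) + (1+D)σ(1+D) = 2σ + 2DσD, and the
second square is dropped. The loss is a factor 2 and an error linear in the discarded weight,
instead of the square root of a gentle-measurement bound. -/
theorem trace_pinch_le {C σ E : Matrix κ κ ℂ} (hC : C.conjTranspose = C) (hCC : C * C = C)
    (hσ : 0 ≤ σ) (hE : 0 ≤ E) (hE1 : E ≤ 1) :
    (C * σ * C * E).trace.re ≤ 2 * (σ * E).trace.re + 2 * ((1 - C) * σ).trace.re := by
  have h1 : C * σ * C ≤ (2 : ℝ) • σ + (2 : ℝ) • ((1 - C) * σ * (1 - C)) := by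
    -- This is the dropped square (1+D)σ(1+D); it equals the difference of the two sides.
    have h := conj_nonneg hσ (1 + (1 - C))
    rw [← sub_nonneg]
    convert h using 1
    rw [Matrix.conjTranspose_add, Matrix.conjTranspose_sub, hC]
    simp only [Matrix.conjTranspose_one, Matrix.sub_mul, Matrix.mul_sub, Matrix.add_mul,
      Matrix.mul_add, Matrix.one_mul, Matrix.mul_one, two_smul]
    abel
  have h2 := trace_mul_re_mono_left hE h1
  have h3 : 0 ≤ (1 - C) * σ * (1 - C) := by
    have h := conj_nonneg hσ (1 - C)
    rwa [Matrix.conjTranspose_sub, hC, Matrix.conjTranspose_one] at h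
  have h4 := trace_mul_re_le_of_le_one h3 hE1
  have h5 : ((1 - C) * σ * (1 - C)).trace = ((1 - C) * σ).trace := by
    rw [Matrix.trace_mul_comm, ← Matrix.mul_assoc]
    congr 2
    simp [Matrix.sub_mul, Matrix.mul_sub, hCC]
  rw [h5] at h4
  refine h2.trans ?_
  rw [Matrix.add_mul, Matrix.trace_add, Matrix.smul_mul, Matrix.smul_mul, Matrix.trace_smul,
    Matrix.trace_smul, Complex.add_re, Complex.smul_re, Complex.smul_re, smul_eq_mul, smul_eq_mul]
  linarith

theorem opSqrt_of_mul_self {T : Matrix κ κ ℂ} (hT : 0 ≤ T) : opSqrt (T * T) = T := by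
  have hT' := isSelfAdjoint_of_nonneg hT
  have e : T * T = cfc (fun x : ℝ => x * x) T := by
    conv_lhs => rw [← cfc_id ℝ T hT']
    rw [cfc_mul_matrix]; rfl
  rw [opSqrt, e, ← cfc_comp' Real.sqrt (fun x : ℝ => x * x) T
      (Real.continuous_sqrt.continuousOn) (continuousOn_spectrum T _)]
  conv_rhs => rw [← cfc_id ℝ T hT']
  exact cfc_congr fun x hx => Real.sqrt_mul_self (nonneg_of_mem_spectrum hT x hx)

theorem conjTranspose_opInvSqrt (M : Matrix κ κ ℂ) :
    (opInvSqrt M).conjTranspose = opInvSqrt M :=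
  conjTranspose_cfc _ _

theorem opInvSqrt_mul_mul_opInvSqrt_le {S : Matrix κ κ ℂ} (hS : 0 ≤ S) :
    opInvSqrt S * S * opInvSqrt S ≤ 1 := by
  have hS' := isSelfAdjoint_of_nonneg hS
  have e : opInvSqrt S * S * opInvSqrt S =
      cfc (fun x : ℝ => (Real.sqrt x)⁻¹ * x * (Real.sqrt x)⁻¹) S := by
    conv_lhs => rw [opInvSqrt]; arg 1; arg 2; rw [← cfc_id ℝ S hS']
    rw [cfc_mul_matrix, cfc_mul_matrix]; rfl
  rw [e, ← cfc_one ℝ S hS']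
  refine cfc_le_matrix fun x hx => ?_
  have hx0 := nonneg_of_mem_spectrum hS x hx
  rcases hx0.eq_or_lt with rfl | h
  · simp
  · have hs := Real.sqrt_pos.2 h
    have := Real.mul_self_sqrt hx0
    simp only [Pi.one_apply]
    apply le_of_eq
    field_simp
    nlinarith

theorem mul_eq_zero_of_conj_eq_zero {G Q : Matrix κ κ ℂ} (hG : 0 ≤ G)
    (h : Q.conjTranspose * G * Q = 0) : G * Q = 0 := by
  obtain ⟨C, rfl⟩ := exists_eq_conjTranspose_mul_self hG
  have h2 : (C * Q).conjTranspose * (C * Q) = 0 := by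
    rw [Matrix.conjTranspose_mul]; simpa [Matrix.mul_assoc] using h
  rw [Matrix.conjTranspose_mul_self_eq_zero] at h2
  rw [Matrix.mul_assoc, h2, Matrix.mul_zero]

/-- The product of the root and its generalized inverse is 1 - Q, with Q the projector onto the
kernel of S. Domination gives QGQ ≤ QSQ = 0, hence GQ = 0 by positivity of G, and 1 - Q acts
trivially on G from both sides. -/
theorem opSqrt_opInvSqrt_conj {S G : Matrix κ κ ℂ} (hS : 0 ≤ S) (hG : 0 ≤ G) (hGS : G ≤ S) :
    opSqrt S * (opInvSqrt S * G * opInvSqrt S) * opSqrt S = G := by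
  have hS' := isSelfAdjoint_of_nonneg hS
  set p : ℝ → ℝ := fun x => Real.sqrt x * (Real.sqrt x)⁻¹ with hp
  set Q := cfc (fun x => 1 - p x) S with hQ
  have hQ' : Q.conjTranspose = Q := conjTranspose_cfc _ _
  have e1 : opSqrt S * opInvSqrt S = 1 - Q := by
    rw [opSqrt, opInvSqrt, cfc_mul_matrix, hQ, eq_sub_iff_add_eq, ← cfc_add _ _ _
      (continuousOn_spectrum _ _) (continuousOn_spectrum _ _), ← cfc_one ℝ S hS']
    congr 1; ext x; simp [hp]
  have e2 : opInvSqrt S * opSqrt S = 1 - Q := by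
    rw [← e1, opSqrt, opInvSqrt, cfc_mul_matrix, cfc_mul_matrix]
    congr 1; ext x; ring
  have hQSQ : Q * S * Q = 0 := by
    have : Q * S * Q = cfc (fun x : ℝ => (1 - p x) * x * (1 - p x)) S := by
      conv_lhs => arg 1; arg 2; rw [← cfc_id ℝ S hS']
      rw [hQ, cfc_mul_matrix, cfc_mul_matrix]; rfl
    rw [this, ← cfc_zero ℝ S]
    refine cfc_congr fun x hx => ?_
    rcases (nonneg_of_mem_spectrum hS x hx).eq_or_lt with rfl | h
    · simp
    · simp [hp, mul_inv_cancel₀ (Real.sqrt_pos.2 h).ne']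
  have hQGQ : Q.conjTranspose * G * Q = 0 := by
    have h1 := conj_le_conj hGS Q
    have h2 := conj_nonneg hG Q
    rw [hQ'] at h1 h2 ⊢
    rw [hQSQ] at h1
    exact le_antisymm h1 h2
  have hGQ := mul_eq_zero_of_conj_eq_zero hG hQGQ
  have hQG : Q * G = 0 := by
    have := congrArg Matrix.conjTranspose hGQ
    rwa [Matrix.conjTranspose_mul, hQ', conjTranspose_of_nonneg hG, Matrix.conjTranspose_zero]
      at this
  calc opSqrt S * (opInvSqrt S * G * opInvSqrt S) * opSqrt S
      = (opSqrt S * opInvSqrt S) * G * (opInvSqrt S * opSqrt S) := by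
        simp only [Matrix.mul_assoc]
    _ = G := by
        rw [e1, e2, Matrix.sub_mul, Matrix.mul_sub, hQG]
        simp [hGQ]

end LinearAlgebra

/-! ### Tensor powers and reduced operators -/

section Tensor

open scoped MatrixOrder

variable {κ : Type*} [Fintype κ] [DecidableEq κ] {n : ℕ}

theorem tensorSeq_mul (M N : Fin n → Matrix κ κ ℂ) :
    tensorSeq M * tensorSeq N = tensorSeq fun k => M k * N k := by
  ext i j
  simp only [tensorSeq, Matrix.mul_apply, Matrix.of_apply, Fintype.prod_sum,
    Finset.prod_mul_distrib]

theorem conjTranspose_tensorSeq (M : Fin n → Matrix κ κ ℂ) :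
    (tensorSeq M).conjTranspose = tensorSeq fun k => (M k).conjTranspose := by
  ext i j
  simp [tensorSeq, Matrix.conjTranspose_apply]

theorem tensorSeq_diagonal (d : Fin n → κ → ℂ) :
    tensorSeq (fun k => Matrix.diagonal (d k)) = Matrix.diagonal fun y => ∏ k, d k (y k) := by
  ext i j
  simp only [tensorSeq, Matrix.of_apply]
  by_cases h : i = j
  · subst h; simp
  · rw [Matrix.diagonal_apply_ne _ h]
    obtain ⟨k, hk⟩ := Function.ne_iff.1 h
    exact Finset.prod_eq_zero (Finset.mem_univ k) (Matrix.diagonal_apply_ne _ hk)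

theorem tensorSeq_one : tensorSeq (fun _ : Fin n => (1 : Matrix κ κ ℂ)) = 1 := by
  have := tensorSeq_diagonal (κ := κ) (n := n) fun _ _ => 1
  simpa using this

theorem tensorSeq_smul (c : Fin n → ℂ) (M : Fin n → Matrix κ κ ℂ) :
    tensorSeq (fun k => c k • M k) = (∏ k, c k) • tensorSeq M := by
  ext i j
  simp [tensorSeq, Finset.prod_mul_distrib]

theorem trace_tensorSeq (M : Fin n → Matrix κ κ ℂ) :
    (tensorSeq M).trace = ∏ k, (M k).trace := by
  simp only [Matrix.trace, Matrix.diag, tensorSeq, Matrix.of_apply, Fintype.prod_sum]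

theorem sum_tensorSeq {X : Type*} [Fintype X] (M : X → Matrix κ κ ℂ) :
    ∑ x : Fin n → X, tensorSeq (fun k => M (x k)) = tensorPow n (∑ x, M x) := by
  ext i j
  simp only [tensorPow, tensorSeq, Matrix.sum_apply, Matrix.of_apply, Fintype.prod_sum]

theorem tensorSeq_nonneg {M : Fin n → Matrix κ κ ℂ} (h : ∀ k, 0 ≤ M k) : 0 ≤ tensorSeq M := by
  choose C hC using fun k => exists_eq_conjTranspose_mul_self (h k)
  have : tensorSeq M = (tensorSeq C).conjTranspose * tensorSeq C := by
    rw [conjTranspose_tensorSeq, tensorSeq_mul]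
    exact congrArg tensorSeq (funext hC)
  rw [this]
  exact (Matrix.posSemidef_conjTranspose_mul_self _).nonneg

theorem opSqrt_tensorPow {M : Matrix κ κ ℂ} (hM : 0 ≤ M) :
    opSqrt (tensorPow n M) = tensorPow n (opSqrt M) := by
  have h : tensorPow n M = tensorPow n (opSqrt M) * tensorPow n (opSqrt M) := by
    rw [tensorPow, tensorPow, tensorSeq_mul, opSqrt_mul_self hM]
  rw [h]
  exact opSqrt_of_mul_self (tensorSeq_nonneg fun _ => opSqrt_nonneg M)

theorem sum_seqProb {X : Type*} [Fintype X] (p : X → ℝ) :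
    ∑ x : Fin n → X, seqProb p x = (∑ x, p x) ^ n := by
  simp only [seqProb]
  rw [← Fintype.prod_sum fun (_ : Fin n) x => p x]
  simp

variable {τ : Type*} [Fintype τ] [DecidableEq τ]

/-- Regrouping the indices reduces statements about A^n ⊗ B^n to the plain tensor power over the
alphabet of pairs. -/
theorem tensorPowPair_eq_submatrix (M : Matrix (κ × τ) (κ × τ) ℂ) :
    tensorPowPair n M = (tensorPow n M).submatrix
      (Equiv.arrowProdEquivProdArrow (Fin n) (fun _ => κ) (fun _ => τ)).symm
      (Equiv.arrowProdEquivProdArrow (Fin n) (fun _ => κ) (fun _ => τ)).symm := by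
  ext i j
  rfl

theorem kronecker_tensorSeq_eq_submatrix (M : Fin n → Matrix κ κ ℂ) (N : Fin n → Matrix τ τ ℂ) :
    tensorSeq M ⊗ₖ tensorSeq N = (tensorSeq fun k => M k ⊗ₖ N k).submatrix
      (Equiv.arrowProdEquivProdArrow (Fin n) (fun _ => κ) (fun _ => τ)).symm
      (Equiv.arrowProdEquivProdArrow (Fin n) (fun _ => κ) (fun _ => τ)).symm := by
  ext i j
  simp only [tensorSeq, Matrix.kroneckerMap_apply, Matrix.of_apply, Matrix.submatrix_apply]
  rw [← Finset.prod_mul_distrib]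
  rfl

theorem trace_submatrix_equiv {α β : Type*} [Fintype α] [Fintype β] (e : α ≃ β)
    (M : Matrix β β ℂ) : (M.submatrix e e).trace = M.trace := by
  simp only [Matrix.trace, Matrix.diag, Matrix.submatrix_apply]
  exact e.sum_comp fun i => M i i

theorem tensorPowPair_nonneg {M : Matrix (κ × τ) (κ × τ) ℂ} (hM : 0 ≤ M) :
    0 ≤ tensorPowPair n M := by
  rw [tensorPowPair_eq_submatrix]
  exact ((Matrix.nonneg_iff_posSemidef.1 (tensorSeq_nonneg fun _ => hM)).submatrix _).nonneg

theorem trace_kronecker_tensorSeq_mul (M : Fin n → Matrix κ κ ℂ) (N : Fin n → Matrix τ τ ℂ)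
    (ρ : Matrix (κ × τ) (κ × τ) ℂ) :
    ((tensorSeq M ⊗ₖ tensorSeq N) * tensorPowPair n ρ).trace =
      ∏ k, ((M k ⊗ₖ N k) * ρ).trace := by
  rw [kronecker_tensorSeq_eq_submatrix, tensorPowPair_eq_submatrix, Matrix.submatrix_mul_equiv,
    trace_submatrix_equiv, tensorPow, tensorSeq_mul, trace_tensorSeq]

theorem reduceFst_tensorPowPair (M : Matrix (κ × τ) (κ × τ) ℂ) :
    reduceFst (tensorPowPair n M) = tensorPow n (reduceFst M) := by
  ext i j
  simp only [reduceFst, tensorPowPair, tensorPow, tensorSeq, Matrix.of_apply, Fintype.prod_sum]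

theorem reduceSnd_eq (M : Matrix (κ × τ) (κ × τ) ℂ) :
    reduceSnd M = reduceFst (M.submatrix Prod.swap Prod.swap) := rfl

theorem reduceFst_nonneg {M : Matrix (κ × τ) (κ × τ) ℂ} (hM : 0 ≤ M) : 0 ≤ reduceFst M := by
  have : reduceFst M = ∑ t, M.submatrix (fun i => (i, t)) (fun i => (i, t)) := by
    ext i j; simp [reduceFst, Matrix.sum_apply]
  rw [this]
  exact Finset.sum_nonneg fun t _ =>
    ((Matrix.nonneg_iff_posSemidef.1 hM).submatrix _).nonneg

theorem trace_reduceFst (M : Matrix (κ × τ) (κ × τ) ℂ) : (reduceFst M).trace = M.trace := by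
  simp only [reduceFst, Matrix.trace, Matrix.diag, Matrix.of_apply, Fintype.sum_prod_type]

theorem swap_submatrix_nonneg {M : Matrix (κ × τ) (κ × τ) ℂ} (hM : 0 ≤ M) :
    0 ≤ M.submatrix (Prod.swap : τ × κ → κ × τ) Prod.swap :=
  ((Matrix.nonneg_iff_posSemidef.1 hM).submatrix _).nonneg

theorem trace_kronecker_one_mul (X : Matrix κ κ ℂ) (M : Matrix (κ × τ) (κ × τ) ℂ) :
    ((X ⊗ₖ (1 : Matrix τ τ ℂ)) * M).trace = (X * reduceFst M).trace := by
  simp only [Matrix.trace, Matrix.diag, Matrix.mul_apply, Fintype.sum_prod_type,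
    Matrix.kroneckerMap_apply, reduceFst, Matrix.of_apply, Matrix.one_apply, mul_ite, mul_one,
    mul_zero, ite_mul, zero_mul, Finset.sum_ite_eq, Finset.mem_univ, if_true, Finset.mul_sum]
  exact Finset.sum_congr rfl fun i _ => Finset.sum_comm

theorem reduceFst_one_kronecker_comm (Y : Matrix τ τ ℂ) (M : Matrix (κ × τ) (κ × τ) ℂ) :
    reduceFst (((1 : Matrix κ κ ℂ) ⊗ₖ Y) * M) = reduceFst (M * ((1 : Matrix κ κ ℂ) ⊗ₖ Y)) := by
  ext i j
  simp only [reduceFst, Matrix.of_apply, Matrix.mul_apply, Fintype.sum_prod_type,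
    Matrix.kroneckerMap_apply, Matrix.one_apply, ite_mul, one_mul, zero_mul, mul_ite, mul_zero]
  simp only [Finset.sum_ite_irrel, Finset.sum_const_zero, Finset.sum_ite_eq, Finset.sum_ite_eq',
    Finset.mem_univ, if_true]
  rw [Finset.sum_comm]
  exact Finset.sum_congr rfl fun s _ => Finset.sum_congr rfl fun t _ => mul_comm _ _

/-- The partial trace is cyclic for operators acting on the traced factor only. Writing Y = C†C, one
factor can therefore be moved to the right, which leaves the reduction of a positive operator. -/
theorem reduceFst_one_kronecker_nonneg {M : Matrix (κ × τ) (κ × τ) ℂ} (hM : 0 ≤ M)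
    {Y : Matrix τ τ ℂ} (hY : 0 ≤ Y) : 0 ≤ reduceFst (((1 : Matrix κ κ ℂ) ⊗ₖ Y) * M) := by
  obtain ⟨C, rfl⟩ := exists_eq_conjTranspose_mul_self hY
  have h : (1 : Matrix κ κ ℂ) ⊗ₖ (C.conjTranspose * C) =
      ((1 : Matrix κ κ ℂ) ⊗ₖ C).conjTranspose * ((1 : Matrix κ κ ℂ) ⊗ₖ C) := by
    rw [Matrix.conjTranspose_kronecker, ← Matrix.mul_kronecker_mul]
    simp
  have h2 : ((1 : Matrix κ κ ℂ) ⊗ₖ C).conjTranspose = (1 : Matrix κ κ ℂ) ⊗ₖ C.conjTranspose := by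
    rw [Matrix.conjTranspose_kronecker]; simp
  rw [h, h2, Matrix.mul_assoc, reduceFst_one_kronecker_comm, ← h2]
  exact reduceFst_nonneg (conj_nonneg hM _)

/-- A functional `X ↦ Tr ((X ⊗ Y) ω)` with `0 ≤ Y ≤ 1` is represented by an operator dominated by
the reduced operator of `ω`. -/
theorem exists_reduced_effect {M : Matrix (κ × τ) (κ × τ) ℂ} (hM : 0 ≤ M)
    {Y : Matrix τ τ ℂ} (hY : 0 ≤ Y) (hY1 : Y ≤ 1) :
    ∃ G : Matrix κ κ ℂ, 0 ≤ G ∧ G ≤ reduceFst M ∧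
      ∀ X : Matrix κ κ ℂ, ((X ⊗ₖ Y) * M).trace = (X * G).trace := by
  refine ⟨reduceFst (((1 : Matrix κ κ ℂ) ⊗ₖ Y) * M), reduceFst_one_kronecker_nonneg hM hY, ?_, ?_⟩
  · have h := reduceFst_one_kronecker_nonneg (κ := κ) hM (sub_nonneg.2 hY1)
    rw [← sub_nonneg]
    convert h using 1
    have e : (1 : Matrix κ κ ℂ) ⊗ₖ (1 - Y) = 1 - (1 : Matrix κ κ ℂ) ⊗ₖ Y := by
      rw [eq_sub_iff_add_eq, ← Matrix.kronecker_add, sub_add_cancel, Matrix.one_kronecker_one]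
    rw [e, Matrix.sub_mul, Matrix.one_mul]
    ext i j
    simp [reduceFst]
  · intro X
    rw [← trace_kronecker_one_mul, ← Matrix.mul_assoc, ← Matrix.mul_kronecker_mul]
    simp

theorem exists_reduced_effect_snd {M : Matrix (κ × τ) (κ × τ) ℂ} (hM : 0 ≤ M)
    {X : Matrix κ κ ℂ} (hX : 0 ≤ X) (hX1 : X ≤ 1) :
    ∃ G : Matrix τ τ ℂ, 0 ≤ G ∧ G ≤ reduceSnd M ∧
      ∀ Y : Matrix τ τ ℂ, ((X ⊗ₖ Y) * M).trace = (Y * G).trace := by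
  obtain ⟨G, h0, h1, h2⟩ := exists_reduced_effect (swap_submatrix_nonneg hM) hX hX1
  refine ⟨G, h0, h1, fun Y => ?_⟩
  rw [← h2 Y, ← trace_submatrix_equiv (Equiv.prodComm τ κ) ((X ⊗ₖ Y) * M)]
  congr 1
  rw [← Matrix.submatrix_mul_equiv _ _ _ (Equiv.prodComm τ κ)]
  congr 1
  ext i j
  simp [mul_comm]

theorem reduceSnd_tensorPowPair (M : Matrix (κ × τ) (κ × τ) ℂ) :
    reduceSnd (tensorPowPair n M) = tensorPow n (reduceSnd M) := by
  ext i j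
  simp only [reduceSnd, tensorPowPair, tensorPow, tensorSeq, Matrix.of_apply, Fintype.prod_sum]

theorem kronecker_nonneg {X : Matrix κ κ ℂ} {Y : Matrix τ τ ℂ} (hX : 0 ≤ X) (hY : 0 ≤ Y) :
    0 ≤ X ⊗ₖ Y :=
  ((Matrix.nonneg_iff_posSemidef.1 hX).kronecker (Matrix.nonneg_iff_posSemidef.1 hY)).nonneg

end Tensor

/-! ### Typical projectors -/

section Projectors

open scoped MatrixOrder

variable {κ : Type*} [Fintype κ] [DecidableEq κ] {n : ℕ}

theorem frame_mul {V : Matrix κ κ ℂ} (hV : V.conjTranspose * V = 1) (D D' : Matrix κ κ ℂ) :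
    V * D * V.conjTranspose * (V * D' * V.conjTranspose) = V * (D * D') * V.conjTranspose := by
  calc V * D * V.conjTranspose * (V * D' * V.conjTranspose)
      = V * D * (V.conjTranspose * V) * D' * V.conjTranspose := by simp only [Matrix.mul_assoc]
    _ = _ := by rw [hV]; simp only [Matrix.mul_assoc, Matrix.mul_one]

theorem conjTranspose_eigVec_mul (M : Matrix κ κ ℂ) :
    (eigVec M).conjTranspose * eigVec M = 1 := by
  unfold eigVec
  split_ifs with h
  · exact Unitary.coe_star_mul_self h.eigenvectorUnitary
  · simp

theorem eq_eigVec_mul_diagonal {M : Matrix κ κ ℂ} (hM : M.IsHermitian) :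
    M = eigVec M * Matrix.diagonal (fun i => (eigVal M i : ℂ)) * (eigVec M).conjTranspose := by
  have h := hM.spectral_theorem
  rw [Unitary.conjStarAlgAut_apply] at h
  simp only [eigVec, eigVal, dif_pos hM]
  exact h

theorem cfc_eq_eigVec_mul_diagonal {M : Matrix κ κ ℂ} (hM : M.IsHermitian) (f : ℝ → ℝ) :
    cfc f M = eigVec M * Matrix.diagonal (fun i => (f (eigVal M i) : ℂ)) *
      (eigVec M).conjTranspose := by
  rw [hM.cfc_eq, Matrix.IsHermitian.cfc, Unitary.conjStarAlgAut_apply]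
  simp only [eigVec, eigVal, dif_pos hM]
  rfl

theorem trace_frame {V : Matrix κ κ ℂ} (hV : V.conjTranspose * V = 1) (D : Matrix κ κ ℂ) :
    (V * D * V.conjTranspose).trace = D.trace := by
  rw [Matrix.trace_mul_comm, ← Matrix.mul_assoc, hV, Matrix.one_mul]

theorem entropy_eq_sum {M : Matrix κ κ ℂ} (hM : M.IsHermitian) :
    entropy M = ∑ i, -(eigVal M i * Real.logb 2 (eigVal M i)) := by
  rw [entropy, cfc_eq_eigVec_mul_diagonal hM, trace_frame (conjTranspose_eigVec_mul M),
    Matrix.trace_diagonal, Complex.re_sum]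
  exact Finset.sum_congr rfl fun i _ => Complex.ofReal_re _

theorem eigVal_nonneg {M : Matrix κ κ ℂ} (hM : 0 ≤ M) (i : κ) : 0 ≤ eigVal M i := by
  have h := Matrix.nonneg_iff_posSemidef.1 hM
  simp only [eigVal, dif_pos h.1]
  exact h.eigenvalues_nonneg i

theorem sum_eigVal {M : Matrix κ κ ℂ} (hM : M.IsHermitian) : ∑ i, eigVal M i = M.trace.re := by
  conv_rhs => rw [eq_eigVec_mul_diagonal hM, trace_frame (conjTranspose_eigVec_mul M)]
  rw [Matrix.trace_diagonal, Complex.re_sum]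
  exact Finset.sum_congr rfl fun i _ => (Complex.ofReal_re _).symm

theorem conjTranspose_tensorSeq_eigVec_mul (M : Fin n → Matrix κ κ ℂ) :
    (tensorSeq fun k => eigVec (M k)).conjTranspose * (tensorSeq fun k => eigVec (M k)) = 1 := by
  rw [conjTranspose_tensorSeq, tensorSeq_mul, ← tensorSeq_one]
  congr 1
  ext1 k
  exact conjTranspose_eigVec_mul _

theorem tensorSeq_eq_frame {M : Fin n → Matrix κ κ ℂ} (hM : ∀ k, (M k).IsHermitian) :
    tensorSeq M = (tensorSeq fun k => eigVec (M k)) *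
      Matrix.diagonal (fun y => ∏ k, (eigVal (M k) (y k) : ℂ)) *
      (tensorSeq fun k => eigVec (M k)).conjTranspose := by
  rw [← tensorSeq_diagonal fun k i => (eigVal (M k) i : ℂ), conjTranspose_tensorSeq,
    tensorSeq_mul, tensorSeq_mul]
  congr 1
  ext1 k
  exact eq_eigVec_mul_diagonal (hM k)

/-- Compressing an operator to a set of its eigenvectors decreases it. -/
theorem frame_compress_le {ι : Type*} [Fintype ι] [DecidableEq ι] {V : Matrix ι ι ℂ}
    (hV : V.conjTranspose * V = 1) (p : ι → Prop) [DecidablePred p] {e : ι → ℝ}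
    (he : ∀ i, 0 ≤ e i) :
    V * Matrix.diagonal (fun i => if p i then (1 : ℂ) else 0) * V.conjTranspose *
      (V * Matrix.diagonal (fun i => (e i : ℂ)) * V.conjTranspose) *
      (V * Matrix.diagonal (fun i => if p i then (1 : ℂ) else 0) * V.conjTranspose) ≤
      V * Matrix.diagonal (fun i => (e i : ℂ)) * V.conjTranspose := by
  rw [frame_mul hV, frame_mul hV]
  refine conj_le_conj ?_ V
  rw [Matrix.diagonal_mul_diagonal, Matrix.diagonal_mul_diagonal, ← sub_nonneg,
    Matrix.diagonal_sub]
  refine (Matrix.PosSemidef.diagonal fun i => ?_).nonneg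
  by_cases h : p i
  · simp [h]
  · simpa [h] using he i

theorem conjTranspose_frame_ite {ι : Type*} [Fintype ι] [DecidableEq ι] (V : Matrix ι ι ℂ)
    (p : ι → Prop) [DecidablePred p] :
    (V * Matrix.diagonal (fun i => if p i then (1 : ℂ) else 0) * V.conjTranspose).conjTranspose =
      V * Matrix.diagonal (fun i => if p i then (1 : ℂ) else 0) * V.conjTranspose := by
  rw [Matrix.conjTranspose_mul, Matrix.conjTranspose_mul, Matrix.conjTranspose_conjTranspose,
    Matrix.diagonal_conjTranspose, Matrix.mul_assoc]
  congr 3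
  ext i
  simp only [Pi.star_apply]
  split_ifs <;> simp

theorem conjTranspose_typProj (ρ : Matrix κ κ ℂ) (δ : ℝ) (n : ℕ) :
    (typProj ρ δ n).conjTranspose = typProj ρ δ n := by
  classical
  exact conjTranspose_frame_ite _ _

theorem conjTranspose_condTypProj {X : Type*} (τ : X → Matrix κ κ ℂ) (δ : ℝ) (x : Fin n → X) :
    (condTypProj τ δ x).conjTranspose = condTypProj τ δ x := by
  classical
  exact conjTranspose_frame_ite _ _

theorem typProj_mul_self (ρ : Matrix κ κ ℂ) (δ : ℝ) (n : ℕ) :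
    typProj ρ δ n * typProj ρ δ n = typProj ρ δ n := by
  classical
  rw [typProj, tensorPow, frame_mul (conjTranspose_tensorSeq_eigVec_mul fun _ => ρ),
    Matrix.diagonal_mul_diagonal]
  congr 3
  ext i
  split_ifs <;> simp

theorem typProj_compress_le {ρ : Matrix κ κ ℂ} (hρ : 0 ≤ ρ) (δ : ℝ) (n : ℕ) :
    typProj ρ δ n * tensorPow n ρ * typProj ρ δ n ≤ tensorPow n ρ := by
  classical
  have h := frame_compress_le (conjTranspose_tensorSeq_eigVec_mul fun _ : Fin n => ρ)
    (EigTypical ρ δ Finset.univ) (e := fun y => ∏ k, eigVal ρ (y k))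
    fun y => Finset.prod_nonneg fun k _ => eigVal_nonneg hρ _
  have e : tensorPow n ρ = _ := tensorSeq_eq_frame (n := n) (M := fun _ => ρ)
    fun _ => (Matrix.nonneg_iff_posSemidef.1 hρ).1
  push_cast at h
  rw [← e] at h
  exact h

/-- The projector is diagonal in the product eigenbasis of the very state it compresses. Apart from
Hermiticity this is the only property of the conditionally typical projector that the proof needs.
-/
theorem condTypProj_compress_le {X : Type*} {τ : X → Matrix κ κ ℂ} (hτ : ∀ x, 0 ≤ τ x) (δ : ℝ)
    (x : Fin n → X) :
    condTypProj τ δ x * tensorSeq (fun k => τ (x k)) * condTypProj τ δ x ≤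
      tensorSeq fun k => τ (x k) := by
  classical
  have h := frame_compress_le (conjTranspose_tensorSeq_eigVec_mul fun k : Fin n => τ (x k))
    (fun y => ∀ s : X, EigTypical (τ s) δ (Finset.univ.filter fun k => x k = s) y)
    (e := fun y => ∏ k, eigVal (τ (x k)) (y k))
    fun y => Finset.prod_nonneg fun k _ => eigVal_nonneg (hτ _) _
  have e := tensorSeq_eq_frame (n := n) (M := fun k => τ (x k))
    fun k => (Matrix.nonneg_iff_posSemidef.1 (hτ (x k))).1
  push_cast at h
  rw [← e] at h
  exact h

open scoped Classical in
/-- The weight of `ρ^{⊗n}` outside its typical subspace. -/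
def atypicalWeight (ρ : Matrix κ κ ℂ) (δ : ℝ) (n : ℕ) : ℝ :=
  ∑ y : Fin n → κ, if EigTypical ρ δ Finset.univ y then 0 else ∏ k, eigVal ρ (y k)

theorem trace_one_sub_typProj_mul {ρ : Matrix κ κ ℂ} (hρ : 0 ≤ ρ) (δ : ℝ) (n : ℕ) :
    ((1 - typProj ρ δ n) * tensorPow n ρ).trace.re = atypicalWeight ρ δ n := by
  classical
  have hV := conjTranspose_tensorSeq_eigVec_mul fun _ : Fin n => ρ
  have e : tensorPow n ρ = _ := tensorSeq_eq_frame (n := n) (M := fun _ => ρ)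
    fun _ => (Matrix.nonneg_iff_posSemidef.1 hρ).1
  have e1 : (tensorPow n ρ).trace =
      (Matrix.diagonal fun y : Fin n → κ => ∏ k, (eigVal ρ (y k) : ℂ)).trace := by
    rw [e, trace_frame hV]
  have e2 : (typProj ρ δ n * tensorPow n ρ).trace =
      (Matrix.diagonal (fun y : Fin n → κ => if EigTypical ρ δ Finset.univ y then (1 : ℂ) else 0) *
        Matrix.diagonal fun y : Fin n → κ => ∏ k, (eigVal ρ (y k) : ℂ)).trace := by
    rw [typProj, e, tensorPow, frame_mul hV, trace_frame hV]
  rw [Matrix.sub_mul, Matrix.one_mul, Matrix.trace_sub, e1, e2,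
    Matrix.diagonal_mul_diagonal, Matrix.trace_diagonal, Matrix.trace_diagonal,
    ← Finset.sum_sub_distrib, Complex.re_sum, atypicalWeight]
  refine Finset.sum_congr rfl fun y _ => ?_
  split_ifs
  · simp
  · rw [zero_mul, sub_zero, ← Complex.ofReal_prod, Complex.ofReal_re]

/-- Each typical eigenvector carries an eigenvalue of at least 2^{-n(S+δ)}, and all eigenvalues sum
to 1. -/
theorem trace_typProj_le {ρ : Matrix κ κ ℂ} (hρ : 0 ≤ ρ) (htr : ρ.trace.re = 1) (δ : ℝ) (n : ℕ) :
    (typProj ρ δ n).trace.re ≤ (2 : ℝ) ^ ((n : ℝ) * (entropy ρ + δ)) := by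
  classical
  have hV := conjTranspose_tensorSeq_eigVec_mul fun _ : Fin n => ρ
  have h1 : (typProj ρ δ n).trace.re =
      ∑ y : Fin n → κ, if EigTypical ρ δ Finset.univ y then (1 : ℝ) else 0 := by
    rw [typProj, tensorPow, trace_frame hV, Matrix.trace_diagonal, Complex.re_sum]
    exact Finset.sum_congr rfl fun y _ => by split_ifs <;> simp
  have h2 : ∑ y : Fin n → κ, ∏ k, eigVal ρ (y k) = 1 := by
    have := sum_seqProb (n := n) (eigVal ρ)
    rw [sum_eigVal (Matrix.nonneg_iff_posSemidef.1 hρ).1, htr, one_pow] at this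
    exact this
  rw [h1]
  have hpos : (0 : ℝ) < (2 : ℝ) ^ ((n : ℝ) * (entropy ρ + δ)) := by positivity
  calc ∑ y : Fin n → κ, (if EigTypical ρ δ Finset.univ y then (1 : ℝ) else 0)
      ≤ ∑ y : Fin n → κ, (2 : ℝ) ^ ((n : ℝ) * (entropy ρ + δ)) * ∏ k, eigVal ρ (y k) := by
        refine Finset.sum_le_sum fun y _ => ?_
        split_ifs with h
        · have h3 := h.1
          rw [Finset.card_univ, Fintype.card_fin, Real.rpow_neg (by norm_num)] at h3
          calc (1 : ℝ) = (2 : ℝ) ^ ((n : ℝ) * (entropy ρ + δ)) *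
                ((2 : ℝ) ^ ((n : ℝ) * (entropy ρ + δ)))⁻¹ := (mul_inv_cancel₀ hpos.ne').symm
            _ ≤ _ := mul_le_mul_of_nonneg_left h3 hpos.le
        · exact mul_nonneg hpos.le (Finset.prod_nonneg fun k _ => eigVal_nonneg hρ _)
    _ = _ := by rw [← Finset.mul_sum, h2, mul_one]

end Projectors

/-! ### The approximating operators of one party -/

section OnePartyBounds

open scoped MatrixOrder

variable {κ X : Type*} [Fintype κ] [DecidableEq κ] [Fintype X] {n : ℕ}
  {ρ : Matrix κ κ ℂ} {M : X → Matrix κ κ ℂ}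

theorem outcomeProb_nonneg (hρ : 0 ≤ ρ) (hM : ∀ x, 0 ≤ M x) (x : X) : 0 ≤ outcomeProb ρ M x :=
  trace_mul_re_nonneg (hM x) hρ

theorem sum_outcomeProb (hM1 : ∑ x, M x = 1) : ∑ x, outcomeProb ρ M x = ρ.trace.re := by
  simp only [outcomeProb]
  rw [← Complex.re_sum, ← Matrix.trace_sum, ← Finset.sum_mul, hM1, Matrix.one_mul]

theorem opSqrt_conj_nonneg (ρ : Matrix κ κ ℂ) {Y : Matrix κ κ ℂ} (hY : 0 ≤ Y) :
    0 ≤ opSqrt ρ * Y * opSqrt ρ := by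
  have h := conj_nonneg hY (opSqrt ρ)
  rwa [conjTranspose_opSqrt] at h

theorem trace_opSqrt_conj (hρ : 0 ≤ ρ) (Y : Matrix κ κ ℂ) :
    (opSqrt ρ * Y * opSqrt ρ).trace = (Y * ρ).trace := by
  rw [Matrix.trace_mul_comm, ← Matrix.mul_assoc, opSqrt_mul_self hρ, Matrix.trace_mul_comm]

theorem real_smul_nonneg {Y : Matrix κ κ ℂ} (hY : 0 ≤ Y) {c : ℝ} (hc : 0 ≤ c) :
    0 ≤ (c : ℂ) • Y := by
  refine ((Matrix.nonneg_iff_posSemidef.1 hY).smul ?_).nonneg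
  exact_mod_cast hc

theorem canonState_nonneg (hρ : 0 ≤ ρ) (hM : ∀ x, 0 ≤ M x) (x : X) : 0 ≤ canonState ρ M x := by
  rw [canonState, ← Complex.ofReal_inv]
  exact real_smul_nonneg (opSqrt_conj_nonneg ρ (hM x)) (inv_nonneg.2 (outcomeProb_nonneg hρ hM x))

/-- Only λ_x = 0 needs an argument: the left side is then zero, and the right side is a positive
operator of trace λ_x = 0, hence zero as well. -/
theorem outcomeProb_smul_canonState (hρ : 0 ≤ ρ) (hM : ∀ x, 0 ≤ M x) (x : X) :
    (outcomeProb ρ M x : ℂ) • canonState ρ M x = opSqrt ρ * M x * opSqrt ρ := by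
  rw [canonState, smul_smul]
  by_cases h : outcomeProb ρ M x = 0
  · have h0 := opSqrt_conj_nonneg ρ (hM x)
    have hps := Matrix.nonneg_iff_posSemidef.1 h0
    have htr : (opSqrt ρ * M x * opSqrt ρ).trace = 0 := by
      have h1 : (opSqrt ρ * M x * opSqrt ρ).trace.re = 0 := by
        rw [trace_opSqrt_conj hρ]; exact h
      refine Complex.ext h1 ?_
      exact (Complex.nonneg_iff.1 hps.trace_nonneg).2.symm
    rw [hps.trace_eq_zero_iff.1 htr, smul_zero]
  · rw [mul_inv_cancel₀ (by exact_mod_cast h), one_smul]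

theorem seqProb_smul_canonState (hρ : 0 ≤ ρ) (hM : ∀ x, 0 ≤ M x) (u : Fin n → X) :
    (seqProb (outcomeProb ρ M) u : ℂ) • tensorSeq (fun k => canonState ρ M (u k)) =
      opSqrt (tensorPow n ρ) * tensorSeq (fun k => M (u k)) * opSqrt (tensorPow n ρ) := by
  rw [seqProb, Complex.ofReal_prod, ← tensorSeq_smul, opSqrt_tensorPow hρ, tensorPow,
    tensorSeq_mul, tensorSeq_mul]
  congr 1
  ext1 k
  exact outcomeProb_smul_canonState hρ hM _

theorem tensorPow_nonneg (hρ : 0 ≤ ρ) : 0 ≤ tensorPow n ρ := tensorSeq_nonneg fun _ => hρ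

theorem sum_tensorSeq_povm (hM1 : ∑ x, M x = 1) :
    ∑ u : Fin n → X, tensorSeq (fun k => M (u k)) = 1 := by
  rw [sum_tensorSeq, hM1, tensorPow, tensorSeq_one]

theorem sum_seqProb_smul_canonState (hρ : 0 ≤ ρ) (hM : ∀ x, 0 ≤ M x) (hM1 : ∑ x, M x = 1) :
    ∑ u : Fin n → X, (seqProb (outcomeProb ρ M) u : ℂ) •
      tensorSeq (fun k => canonState ρ M (u k)) = tensorPow n ρ := by
  simp only [seqProb_smul_canonState hρ hM]
  rw [← Finset.sum_mul, ← Finset.mul_sum, sum_tensorSeq_povm hM1, Matrix.mul_one,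
    opSqrt_mul_self (tensorPow_nonneg hρ)]

theorem seqProb_nonneg {p : X → ℝ} (hp : ∀ x, 0 ≤ p x) (u : Fin n → X) : 0 ≤ seqProb p u :=
  Finset.prod_nonneg fun _ _ => hp _

theorem typicalMass_le_one {p : X → ℝ} (hp : ∀ x, 0 ≤ p x) (hp1 : ∑ x, p x = 1) (δ : ℝ) (n : ℕ) :
    typicalMass p δ n ≤ 1 := by
  calc typicalMass p δ n ≤ ∑ u : Fin n → X, seqProb p u :=
        Finset.sum_le_sum_of_subset_of_nonneg (Finset.subset_univ _) fun u _ _ =>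
          seqProb_nonneg hp u
    _ = 1 := by rw [sum_seqProb, hp1, one_pow]

/-- The canonical product state compressed by its conditionally typical projector. -/
def condState (ρ : Matrix κ κ ℂ) (M : X → Matrix κ κ ℂ) (δ : ℝ) (u : Fin n → X) :
    Matrix (Fin n → κ) (Fin n → κ) ℂ :=
  condTypProj (canonState ρ M) δ u * tensorSeq (fun k => canonState ρ M (u k)) *
    condTypProj (canonState ρ M) δ u

theorem condState_nonneg (hρ : 0 ≤ ρ) (hM : ∀ x, 0 ≤ M x) (δ : ℝ) (u : Fin n → X) :
    0 ≤ condState ρ M δ u := by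
  have h := conj_nonneg (tensorSeq_nonneg fun k => canonState_nonneg hρ hM (u k))
    (condTypProj (canonState ρ M) δ u)
  rwa [conjTranspose_condTypProj] at h

theorem condState_le (hρ : 0 ≤ ρ) (hM : ∀ x, 0 ≤ M x) (δ : ℝ) (u : Fin n → X) :
    condState ρ M δ u ≤ tensorSeq fun k => canonState ρ M (u k) :=
  condTypProj_compress_le (canonState_nonneg hρ hM) δ u

theorem projState_eq (ρ : Matrix κ κ ℂ) (M : X → Matrix κ κ ℂ) (δ : ℝ) (u : Fin n → X) :
    projState ρ M δ u = typProj ρ δ n * condState ρ M δ u * typProj ρ δ n := by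
  simp only [projState, condState, Matrix.mul_assoc]

theorem projState_nonneg (hρ : 0 ≤ ρ) (hM : ∀ x, 0 ≤ M x) (δ : ℝ) (u : Fin n → X) :
    0 ≤ projState ρ M δ u := by
  have h := conj_nonneg (condState_nonneg hρ hM δ u) (typProj ρ δ n)
  rwa [conjTranspose_typProj, ← projState_eq] at h

theorem prunedProb_nonneg {p : X → ℝ} (hp : ∀ x, 0 ≤ p x) (δ : ℝ) (u : Fin n → X) :
    0 ≤ prunedProb p δ u := by
  unfold prunedProb typicalMass
  split_ifs
  · exact div_nonneg (seqProb_nonneg hp u) (Finset.sum_nonneg fun u _ => seqProb_nonneg hp u)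
  · exact le_rfl

theorem typicalMass_mul_prunedProb {p : X → ℝ} {δ : ℝ} (h : 0 < typicalMass p δ n)
    {u : Fin n → X} (hu : u ∈ typicalSet p δ n) :
    typicalMass p δ n * prunedProb p δ u = seqProb p u := by
  rw [prunedProb, if_pos hu, mul_div_cancel₀ _ h.ne']

theorem avgProjState_nonneg (hρ : 0 ≤ ρ) (hM : ∀ x, 0 ≤ M x) (δ : ℝ) (n : ℕ) :
    0 ≤ avgProjState ρ M δ n :=
  Finset.sum_nonneg fun u _ => real_smul_nonneg (projState_nonneg hρ hM δ u)
    (prunedProb_nonneg (outcomeProb_nonneg hρ hM) δ u)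

theorem typicalMass_smul_avgProjState {δ : ℝ}
    (h : 0 < typicalMass (outcomeProb ρ M) δ n) :
    (typicalMass (outcomeProb ρ M) δ n : ℂ) • avgProjState ρ M δ n =
      ∑ u ∈ typicalSet (outcomeProb ρ M) δ n,
        (seqProb (outcomeProb ρ M) u : ℂ) • projState ρ M δ u := by
  rw [avgProjState, Finset.smul_sum]
  refine Finset.sum_congr rfl fun u hu => ?_
  rw [smul_smul, ← Complex.ofReal_mul, typicalMass_mul_prunedProb h hu]

theorem avgProjState_mul_typProj (δ : ℝ) :
    avgProjState ρ M δ n * typProj ρ δ n = avgProjState ρ M δ n := by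
  rw [avgProjState, Finset.sum_mul]
  refine Finset.sum_congr rfl fun u _ => ?_
  rw [Matrix.smul_mul, projState_eq, Matrix.mul_assoc, typProj_mul_self]

theorem conjTranspose_cutProj (δ : ℝ) :
    (cutProj ρ M δ n).conjTranspose = cutProj ρ M δ n := conjTranspose_cfc _ _

theorem cutProj_mul_self (δ : ℝ) : cutProj ρ M δ n * cutProj ρ M δ n = cutProj ρ M δ n := by
  rw [cutProj, cfc_mul_matrix]
  congr 1
  ext t
  split_ifs <;> simp

/-- The cut-off is a spectral projector of the averaged operator. It commutes with the average,
though not necessarily with the individual terms. -/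
theorem cutProj_compress_le (hρ : 0 ≤ ρ) (hM : ∀ x, 0 ≤ M x) (δ : ℝ) :
    cutProj ρ M δ n * avgProjState ρ M δ n * cutProj ρ M δ n ≤ avgProjState ρ M δ n := by
  have hW := avgProjState_nonneg hρ hM δ n
  have hW' := isSelfAdjoint_of_nonneg hW
  set W := avgProjState ρ M δ n with hWdef
  conv_lhs => arg 1; arg 2; rw [← cfc_id ℝ W hW']
  conv_rhs => rw [← cfc_id ℝ W hW']
  rw [cutProj, cfc_mul_matrix, cfc_mul_matrix]
  refine cfc_le_matrix fun x hx => ?_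
  have := nonneg_of_mem_spectrum hW x hx
  simp only [id]
  split_ifs <;> simp [this]

/-- The discarded part is at most the threshold times the identity and lives on the typical
subspace, whose dimension is at most 2^{n(S+δ)}. The threshold ε 2^{-n(S+δ)} is scaled so that the
product is ε. -/
theorem trace_one_sub_cutProj_mul_le (hρ : 0 ≤ ρ) (htr : ρ.trace.re = 1) (hM : ∀ x, 0 ≤ M x)
    (hM1 : ∑ x, M x = 1) (δ : ℝ) :
    ((1 - cutProj ρ M δ n) * avgProjState ρ M δ n).trace.re ≤
      1 - typicalMass (outcomeProb ρ M) δ n := by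
  have hW := avgProjState_nonneg hρ hM δ n
  have hW' := isSelfAdjoint_of_nonneg hW
  have htm : 0 ≤ 1 - typicalMass (outcomeProb ρ M) δ n :=
    sub_nonneg.2 (typicalMass_le_one (outcomeProb_nonneg hρ hM)
      ((sum_outcomeProb hM1).trans htr) δ n)
  set θ := (1 - typicalMass (outcomeProb ρ M) δ n) *
      (2 : ℝ) ^ (-((n : ℝ) * (entropy ρ + δ))) with hθ
  have hθ0 : 0 ≤ θ := mul_nonneg htm (by positivity)
  have h1 : (1 - cutProj ρ M δ n) * avgProjState ρ M δ n ≤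
      (θ : ℂ) • (1 : Matrix (Fin n → κ) (Fin n → κ) ℂ) := by
    have e : (θ : ℂ) • (1 : Matrix (Fin n → κ) (Fin n → κ) ℂ) =
        cfc (fun _ : ℝ => θ) (avgProjState ρ M δ n) := by
      rw [cfc_const θ _ hW', Algebra.algebraMap_eq_smul_one]
      rfl
    rw [e, Matrix.sub_mul, Matrix.one_mul]
    set W := avgProjState ρ M δ n with hWdef
    conv_lhs => rw [← cfc_id ℝ W hW']
    rw [cfc_id ℝ W hW']
    nth_rw 1 [← cfc_id ℝ W hW']
    nth_rw 2 [← cfc_id ℝ W hW']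
    rw [cutProj, ← hWdef, cfc_mul_matrix, ← cfc_sub _ _ _ (continuousOn_spectrum _ _)
      (continuousOn_spectrum _ _)]
    refine cfc_le_matrix fun x hx => ?_
    simp only [id, ← hθ]
    split_ifs with h
    · simpa using hθ0
    · simpa using h
  have hP : 0 ≤ typProj ρ δ n := by
    have := conj_nonneg (zero_le_one' (Matrix (Fin n → κ) (Fin n → κ) ℂ)) (typProj ρ δ n)
    rwa [conjTranspose_typProj, Matrix.mul_one, typProj_mul_self] at this
  -- The average absorbs Π_ρ on the right, so testing against Π_ρ changes nothing on the left and
  -- replaces the full dimension by the trace of Π_ρ on the right.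
  have h2 := trace_mul_re_mono_left hP h1
  rw [Matrix.mul_assoc, avgProjState_mul_typProj, Matrix.smul_mul, Matrix.one_mul,
    trace_real_smul_re] at h2
  refine h2.trans ((mul_le_mul_of_nonneg_left (trace_typProj_le hρ htr δ n) hθ0).trans ?_)
  rw [hθ, mul_assoc, ← Real.rpow_add (by norm_num)]
  simp

/-- The operator `√(ρ^{⊗n})⁻¹ Λ_{u^n} √(ρ^{⊗n})⁻¹`. -/
def dressedOp (ρ : Matrix κ κ ℂ) (M : X → Matrix κ κ ℂ) (δ : ℝ) (u : Fin n → X) :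
    Matrix (Fin n → κ) (Fin n → κ) ℂ :=
  opInvSqrt (tensorPow n ρ) * approxOp ρ M δ u * opInvSqrt (tensorPow n ρ)

theorem approxOp_nonneg (hρ : 0 ≤ ρ) (hM : ∀ x, 0 ≤ M x) (δ : ℝ) (u : Fin n → X) :
    0 ≤ approxOp ρ M δ u := by
  have h := conj_nonneg (projState_nonneg hρ hM δ u) (cutProj ρ M δ n)
  rwa [conjTranspose_cutProj] at h

theorem dressedOp_nonneg (hρ : 0 ≤ ρ) (hM : ∀ x, 0 ≤ M x) (δ : ℝ) (u : Fin n → X) :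
    0 ≤ dressedOp ρ M δ u := by
  have h := conj_nonneg (approxOp_nonneg hρ hM δ u) (opInvSqrt (tensorPow n ρ))
  rwa [conjTranspose_opInvSqrt] at h

theorem real_smul_mono {Y Y' : Matrix κ κ ℂ} (h : Y ≤ Y') {c : ℝ} (hc : 0 ≤ c) :
    (c : ℂ) • Y ≤ (c : ℂ) • Y' := by
  have := real_smul_nonneg (sub_nonneg.2 h) hc
  rwa [smul_sub, sub_nonneg] at this

/-- Compressing each state by Π_{u^n} decreases it, and the full ensemble average is ρ^{⊗n}. The
remaining compression by Π_ρ is applied to the whole sum, where it commutes with the upper bound. -/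
theorem sum_seqProb_smul_projState_le (hρ : 0 ≤ ρ) (hM : ∀ x, 0 ≤ M x) (hM1 : ∑ x, M x = 1)
    (δ : ℝ) :
    ∑ u ∈ typicalSet (outcomeProb ρ M) δ n,
      (seqProb (outcomeProb ρ M) u : ℂ) • projState ρ M δ u ≤ tensorPow n ρ := by
  have hp := outcomeProb_nonneg hρ hM
  have h1 : ∑ u ∈ typicalSet (outcomeProb ρ M) δ n,
      (seqProb (outcomeProb ρ M) u : ℂ) • condState ρ M δ u ≤ tensorPow n ρ := by
    rw [← sum_seqProb_smul_canonState hρ hM hM1]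
    refine (Finset.sum_le_sum fun u _ => real_smul_mono (condState_le hρ hM δ u)
      (seqProb_nonneg hp u)).trans ?_
    exact Finset.sum_le_sum_of_subset_of_nonneg (Finset.subset_univ _) fun u _ _ =>
      real_smul_nonneg (tensorSeq_nonneg fun k => canonState_nonneg hρ hM _)
        (seqProb_nonneg hp u)
  have h2 := conj_le_conj h1 (typProj ρ δ n)
  rw [conjTranspose_typProj] at h2
  refine le_trans (le_of_eq ?_) (h2.trans (typProj_compress_le hρ δ n))
  rw [Finset.mul_sum, Finset.sum_mul]
  refine Finset.sum_congr rfl fun u _ => ?_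
  rw [Matrix.mul_smul, Matrix.smul_mul, projState_eq]

/-- The dressed operators, weighted by λ_u, form a sub-POVM. Without the dressing their sum is
dominated by ρ^{⊗n}, and the inverse roots turn that bound into the support projector. -/
theorem sum_seqProb_smul_dressedOp_le_one (hρ : 0 ≤ ρ) (hM : ∀ x, 0 ≤ M x)
    (hM1 : ∑ x, M x = 1) {δ : ℝ} (htm : 0 < typicalMass (outcomeProb ρ M) δ n) :
    ∑ u ∈ typicalSet (outcomeProb ρ M) δ n,
      (seqProb (outcomeProb ρ M) u : ℂ) • dressedOp ρ M δ u ≤ 1 := by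
  have h1 : ∑ u ∈ typicalSet (outcomeProb ρ M) δ n,
      (seqProb (outcomeProb ρ M) u : ℂ) • approxOp ρ M δ u ≤ tensorPow n ρ := by
    calc ∑ u ∈ typicalSet (outcomeProb ρ M) δ n,
          (seqProb (outcomeProb ρ M) u : ℂ) • approxOp ρ M δ u
        = (typicalMass (outcomeProb ρ M) δ n : ℂ) •
          (cutProj ρ M δ n * avgProjState ρ M δ n * cutProj ρ M δ n) := by
          rw [← Matrix.smul_mul, ← Matrix.mul_smul, typicalMass_smul_avgProjState htm,
            Finset.mul_sum, Finset.sum_mul]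
          refine Finset.sum_congr rfl fun u _ => ?_
          rw [Matrix.mul_smul, Matrix.smul_mul, approxOp]
      _ ≤ (typicalMass (outcomeProb ρ M) δ n : ℂ) • avgProjState ρ M δ n :=
          real_smul_mono (cutProj_compress_le hρ hM δ) htm.le
      _ ≤ tensorPow n ρ := by
          rw [typicalMass_smul_avgProjState htm]
          exact sum_seqProb_smul_projState_le hρ hM hM1 δ
  have h2 := conj_le_conj h1 (opInvSqrt (tensorPow n ρ))
  rw [conjTranspose_opInvSqrt] at h2
  refine le_trans (le_of_eq ?_) (h2.trans (opInvSqrt_mul_mul_opInvSqrt_le (tensorPow_nonneg hρ)))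
  rw [Finset.mul_sum, Finset.sum_mul]
  refine Finset.sum_congr rfl fun u _ => ?_
  rw [Matrix.mul_smul, Matrix.smul_mul, dressedOp]

/-- Replacing the POVM elements by the approximating operators costs a factor `4` and a small
additive error, against any family of effects dominated by `ρ^{⊗n}`. -/
theorem sum_seqProb_mul_trace_dressedOp_le (hρ : 0 ≤ ρ) (htr : ρ.trace.re = 1)
    (hM : ∀ x, 0 ≤ M x) (hM1 : ∑ x, M x = 1) {δ : ℝ}
    (htm : 0 < typicalMass (outcomeProb ρ M) δ n)
    (G : (Fin n → X) → Matrix (Fin n → κ) (Fin n → κ) ℂ) (hG : ∀ u, 0 ≤ G u)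
    (hGρ : ∀ u, G u ≤ tensorPow n ρ) :
    ∑ u ∈ typicalSet (outcomeProb ρ M) δ n,
      seqProb (outcomeProb ρ M) u * (dressedOp ρ M δ u * G u).trace.re ≤
    4 * ∑ u ∈ typicalSet (outcomeProb ρ M) δ n, (tensorSeq (fun k => M (u k)) * G u).trace.re +
      (4 * atypicalWeight ρ δ n + 2 * (1 - typicalMass (outcomeProb ρ M) δ n)) := by
  set S := tensorPow n ρ with hS
  have hS0 : 0 ≤ S := tensorPow_nonneg hρ
  set R := opInvSqrt S with hR
  have hRR : R.conjTranspose = R := conjTranspose_opInvSqrt S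
  have hp := outcomeProb_nonneg hρ hM
  set T := typicalSet (outcomeProb ρ M) δ n with hT
  set τ : (Fin n → X) → Matrix (Fin n → κ) (Fin n → κ) ℂ :=
    fun u => tensorSeq fun k => canonState ρ M (u k) with hτ
  have hτ0 : ∀ u, 0 ≤ τ u := fun u => tensorSeq_nonneg fun k => canonState_nonneg hρ hM _
  -- Moving the inverse roots from the approximating operator onto G turns the dominated operator G
  -- into an effect, as the pinching bound requires.
  set E : (Fin n → X) → Matrix (Fin n → κ) (Fin n → κ) ℂ := fun u => R * G u * R with hE
  have hE0 : ∀ u, 0 ≤ E u := fun u => by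
    have h := conj_nonneg (hG u) R
    rwa [hRR] at h
  have hE1 : ∀ u, E u ≤ 1 := fun u => by
    have h := conj_le_conj (hGρ u) R
    rw [hRR] at h
    exact h.trans (opInvSqrt_mul_mul_opInvSqrt_le hS0)
  have hP : 0 ≤ 1 - typProj ρ δ n := by
    have h := conj_nonneg (zero_le_one' (Matrix (Fin n → κ) (Fin n → κ) ℂ)) (1 - typProj ρ δ n)
    rw [Matrix.conjTranspose_sub, conjTranspose_typProj, Matrix.mul_one,
      Matrix.conjTranspose_one] at h
    simpa [Matrix.sub_mul, Matrix.mul_sub, typProj_mul_self] using h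
  -- Pinching is applied to Π̂ and then to Π_ρ, which gives 4 = 2·2 on the main term and on the
  -- error of Π_ρ, and 2 on the error of Π̂. Removing Π_{u^n} costs nothing, since its compression
  -- only decreases the state.
  have h1 : ∀ u, (dressedOp ρ M δ u * G u).trace.re ≤
      4 * (τ u * E u).trace.re + 4 * ((1 - typProj ρ δ n) * τ u).trace.re +
        2 * ((1 - cutProj ρ M δ n) * projState ρ M δ u).trace.re := fun u => by
    have e1 : (dressedOp ρ M δ u * G u).trace = (approxOp ρ M δ u * E u).trace := by
      rw [dressedOp, ← hS, ← hR, hE, Matrix.mul_assoc, Matrix.mul_assoc, Matrix.trace_mul_comm]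
      simp only [Matrix.mul_assoc]
    have a1 := trace_pinch_le (conjTranspose_cutProj (ρ := ρ) (M := M) (n := n) δ)
      (cutProj_mul_self δ) (projState_nonneg hρ hM δ u) (hE0 u) (hE1 u)
    have a2 := trace_pinch_le (conjTranspose_typProj ρ δ n)
      (typProj_mul_self ρ δ n) (condState_nonneg hρ hM δ u) (hE0 u) (hE1 u)
    rw [← projState_eq] at a2
    have a3 := trace_mul_re_mono_left (hE0 u) (condState_le hρ hM δ u)
    have a4 := trace_mul_re_mono_right hP (condState_le hρ hM δ u)
    rw [e1]
    rw [← approxOp] at a1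
    linarith
  -- The weighted state λ_u τ_u is the POVM element between two roots of ρ^{⊗n}. Those roots cancel
  -- the inverse roots in E because G is dominated by ρ^{⊗n}.
  have h2 : ∀ u, seqProb (outcomeProb ρ M) u * (τ u * E u).trace.re =
      (tensorSeq (fun k => M (u k)) * G u).trace.re := fun u => by
    rw [← trace_real_smul_re, ← Matrix.smul_mul, hτ, seqProb_smul_canonState hρ hM, ← hS,
      ← opSqrt_opInvSqrt_conj hS0 (hG u) (hGρ u), ← hR, Matrix.mul_assoc,
      Matrix.mul_assoc, Matrix.trace_mul_comm]
    congr 2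
    simp only [hE, Matrix.mul_assoc]
  have h3 : ∑ u ∈ T, seqProb (outcomeProb ρ M) u * ((1 - typProj ρ δ n) * τ u).trace.re ≤
      atypicalWeight ρ δ n := by
    rw [← trace_one_sub_typProj_mul hρ, ← sum_seqProb_smul_canonState hρ hM hM1,
      Matrix.mul_sum, Matrix.trace_sum, Complex.re_sum]
    simp only [Matrix.mul_smul, trace_real_smul_re]
    exact Finset.sum_le_sum_of_subset_of_nonneg (Finset.subset_univ _) fun u _ _ =>
      mul_nonneg (seqProb_nonneg hp u) (trace_mul_re_nonneg hP (hτ0 u))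
  -- The cut-off error is controlled only after averaging over u, so the weighted sum must be
  -- reassembled into the averaged operator first.
  have h4 : ∑ u ∈ T, seqProb (outcomeProb ρ M) u *
      ((1 - cutProj ρ M δ n) * projState ρ M δ u).trace.re ≤
      1 - typicalMass (outcomeProb ρ M) δ n := by
    have e : ∑ u ∈ T, seqProb (outcomeProb ρ M) u *
        ((1 - cutProj ρ M δ n) * projState ρ M δ u).trace.re =
        typicalMass (outcomeProb ρ M) δ n *
          ((1 - cutProj ρ M δ n) * avgProjState ρ M δ n).trace.re := by
      rw [← trace_real_smul_re, ← Matrix.mul_smul, typicalMass_smul_avgProjState htm,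
        Matrix.mul_sum, Matrix.trace_sum, Complex.re_sum]
      simp only [Matrix.mul_smul, trace_real_smul_re, hT]
    have h5 := trace_one_sub_cutProj_mul_le (n := n) hρ htr hM hM1 δ
    have h6 := typicalMass_le_one hp ((sum_outcomeProb hM1).trans htr) δ n
    rw [e]
    nlinarith [mul_le_mul_of_nonneg_left h5 htm.le]
  calc ∑ u ∈ T, seqProb (outcomeProb ρ M) u * (dressedOp ρ M δ u * G u).trace.re
      ≤ ∑ u ∈ T, seqProb (outcomeProb ρ M) u * (4 * (τ u * E u).trace.re +
          4 * ((1 - typProj ρ δ n) * τ u).trace.re +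
          2 * ((1 - cutProj ρ M δ n) * projState ρ M δ u).trace.re) :=
        Finset.sum_le_sum fun u _ => mul_le_mul_of_nonneg_left (h1 u) (seqProb_nonneg hp u)
    _ = 4 * ∑ u ∈ T, (tensorSeq (fun k => M (u k)) * G u).trace.re +
        (4 * ∑ u ∈ T, seqProb (outcomeProb ρ M) u * ((1 - typProj ρ δ n) * τ u).trace.re +
         2 * ∑ u ∈ T, seqProb (outcomeProb ρ M) u *
          ((1 - cutProj ρ M δ n) * projState ρ M δ u).trace.re) := by
        simp only [← h2, Finset.mul_sum, ← Finset.sum_add_distrib]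
        exact Finset.sum_congr rfl fun u _ => by ring
    _ ≤ _ := by linarith

end OnePartyBounds

/-! ### The approximating operators of two parties -/

section TwoPartyBounds

open scoped MatrixOrder

variable {a b U V : Type*} [Fintype a] [DecidableEq a] [Fintype b] [DecidableEq b]
  [Fintype U] [Fintype V] {n : ℕ}
  {ρ : Matrix (a × b) (a × b) ℂ} {MA : U → Matrix a a ℂ} {MB : V → Matrix b b ℂ}

theorem trace_mul_eq_ofReal {κ : Type*} [Fintype κ] [DecidableEq κ] {M N : Matrix κ κ ℂ}
    (hM : 0 ≤ M) (hN : 0 ≤ N) : (M * N).trace = ((M * N).trace.re : ℂ) := by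
  obtain ⟨C, rfl⟩ := exists_eq_conjTranspose_mul_self hM
  rw [Matrix.mul_assoc, Matrix.trace_mul_comm]
  have h := (Matrix.nonneg_iff_posSemidef.1 (conj_nonneg hN C)).trace_nonneg
  exact Complex.ext (Complex.ofReal_re _).symm (Complex.nonneg_iff.1 h).2.symm

theorem trace_povm_kronecker_mul (hρ : 0 ≤ ρ) (hMA : ∀ x, 0 ≤ MA x) (hMB : ∀ x, 0 ≤ MB x)
    (u : Fin n → U) (v : Fin n → V) :
    ((tensorSeq (fun k => MA (u k)) ⊗ₖ tensorSeq (fun k => MB (v k))) *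
      tensorPowPair n ρ).trace.re = seqProb (jointProb ρ MA MB) fun k => (u k, v k) := by
  rw [trace_kronecker_tensorSeq_mul, seqProb]
  have h : ∀ k, ((MA (u k) ⊗ₖ MB (v k)) * ρ).trace = (jointProb ρ MA MB (u k, v k) : ℂ) :=
    fun k => trace_mul_eq_ofReal (kronecker_nonneg (hMA _) (hMB _)) hρ
  simp only [h]
  rw [← Complex.ofReal_prod, Complex.ofReal_re]

theorem trace_reduceSnd (M : Matrix (a × b) (a × b) ℂ) : (reduceSnd M).trace = M.trace := by
  rw [reduceSnd_eq, trace_reduceFst]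
  exact trace_submatrix_equiv (Equiv.prodComm b a) M

theorem reduceSnd_nonneg {M : Matrix (a × b) (a × b) ℂ} (hM : 0 ≤ M) : 0 ≤ reduceSnd M := by
  rw [reduceSnd_eq]
  exact reduceFst_nonneg (swap_submatrix_nonneg hM)

/-- The trace of `(√ρ_A⁻¹ Λ_u √ρ_A⁻¹ ⊗ √ρ_B⁻¹ Λ_v √ρ_B⁻¹) ρ_{AB}` on `n` copies. -/
def overlap (ρ : Matrix (a × b) (a × b) ℂ) (MA : U → Matrix a a ℂ) (MB : V → Matrix b b ℂ)
    (δ : ℝ) (u : Fin n → U) (v : Fin n → V) : ℝ :=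
  ((dressedOp (reduceFst ρ) MA δ u ⊗ₖ dressedOp (reduceSnd ρ) MB δ v) *
    tensorPowPair n ρ).trace.re

theorem overlap_nonneg (hρ : 0 ≤ ρ) (hMA : ∀ x, 0 ≤ MA x) (hMB : ∀ x, 0 ≤ MB x) (δ : ℝ)
    (u : Fin n → U) (v : Fin n → V) : 0 ≤ overlap ρ MA MB δ u v :=
  trace_mul_re_nonneg (kronecker_nonneg (dressedOp_nonneg (reduceFst_nonneg hρ) hMA δ u)
    (dressedOp_nonneg (reduceSnd_nonneg hρ) hMB δ v)) (tensorPowPair_nonneg hρ)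

/-- The additive error made by one party. -/
def partyError {κ X : Type*} [Fintype κ] [DecidableEq κ] [Fintype X] (ρ : Matrix κ κ ℂ)
    (M : X → Matrix κ κ ℂ) (δ : ℝ) (n : ℕ) : ℝ :=
  4 * atypicalWeight ρ δ n + 2 * (1 - typicalMass (outcomeProb ρ M) δ n)

theorem sum_real_smul_kronecker_trace {ι κ τ : Type*} [Fintype κ] [DecidableEq κ] [Fintype τ]
    [DecidableEq τ] (s : Finset ι) (c : ι → ℝ) (X : Matrix κ κ ℂ) (Y : ι → Matrix τ τ ℂ)
    (S : Matrix (κ × τ) (κ × τ) ℂ) :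
    ((X ⊗ₖ ∑ i ∈ s, (c i : ℂ) • Y i) * S).trace.re =
      ∑ i ∈ s, c i * ((X ⊗ₖ Y i) * S).trace.re := by
  have h : X ⊗ₖ ∑ i ∈ s, (c i : ℂ) • Y i = ∑ i ∈ s, (c i : ℂ) • (X ⊗ₖ Y i) := by
    ext i j
    simp only [Matrix.kroneckerMap_apply, Matrix.sum_apply, Matrix.smul_apply, Finset.mul_sum,
      smul_eq_mul]
    exact Finset.sum_congr rfl fun _ _ => by ring
  rw [h, Matrix.sum_mul, Matrix.trace_sum, Complex.re_sum]
  simp only [Matrix.smul_mul, trace_real_smul_re]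

theorem sum_real_smul_kronecker_trace' {ι κ τ : Type*} [Fintype κ] [DecidableEq κ] [Fintype τ]
    [DecidableEq τ] (s : Finset ι) (c : ι → ℝ) (X : ι → Matrix κ κ ℂ) (Y : Matrix τ τ ℂ)
    (S : Matrix (κ × τ) (κ × τ) ℂ) :
    (((∑ i ∈ s, (c i : ℂ) • X i) ⊗ₖ Y) * S).trace.re =
      ∑ i ∈ s, c i * ((X i ⊗ₖ Y) * S).trace.re := by
  have h : (∑ i ∈ s, (c i : ℂ) • X i) ⊗ₖ Y = ∑ i ∈ s, (c i : ℂ) • (X i ⊗ₖ Y) := by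
    ext i j
    simp only [Matrix.kroneckerMap_apply, Matrix.sum_apply, Matrix.smul_apply, Finset.sum_mul,
      smul_eq_mul]
    exact Finset.sum_congr rfl fun _ _ => by ring
  rw [h, Matrix.sum_mul, Matrix.trace_sum, Complex.re_sum]
  simp only [Matrix.smul_mul, trace_real_smul_re]

theorem sum_smul_le_of_le {ι κ : Type*} [Fintype κ] [DecidableEq κ] {s : Finset ι} {c d : ι → ℝ}
    {Y : ι → Matrix κ κ ℂ} {N : Matrix κ κ ℂ} (hY : ∀ i, 0 ≤ Y i) (hcd : ∀ i, c i ≤ d i)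
    (h : ∑ i ∈ s, (d i : ℂ) • Y i ≤ N) : ∑ i ∈ s, (c i : ℂ) • Y i ≤ N := by
  refine (Finset.sum_le_sum fun i _ => ?_).trans h
  have := real_smul_nonneg (hY i) (sub_nonneg.2 (hcd i))
  rwa [Complex.ofReal_sub, sub_smul, sub_nonneg] at this

/-- A tensor product of two sub-POVMs has total weight at most 1. Party B is absorbed into an
operator below the marginal of A, which is then tested against the sub-POVM of A. -/
theorem sum_overlap_le_one (hρ : 0 ≤ ρ) (htr : ρ.trace.re = 1) (hMA : ∀ x, 0 ≤ MA x)
    (hMA1 : ∑ x, MA x = 1) (hMB : ∀ x, 0 ≤ MB x) (hMB1 : ∑ x, MB x = 1) {δ : ℝ}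
    (hA : 0 < typicalMass (outcomeProb (reduceFst ρ) MA) δ n)
    (hB : 0 < typicalMass (outcomeProb (reduceSnd ρ) MB) δ n) :
    ∑ u ∈ typicalSet (outcomeProb (reduceFst ρ) MA) δ n,
      ∑ v ∈ typicalSet (outcomeProb (reduceSnd ρ) MB) δ n,
        seqProb (outcomeProb (reduceFst ρ) MA) u * seqProb (outcomeProb (reduceSnd ρ) MB) v *
          overlap ρ MA MB δ u v ≤ 1 := by
  have hρA := reduceFst_nonneg hρ
  have hρB := reduceSnd_nonneg hρ
  have hY1 := sum_seqProb_smul_dressedOp_le_one (n := n) hρB hMB hMB1 hB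
  have hX1 := sum_seqProb_smul_dressedOp_le_one (n := n) hρA hMA hMA1 hA
  have hpB := outcomeProb_nonneg hρB hMB
  have hY0 : 0 ≤ ∑ v ∈ typicalSet (outcomeProb (reduceSnd ρ) MB) δ n,
      (seqProb (outcomeProb (reduceSnd ρ) MB) v : ℂ) • dressedOp (reduceSnd ρ) MB δ v :=
    Finset.sum_nonneg fun v _ =>
      real_smul_nonneg (dressedOp_nonneg hρB hMB δ v) (seqProb_nonneg hpB v)
  obtain ⟨G, hG0, hG1, hG⟩ := exists_reduced_effect (κ := Fin n → a)
    (tensorPowPair_nonneg (n := n) hρ) hY0 hY1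
  have e : ∑ u ∈ typicalSet (outcomeProb (reduceFst ρ) MA) δ n,
      ∑ v ∈ typicalSet (outcomeProb (reduceSnd ρ) MB) δ n,
        seqProb (outcomeProb (reduceFst ρ) MA) u * seqProb (outcomeProb (reduceSnd ρ) MB) v *
          overlap ρ MA MB δ u v =
      ((∑ u ∈ typicalSet (outcomeProb (reduceFst ρ) MA) δ n,
        (seqProb (outcomeProb (reduceFst ρ) MA) u : ℂ) • dressedOp (reduceFst ρ) MA δ u) *
          G).trace.re := by
    rw [← hG, sum_real_smul_kronecker_trace']
    simp only [sum_real_smul_kronecker_trace, Finset.mul_sum, overlap, mul_assoc]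
  rw [e]
  refine (trace_mul_re_mono_left hG0 hX1).trans ?_
  rw [Matrix.one_mul]
  have h1 := trace_re_nonneg (sub_nonneg.2 hG1)
  rw [Matrix.trace_sub, Complex.sub_re, reduceFst_tensorPowPair, tensorPow, trace_tensorSeq,
    trace_reduceFst, Finset.prod_const, Finset.card_univ, Fintype.card_fin] at h1
  have h2 : ρ.trace = 1 := by
    refine Complex.ext htr ?_
    exact (Complex.nonneg_iff.1 (Matrix.nonneg_iff_posSemidef.1 hρ).trace_nonneg).2.symm
  rw [h2, one_pow, Complex.one_re] at h1
  linarith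

/-- Against any `[0,1]`-valued test, the approximating operators of the two parties are dominated
by the POVMs, up to a constant factor and the errors of the parties. -/
theorem sum_overlap_mul_le (hρ : 0 ≤ ρ) (htr : ρ.trace.re = 1) (hMA : ∀ x, 0 ≤ MA x)
    (hMA1 : ∑ x, MA x = 1) (hMB : ∀ x, 0 ≤ MB x) (hMB1 : ∑ x, MB x = 1) {δ : ℝ}
    (hA : 0 < typicalMass (outcomeProb (reduceFst ρ) MA) δ n)
    (hB : 0 < typicalMass (outcomeProb (reduceSnd ρ) MB) δ n)
    (χ : (Fin n → U) → (Fin n → V) → ℝ) (hχ0 : ∀ u v, 0 ≤ χ u v) (hχ1 : ∀ u v, χ u v ≤ 1) :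
    ∑ u ∈ typicalSet (outcomeProb (reduceFst ρ) MA) δ n,
      ∑ v ∈ typicalSet (outcomeProb (reduceSnd ρ) MB) δ n,
        seqProb (outcomeProb (reduceFst ρ) MA) u * seqProb (outcomeProb (reduceSnd ρ) MB) v *
          overlap ρ MA MB δ u v * χ u v ≤
    16 * ∑ u ∈ typicalSet (outcomeProb (reduceFst ρ) MA) δ n,
      ∑ v ∈ typicalSet (outcomeProb (reduceSnd ρ) MB) δ n,
        χ u v * seqProb (jointProb ρ MA MB) (fun k => (u k, v k)) +
      (partyError (reduceFst ρ) MA δ n + 4 * partyError (reduceSnd ρ) MB δ n) := by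
  have hρA := reduceFst_nonneg hρ
  have hρB := reduceSnd_nonneg hρ
  have hS := tensorPowPair_nonneg (n := n) hρ
  have htrA : (reduceFst ρ).trace.re = 1 := by rw [trace_reduceFst, htr]
  have htrB : (reduceSnd ρ).trace.re = 1 := by rw [trace_reduceSnd, htr]
  have hpB := outcomeProb_nonneg hρB hMB
  set pA := outcomeProb (reduceFst ρ) MA with hpA_def
  set pB := outcomeProb (reduceSnd ρ) MB with hpB_def
  set TU := typicalSet pA δ n with hTU
  set TV := typicalSet pB δ n with hTV
  set S := tensorPowPair n ρ with hSdef
  -- First replacement: for fixed u, the approximating operators of B weighted by the test form an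
  -- effect, so that only A is replaced.
  set Y : (Fin n → U) → Matrix (Fin n → b) (Fin n → b) ℂ := fun u =>
    ∑ v ∈ TV, ((χ u v * seqProb pB v : ℝ) : ℂ) • dressedOp (reduceSnd ρ) MB δ v with hY
  have hY0 : ∀ u, 0 ≤ Y u := fun u => Finset.sum_nonneg fun v _ =>
    real_smul_nonneg (dressedOp_nonneg hρB hMB δ v) (mul_nonneg (hχ0 u v) (seqProb_nonneg hpB v))
  have hY1 : ∀ u, Y u ≤ 1 := fun u => sum_smul_le_of_le (fun v => dressedOp_nonneg hρB hMB δ v)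
    (fun v => mul_le_of_le_one_left (seqProb_nonneg hpB v) (hχ1 u v))
    (sum_seqProb_smul_dressedOp_le_one hρB hMB hMB1 hB)
  -- Second replacement: A is already represented by its true POVM, and for fixed v its elements
  -- weighted by the test again form an effect.
  set X : (Fin n → V) → Matrix (Fin n → a) (Fin n → a) ℂ := fun v =>
    ∑ u ∈ TU, ((χ u v : ℝ) : ℂ) • tensorSeq fun k => MA (u k) with hX
  have hMAn : ∀ u : Fin n → U, 0 ≤ tensorSeq fun k => MA (u k) :=
    fun u => tensorSeq_nonneg fun k => hMA _
  have hX0 : ∀ v, 0 ≤ X v := fun v => Finset.sum_nonneg fun u _ =>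
    real_smul_nonneg (hMAn u) (hχ0 u v)
  have hX1 : ∀ v, X v ≤ 1 := fun v => by
    refine sum_smul_le_of_le (d := fun _ => 1) hMAn (fun u => hχ1 u v) ?_
    rw [← sum_tensorSeq_povm (n := n) hMA1]
    simp only [Complex.ofReal_one, one_smul]
    exact Finset.sum_le_sum_of_subset_of_nonneg (Finset.subset_univ _) fun u _ _ => hMAn u
  choose G hG0 hG1 hG using fun u => exists_reduced_effect (κ := Fin n → a) hS (hY0 u) (hY1 u)
  choose H hH0 hH1 hH using fun v => exists_reduced_effect_snd (τ := Fin n → b) hS (hX0 v) (hX1 v)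
  have s1 := sum_seqProb_mul_trace_dressedOp_le hρA htrA hMA hMA1 hA G hG0
    (fun u => (hG1 u).trans (reduceFst_tensorPowPair ρ).le)
  have s2 := sum_seqProb_mul_trace_dressedOp_le hρB htrB hMB hMB1 hB H hH0
    (fun v => (hH1 v).trans (reduceSnd_tensorPowPair ρ).le)
  have e1 : ∑ u ∈ TU, seqProb pA u * (dressedOp (reduceFst ρ) MA δ u * G u).trace.re =
      ∑ u ∈ TU, ∑ v ∈ TV, seqProb pA u * seqProb pB v * overlap ρ MA MB δ u v * χ u v := by
    refine Finset.sum_congr rfl fun u _ => ?_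
    rw [← hG, hY, sum_real_smul_kronecker_trace, Finset.mul_sum]
    exact Finset.sum_congr rfl fun v _ => by rw [overlap]; ring
  -- The main term left by the replacement for A is the starting point of the replacement for B.
  -- Chaining them gives the constant 16 = 4·4 and the weight 4 on the error of B.
  have e2 : ∑ u ∈ TU, (tensorSeq (fun k => MA (u k)) * G u).trace.re =
      ∑ v ∈ TV, seqProb pB v * (dressedOp (reduceSnd ρ) MB δ v * H v).trace.re := by
    simp only [← hG, ← hH, hX, hY, sum_real_smul_kronecker_trace, sum_real_smul_kronecker_trace',
      Finset.mul_sum]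
    rw [Finset.sum_comm]
    exact Finset.sum_congr rfl fun v _ => Finset.sum_congr rfl fun u _ => by ring
  have e3 : ∑ v ∈ TV, (tensorSeq (fun k => MB (v k)) * H v).trace.re =
      ∑ u ∈ TU, ∑ v ∈ TV, χ u v * seqProb (jointProb ρ MA MB) (fun k => (u k, v k)) := by
    simp only [← hH, hX, sum_real_smul_kronecker_trace', hSdef,
      trace_povm_kronecker_mul hρ hMA hMB]
    exact Finset.sum_comm
  rw [← e1, ← e3, partyError, partyError]
  rw [e2] at s1
  linarith

end TwoPartyBounds

/-! ### Laws of large numbers for product distributions -/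

section LawOfLargeNumbers

open Filter Topology

variable {X : Type*} [Fintype X]

theorem sum_seqProb_succ (p : X → ℝ) {n : ℕ} (F : (Fin (n + 1) → X) → ℝ) :
    ∑ x : Fin (n + 1) → X, seqProb p x * F x =
      ∑ a, p a * ∑ x : Fin n → X, seqProb p x * F (Fin.cons a x) := by
  rw [← (Fin.consEquiv fun _ : Fin (n + 1) => X).sum_comp, Fintype.sum_prod_type]
  refine Finset.sum_congr rfl fun a _ => ?_
  rw [Finset.mul_sum]
  refine Finset.sum_congr rfl fun x _ => ?_
  simp only [Fin.consEquiv, Equiv.coe_fn_mk, seqProb, Fin.prod_univ_succ, Fin.cons_zero,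
    Fin.cons_succ]
  ring

theorem sum_seqProb_eq_one {p : X → ℝ} (hp : ∑ x, p x = 1) (n : ℕ) :
    ∑ x : Fin n → X, seqProb p x = 1 := by rw [sum_seqProb, hp, one_pow]

theorem sum_seqProb_mul_sum {p g : X → ℝ} (hp : ∑ x, p x = 1) (hg : ∑ x, p x * g x = 0) (n : ℕ) :
    ∑ x : Fin n → X, seqProb p x * ∑ k, g (x k) = 0 := by
  induction n with
  | zero => simp
  | succ n ih =>
    rw [sum_seqProb_succ]
    simp only [Fin.sum_univ_succ, Fin.cons_zero, Fin.cons_succ, mul_add, Finset.sum_add_distrib,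
      ih, add_zero, ← Finset.sum_mul, sum_seqProb_eq_one hp, one_mul, hg]

/-- Variances of independent letters add: after splitting off the first letter, the cross term
vanishes because the remaining centred sum has mean zero. -/
theorem sum_seqProb_mul_sum_sq {p g : X → ℝ} (hp : ∑ x, p x = 1) (hg : ∑ x, p x * g x = 0)
    (n : ℕ) :
    ∑ x : Fin n → X, seqProb p x * (∑ k, g (x k)) ^ 2 = n * ∑ x, p x * g x ^ 2 := by
  induction n with
  | zero => simp
  | succ n ih =>
    rw [sum_seqProb_succ]
    have h : ∀ a, ∑ x : Fin n → X, seqProb p x * (∑ k, g ((Fin.cons a x : Fin (n + 1) → X) k)) ^ 2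
        = g a ^ 2 + n * ∑ x, p x * g x ^ 2 := fun a => by
      have e : ∀ x : Fin n → X,
          seqProb p x * (∑ k, g ((Fin.cons a x : Fin (n + 1) → X) k)) ^ 2 =
          g a ^ 2 * seqProb p x + 2 * g a * (seqProb p x * ∑ k, g (x k)) +
            seqProb p x * (∑ k, g (x k)) ^ 2 := fun x => by
        simp only [Fin.sum_univ_succ, Fin.cons_zero, Fin.cons_succ]
        ring
      simp only [e, Finset.sum_add_distrib, ← Finset.mul_sum, ih, sum_seqProb_eq_one hp,
        sum_seqProb_mul_sum hp hg]
      ring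
    simp only [h, mul_add, Finset.sum_add_distrib, ← Finset.sum_mul, hp]
    push_cast
    ring

-- Chebyshev's inequality: the second moment of the centred sum is linear in n, while the squared
-- tolerance grows like n².
open scoped Classical in
theorem tendsto_sum_seqProb_deviation {p : X → ℝ} (hp0 : ∀ x, 0 ≤ p x) (hp : ∑ x, p x = 1)
    (f : X → ℝ) {δ : ℝ} (hδ : 0 < δ) :
    Tendsto (fun n : ℕ => ∑ x : Fin n → X,
      if |∑ k, f (x k) - n * ∑ s, p s * f s| ≤ n * δ then 0 else seqProb p x) atTop (𝓝 0) := by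
  set m := ∑ s, p s * f s with hm
  set g : X → ℝ := fun s => f s - m with hg_def
  have hg : ∑ x, p x * g x = 0 := by
    simp only [hg_def, mul_sub, Finset.sum_sub_distrib, ← Finset.sum_mul, hp, ← hm]
    ring
  set C := ∑ x, p x * g x ^ 2 with hC
  have hlim : Tendsto (fun n : ℕ => C / δ ^ 2 / (n : ℝ)) atTop (𝓝 0) :=
    tendsto_const_div_atTop_nhds_zero_nat _
  refine tendsto_of_tendsto_of_tendsto_of_le_of_le' tendsto_const_nhds hlim
    (Eventually.of_forall fun n => Finset.sum_nonneg fun x _ => ?_) ?_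
  · split_ifs
    · exact le_rfl
    · exact seqProb_nonneg hp0 x
  filter_upwards [eventually_gt_atTop 0] with n hn
  have hn' : (0 : ℝ) < n := by exact_mod_cast hn
  have h2 := sum_seqProb_mul_sum_sq hp hg n
  have h3 : ∑ x : Fin n → X,
      (if |∑ k, f (x k) - n * m| ≤ n * δ then 0 else seqProb p x) ≤
      ∑ x : Fin n → X, ((n * δ) ^ 2)⁻¹ * (seqProb p x * (∑ k, g (x k)) ^ 2) := by
    refine Finset.sum_le_sum fun x _ => ?_
    have hs := seqProb_nonneg hp0 x
    split_ifs with h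
    · positivity
    · have e : ∑ k, g (x k) = ∑ k, f (x k) - n * m := by
        simp [hg_def, Finset.sum_sub_distrib]
      rw [e]
      have h4 : (n * δ) ^ 2 ≤ (∑ k, f (x k) - n * m) ^ 2 := by
        rw [← sq_abs (∑ k, f (x k) - n * m)]
        exact pow_le_pow_left₀ (by positivity) (not_le.1 h).le 2
      have hpos : 0 < (n * δ) ^ 2 := by positivity
      rw [inv_mul_eq_div, le_div_iff₀ hpos]
      exact mul_le_mul_of_nonneg_left h4 hs
  refine h3.trans (le_of_eq ?_)
  rw [← Finset.mul_sum, h2, ← hC]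
  field_simp

/-- An atypical sequence either has a letter with a deviating frequency, which is the law of large
numbers for the indicator of that letter, or contains a letter of probability 0 and has no mass. A
union bound over the finite alphabet concludes. -/
theorem tendsto_typicalMass {p : X → ℝ} (hp0 : ∀ x, 0 ≤ p x) (hp : ∑ x, p x = 1) {δ : ℝ}
    (hδ : 0 < δ) : Tendsto (fun n => typicalMass p δ n) atTop (𝓝 1) := by
  classical
  have h0 : Tendsto (fun n : ℕ => ∑ s : X, ∑ x : Fin n → X,
      if |∑ k, (if x k = s then (1 : ℝ) else 0) - n * ∑ t, p t * (if t = s then (1 : ℝ) else 0)|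
        ≤ n * δ then 0 else seqProb p x) atTop (𝓝 0) := by
    have := tendsto_finsetSum (Finset.univ : Finset X) fun s _ =>
      tendsto_sum_seqProb_deviation hp0 hp (fun t => if t = s then (1 : ℝ) else 0) hδ
    simpa using this
  have h1 : Tendsto (fun n : ℕ => 1 - ∑ s : X, ∑ x : Fin n → X,
      if |∑ k, (if x k = s then (1 : ℝ) else 0) - n * ∑ t, p t * (if t = s then (1 : ℝ) else 0)|
        ≤ n * δ then 0 else seqProb p x) atTop (𝓝 1) := by
    simpa using h0.const_sub 1
  refine tendsto_of_tendsto_of_tendsto_of_le_of_le' h1 tendsto_const_nhds ?_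
    (Eventually.of_forall fun n => typicalMass_le_one hp0 hp δ n)
  filter_upwards [eventually_gt_atTop 0] with n hn
  have hn' : (0 : ℝ) < n := by exact_mod_cast hn
  have e1 : (1 : ℝ) = typicalMass p δ n +
      ∑ x : Fin n → X, if x ∈ typicalSet p δ n then 0 else seqProb p x := by
    rw [← sum_seqProb_eq_one hp n, typicalMass,
      ← Finset.sum_filter_add_sum_filter_not Finset.univ (· ∈ typicalSet p δ n),
      Finset.filter_mem_eq_inter, Finset.univ_inter, Finset.sum_filter]
    simp only [ite_not]
  refine sub_le_iff_le_add.2 (e1.le.trans (add_le_add_right ?_ _))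
  rw [Finset.sum_comm]
  refine Finset.sum_le_sum fun x _ => ?_
  have hnn : ∀ s ∈ (Finset.univ : Finset X), 0 ≤
      (if |∑ k, (if x k = s then (1 : ℝ) else 0) - n * ∑ t, p t * (if t = s then (1 : ℝ) else 0)|
        ≤ n * δ then 0 else seqProb p x) := fun s _ => by
    split_ifs
    · exact le_rfl
    · exact seqProb_nonneg hp0 x
  by_cases hx : x ∈ typicalSet p δ n
  · rw [if_pos hx]
    exact Finset.sum_nonneg hnn
  · rw [if_neg hx]
    have hx' : ¬ ∀ s : X,
        |((Finset.univ.filter fun k => x k = s).card : ℝ) / n - p s| ≤ δ ∧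
          (p s = 0 → ∀ k, x k ≠ s) := fun h => hx (by
        simp only [typicalSet, Finset.mem_filter, Finset.mem_univ, true_and]; exact h)
    push Not at hx'
    obtain ⟨s, hs⟩ := hx'
    by_cases hd : |((Finset.univ.filter fun k => x k = s).card : ℝ) / n - p s| ≤ δ
    · obtain ⟨hps, k, hk⟩ := hs hd
      have : seqProb p x = 0 := Finset.prod_eq_zero (Finset.mem_univ k) (by rw [hk, hps])
      rw [this] at hnn ⊢
      exact Finset.sum_nonneg hnn
    · refine le_trans (le_of_eq ?_) (Finset.single_le_sum hnn (Finset.mem_univ s))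
      rw [if_neg]
      intro h
      apply hd
      have e : ((Finset.univ.filter fun k => x k = s).card : ℝ) / n - p s =
          (∑ k, (if x k = s then (1 : ℝ) else 0) -
            n * ∑ t, p t * (if t = s then (1 : ℝ) else 0)) / n := by
        simp
        field_simp
      rw [e, abs_div, abs_of_pos hn', div_le_iff₀ hn', mul_comm δ]
      exact h

/-- The eigenvalues form a probability distribution, and the random variable -log₂(eigenvalue) has
mean S(ρ). Typicality of the labels is exactly the law-of-large-numbers event for it. -/
theorem tendsto_atypicalWeight {κ : Type*} [Fintype κ] [DecidableEq κ] {ρ : Matrix κ κ ℂ}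
    (hρ : ρ.PosSemidef) (htr : ρ.trace.re = 1) {δ : ℝ} (hδ : 0 < δ) :
    Tendsto (fun n => atypicalWeight ρ δ n) atTop (𝓝 0) := by
  classical
  have he0 : ∀ i, 0 ≤ eigVal ρ i := fun i => by
    simp only [eigVal, dif_pos hρ.1]
    exact hρ.eigenvalues_nonneg i
  have he1 : ∑ i, eigVal ρ i = 1 := (sum_eigVal hρ.1).trans htr
  have h := tendsto_sum_seqProb_deviation he0 he1 (fun i => -Real.logb 2 (eigVal ρ i)) hδ
  have hm : ∑ i, eigVal ρ i * -Real.logb 2 (eigVal ρ i) = entropy ρ := by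
    rw [entropy_eq_sum hρ.1]
    exact Finset.sum_congr rfl fun i _ => by ring
  rw [hm] at h
  refine h.congr fun n => Finset.sum_congr rfl fun y _ => ?_
  -- With a zero eigenvalue the convention log 0 = 0 may separate the two notions of typicality, but
  -- such a label sequence has weight 0.
  by_cases hy : ∃ k, eigVal ρ (y k) = 0
  · obtain ⟨k, hk⟩ := hy
    have h0 : ∏ k, eigVal ρ (y k) = 0 := Finset.prod_eq_zero (Finset.mem_univ k) hk
    simp [seqProb, h0]
  · push Not at hy
    have hpos : ∀ k, 0 < eigVal ρ (y k) := fun k => (he0 _).lt_of_ne' (hy k)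
    have hprod : ∏ k, eigVal ρ (y k) = (2 : ℝ) ^ (-∑ k, -Real.logb 2 (eigVal ρ (y k))) := by
      rw [Finset.sum_neg_distrib, neg_neg, Real.rpow_sum_of_pos (by norm_num)]
      exact Finset.prod_congr rfl fun k _ =>
        (Real.rpow_logb (by norm_num) (by norm_num) (hpos k)).symm
    have hiff : |∑ k, -Real.logb 2 (eigVal ρ (y k)) - n * entropy ρ| ≤ n * δ ↔
        EigTypical ρ δ Finset.univ y := by
      rw [EigTypical, hprod, Finset.card_univ, Fintype.card_fin,
        Real.rpow_le_rpow_left_iff (by norm_num), Real.rpow_le_rpow_left_iff (by norm_num), abs_le]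
      constructor
      · rintro ⟨h1, h2⟩
        constructor <;> linarith
      · rintro ⟨h1, h2⟩
        constructor <;> linarith
    by_cases ht : EigTypical ρ δ Finset.univ y
    · rw [if_pos ht, if_pos (hiff.2 ht)]
    · rw [if_neg ht, if_neg fun hh => ht (hiff.1 hh), seqProb]

end LawOfLargeNumbers

/-! ### Mutual information and joint typicality -/

section Packing

variable {U V : Type*} [Fintype U] [Fintype V]

/-- The Shannon entropy of a finite distribution, in bits. -/
def shannon {X : Type*} [Fintype X] (p : X → ℝ) : ℝ := ∑ x, -(p x * Real.logb 2 (p x))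

/-- The constant in the exponent of the joint typicality bound. -/
def typicalityConst (q : U × V → ℝ) (pU : U → ℝ) (pV : V → ℝ) : ℝ :=
  ∑ s, |Real.logb 2 (pU s.1) + Real.logb 2 (pV s.2) - Real.logb 2 (q s)|

theorem pos_of_mem_typicalSet {X : Type*} [Fintype X] {p : X → ℝ} (hp : ∀ x, 0 ≤ p x) {δ : ℝ}
    {n : ℕ} {x : Fin n → X} (hx : x ∈ typicalSet p δ n) (k : Fin n) : 0 < p (x k) := by
  simp only [typicalSet, Finset.mem_filter, Finset.mem_univ, true_and] at hx
  exact (hp _).lt_of_ne' fun h => (hx (x k)).2 h k rfl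

theorem seqProb_eq_rpow {X : Type*} {p : X → ℝ} {n : ℕ} {x : Fin n → X} (h : ∀ k, 0 < p (x k)) :
    seqProb p x = (2 : ℝ) ^ (∑ k, Real.logb 2 (p (x k))) := by
  rw [Real.rpow_sum_of_pos (by norm_num)]
  exact Finset.prod_congr rfl fun k _ =>
    (Real.rpow_logb (by norm_num) (by norm_num) (h k)).symm

-- Collecting the positions by letter turns the sum into empirical counts times f, and each
-- frequency is within δ of its probability.
open scoped Classical in
theorem sum_le_of_mem_typicalSet {X : Type*} [Fintype X] {p : X → ℝ} {δ : ℝ} {n : ℕ} (hn : 0 < n)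
    {x : Fin n → X} (hx : x ∈ typicalSet p δ n) (f : X → ℝ) :
    ∑ k, f (x k) ≤ n * (∑ s, p s * f s + δ * ∑ s, |f s|) := by
  have hn' : (0 : ℝ) < n := by exact_mod_cast hn
  simp only [typicalSet, Finset.mem_filter, Finset.mem_univ, true_and] at hx
  have e : ∑ k, f (x k) = ∑ s, ((Finset.univ.filter fun k => x k = s).card : ℝ) * f s := by
    rw [← Finset.sum_fiberwise Finset.univ x fun k => f (x k)]
    refine Finset.sum_congr rfl fun s _ => ?_
    rw [← nsmul_eq_mul, ← Finset.sum_const]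
    exact Finset.sum_congr rfl fun k hk => by rw [(Finset.mem_filter.1 hk).2]
  rw [e, Finset.mul_sum, ← Finset.sum_add_distrib, Finset.mul_sum]
  refine Finset.sum_le_sum fun s _ => ?_
  have h1 := (hx s).1
  set c : ℝ := ((Finset.univ.filter fun k => x k = s).card : ℝ)
  have h2 : c * f s = n * (p s * f s + (c / n - p s) * f s) := by field_simp; ring
  rw [h2]
  refine mul_le_mul_of_nonneg_left (add_le_add_right ?_ _) hn'.le
  calc (c / n - p s) * f s ≤ |(c / n - p s) * f s| := le_abs_self _
    _ = |c / n - p s| * |f s| := abs_mul _ _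
    _ ≤ _ := mul_le_mul_of_nonneg_right h1 (abs_nonneg _)

variable {q : U × V → ℝ} {pU : U → ℝ} {pV : V → ℝ}

theorem sum_mul_log_ratio (hU : ∀ u, pU u = ∑ v, q (u, v)) (hV : ∀ v, pV v = ∑ u, q (u, v)) :
    ∑ s, q s * (Real.logb 2 (pU s.1) + Real.logb 2 (pV s.2) - Real.logb 2 (q s)) =
      -(shannon pU + shannon pV - shannon q) := by
  have h1 : ∑ s, q s * Real.logb 2 (pU s.1) = - shannon pU := by
    rw [Fintype.sum_prod_type, shannon, Finset.sum_neg_distrib, neg_neg]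
    refine Finset.sum_congr rfl fun u _ => ?_
    change ∑ v, q (u, v) * Real.logb 2 (pU u) = _
    rw [← Finset.sum_mul, ← hU]
  have h2 : ∑ s, q s * Real.logb 2 (pV s.2) = - shannon pV := by
    rw [Fintype.sum_prod_type_right, shannon, Finset.sum_neg_distrib, neg_neg]
    refine Finset.sum_congr rfl fun v _ => ?_
    change ∑ u, q (u, v) * Real.logb 2 (pV v) = _
    rw [← Finset.sum_mul, ← hV]
  have h3 : ∑ s, q s * Real.logb 2 (q s) = - shannon q := by
    rw [shannon, Finset.sum_neg_distrib, neg_neg]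
  simp only [mul_sub, mul_add, Finset.sum_sub_distrib, Finset.sum_add_distrib, h1, h2, h3]
  ring

/-- The exponential bound for the probability that independent sequences are jointly typical. -/
def packingBound (q : U × V → ℝ) (pU : U → ℝ) (pV : V → ℝ) (δ : ℝ) (n : ℕ) : ℝ :=
  (2 : ℝ) ^ (-((n : ℝ) *
    (shannon pU + shannon pV - shannon q - δ * typicalityConst q pU pV)))

theorem packingBound_nonneg (q : U × V → ℝ) (pU : U → ℝ) (pV : V → ℝ) (δ : ℝ) (n : ℕ) :
    0 ≤ packingBound q pU pV δ n := by unfold packingBound; positivity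

theorem marginal_pos_fst (hq : ∀ s, 0 ≤ q s) (hU : ∀ u, pU u = ∑ v, q (u, v)) {u : U} {v : V}
    (h : 0 < q (u, v)) : 0 < pU u := by
  rw [hU]
  exact h.trans_le (Finset.single_le_sum (f := fun v => q (u, v)) (fun v _ => hq _)
    (Finset.mem_univ v))

theorem marginal_pos_snd (hq : ∀ s, 0 ≤ q s) (hV : ∀ v, pV v = ∑ u, q (u, v)) {u : U} {v : V}
    (h : 0 < q (u, v)) : 0 < pV v := by
  rw [hV]
  exact h.trans_le (Finset.single_le_sum (f := fun u => q (u, v)) (fun v _ => hq _)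
    (Finset.mem_univ u))

/-- The likelihood ratio of the product law to the joint law is 2 to a sum of single-letter log
ratios. Their mean under the joint law is -I, and joint typicality bounds the sum by its mean up to
nδ times a constant. -/
theorem seqProb_mul_seqProb_le (hq : ∀ s, 0 ≤ q s) (hU : ∀ u, pU u = ∑ v, q (u, v))
    (hV : ∀ v, pV v = ∑ u, q (u, v)) {δ : ℝ} {n : ℕ} (hn : 0 < n) {u : Fin n → U} {v : Fin n → V}
    (h : (fun k => (u k, v k)) ∈ typicalSet q δ n) :
    seqProb pU u * seqProb pV v ≤
      packingBound q pU pV δ n * seqProb q fun k => (u k, v k) := by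
  have hpos := pos_of_mem_typicalSet hq h
  have hu : ∀ k, 0 < pU (u k) := fun k => marginal_pos_fst hq hU (hpos k)
  have hv : ∀ k, 0 < pV (v k) := fun k => marginal_pos_snd hq hV (hpos k)
  have hs := sum_le_of_mem_typicalSet hn h fun s =>
    Real.logb 2 (pU s.1) + Real.logb 2 (pV s.2) - Real.logb 2 (q s)
  rw [sum_mul_log_ratio hU hV] at hs
  rw [seqProb_eq_rpow hu, seqProb_eq_rpow hv, seqProb_eq_rpow hpos, packingBound,
    ← Real.rpow_add (by norm_num), ← Real.rpow_add (by norm_num)]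
  refine Real.rpow_le_rpow_of_exponent_le (by norm_num) ?_
  simp only [Finset.sum_sub_distrib, Finset.sum_add_distrib] at hs
  have e : ∑ s, |Real.logb 2 (pU s.1) + Real.logb 2 (pV s.2) - Real.logb 2 (q s)| =
    typicalityConst q pU pV := rfl
  rw [e] at hs
  linarith

theorem sum_seqProb_pair_fst (hU : ∀ u, pU u = ∑ v, q (u, v)) {n : ℕ} (u : Fin n → U) :
    ∑ v : Fin n → V, seqProb q (fun k => (u k, v k)) = seqProb pU u := by
  simp only [seqProb, hU, Fintype.prod_sum]

theorem sum_seqProb_pair_snd (hV : ∀ v, pV v = ∑ u, q (u, v)) {n : ℕ} (v : Fin n → V) :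
    ∑ u : Fin n → U, seqProb q (fun k => (u k, v k)) = seqProb pV v := by
  simp only [seqProb, hV, Fintype.prod_sum]

-- Multiply by the probability of u, change to the joint law, and sum over v to recover that same
-- probability. The bound holds for every single u, which is needed for collisions where one
-- coordinate is unchanged. If u has probability 0, no pair containing it is jointly typical.
open scoped Classical in
theorem sum_typical_snd_le (hq : ∀ s, 0 ≤ q s) (hU : ∀ u, pU u = ∑ v, q (u, v))
    (hV : ∀ v, pV v = ∑ u, q (u, v)) (δ : ℝ) {n : ℕ} (hn : 0 < n) (u : Fin n → U) :
    ∑ v : Fin n → V, (if (fun k => (u k, v k)) ∈ typicalSet q δ n then seqProb pV v else 0) ≤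
      packingBound q pU pV δ n := by
  have hpU : ∀ u, 0 ≤ pU u := fun u => by rw [hU]; exact Finset.sum_nonneg fun v _ => hq _
  rcases (seqProb_nonneg hpU u).eq_or_lt with h0 | hpos
  · refine le_trans (le_of_eq ?_) (packingBound_nonneg q pU pV δ n)
    refine Finset.sum_eq_zero fun v _ => if_neg fun h => ?_
    exact (Finset.prod_pos fun k _ =>
      marginal_pos_fst hq hU (pos_of_mem_typicalSet hq h k)).ne h0
  · refine le_of_mul_le_mul_left ?_ hpos
    rw [Finset.mul_sum, mul_comm (seqProb pU u) (packingBound q pU pV δ n),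
      ← sum_seqProb_pair_fst hU u, Finset.mul_sum]
    refine Finset.sum_le_sum fun v _ => ?_
    rw [sum_seqProb_pair_fst hU u]
    split_ifs with h
    · exact seqProb_mul_seqProb_le hq hU hV hn h
    · rw [mul_zero]
      exact mul_nonneg (packingBound_nonneg _ _ _ _ _) (seqProb_nonneg hq _)

open scoped Classical in
theorem sum_typical_fst_le (hq : ∀ s, 0 ≤ q s) (hU : ∀ u, pU u = ∑ v, q (u, v))
    (hV : ∀ v, pV v = ∑ u, q (u, v)) (δ : ℝ) {n : ℕ} (hn : 0 < n) (v : Fin n → V) :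
    ∑ u : Fin n → U, (if (fun k => (u k, v k)) ∈ typicalSet q δ n then seqProb pU u else 0) ≤
      packingBound q pU pV δ n := by
  have hpV : ∀ v, 0 ≤ pV v := fun v => by rw [hV]; exact Finset.sum_nonneg fun u _ => hq _
  rcases (seqProb_nonneg hpV v).eq_or_lt with h0 | hpos
  · refine le_trans (le_of_eq ?_) (packingBound_nonneg q pU pV δ n)
    refine Finset.sum_eq_zero fun u _ => if_neg fun h => ?_
    exact (Finset.prod_pos fun k _ =>
      marginal_pos_snd hq hV (pos_of_mem_typicalSet hq h k)).ne h0
  · refine le_of_mul_le_mul_right ?_ hpos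
    rw [Finset.sum_mul, ← sum_seqProb_pair_snd hV v, Finset.mul_sum]
    refine Finset.sum_le_sum fun u _ => ?_
    rw [sum_seqProb_pair_snd hV v]
    split_ifs with h
    · exact seqProb_mul_seqProb_le hq hU hV hn h
    · rw [zero_mul]
      exact mul_nonneg (packingBound_nonneg _ _ _ _ _) (seqProb_nonneg hq _)

end Packing

/-! ### Reduction of the quantum mutual information to Shannon entropies. -/

section MutualInformation

open scoped MatrixOrder

variable {a b U V Z : Type*} [Fintype a] [DecidableEq a] [Fintype b] [DecidableEq b]
  [Fintype U] [DecidableEq U] [Fintype V] [DecidableEq V] [Fintype Z] [DecidableEq Z]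

/-- The eigenvalues come in an unspecified order. Comparing multisets of roots of the characteristic
polynomial makes the order irrelevant. -/
theorem entropy_diagonal {κ : Type*} [Fintype κ] [DecidableEq κ] (d : κ → ℝ) :
    entropy (Matrix.diagonal fun i => (d i : ℂ)) = shannon d := by
  have hM : (Matrix.diagonal fun i => (d i : ℂ)).IsHermitian := by
    rw [Matrix.IsHermitian, Matrix.diagonal_conjTranspose]
    congr 1
    ext i
    simp
  rw [entropy_eq_sum hM, shannon]
  have h1 := hM.roots_charpoly_eq_eigenvalues
  rw [Matrix.charpoly_diagonal] at h1
  have h2 : (∏ i, (Polynomial.X - Polynomial.C (d i : ℂ))).roots =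
      Finset.univ.val.map fun i => (d i : ℂ) := by
    have := Polynomial.roots_multiset_prod_X_sub_C
      (Finset.univ.val.map fun i => (d i : ℂ))
    rw [Multiset.map_map] at this
    exact this
  rw [h2] at h1
  have h3 := congrArg (fun m : Multiset ℂ =>
    (m.map fun z => -(z.re * Real.logb 2 z.re)).sum) h1
  simp only [Multiset.map_map, Function.comp_def] at h3
  simp only [eigVal, dif_pos hM]
  exact h3.symm

theorem marginal_fst {ρ : Matrix (a × b) (a × b) ℂ} {MA : U → Matrix a a ℂ}
    {MB : V → Matrix b b ℂ} (hMB1 : ∑ v, MB v = 1) (u : U) :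
    outcomeProb (reduceFst ρ) MA u = ∑ v, jointProb ρ MA MB (u, v) := by
  simp only [jointProb, outcomeProb]
  rw [← Complex.re_sum, ← Matrix.trace_sum, ← Finset.sum_mul, ← trace_kronecker_one_mul, ← hMB1]
  congr 3
  ext i j
  simp [Matrix.kroneckerMap_apply, Matrix.sum_apply, Finset.mul_sum]

theorem trace_one_kronecker_mul (Y : Matrix b b ℂ) (M : Matrix (a × b) (a × b) ℂ) :
    (((1 : Matrix a a ℂ) ⊗ₖ Y) * M).trace = (Y * reduceSnd M).trace := by
  rw [reduceSnd_eq, ← trace_kronecker_one_mul, ← trace_submatrix_equiv (Equiv.prodComm b a)]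
  congr 1
  rw [← Matrix.submatrix_mul_equiv _ _ _ (Equiv.prodComm b a)]
  congr 1
  ext ⟨i, i'⟩ ⟨j, j'⟩
  simp [mul_comm]

theorem marginal_snd {ρ : Matrix (a × b) (a × b) ℂ} {MA : U → Matrix a a ℂ}
    {MB : V → Matrix b b ℂ} (hMA1 : ∑ u, MA u = 1) (v : V) :
    outcomeProb (reduceSnd ρ) MB v = ∑ u, jointProb ρ MA MB (u, v) := by
  simp only [jointProb, outcomeProb]
  rw [← Complex.re_sum, ← Matrix.trace_sum, ← Finset.sum_mul, ← trace_one_kronecker_mul, ← hMA1]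
  congr 3
  ext i j
  simp [Matrix.kroneckerMap_apply, Matrix.sum_apply, Finset.sum_mul]

theorem reduce_sigma3 {ρ : Matrix (a × b) (a × b) ℂ} (hρ : 0 ≤ ρ) {MA : U → Matrix a a ℂ}
    {MB : V → Matrix b b ℂ} (hMA : ∀ x, 0 ≤ MA x) (hMB : ∀ x, 0 ≤ MB x) {P : U → V → Z → ℝ}
    (hP : IsStochastic P) :
    reduceFst (reduceSnd (sigma3 ρ MA MB P)) =
      Matrix.diagonal fun w => (jointProb ρ MA MB w : ℂ) := by
  have h1 : ∀ u v, ∑ k, (opSqrt ρ * (MA u ⊗ₖ MB v) * opSqrt ρ) k k =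
      (jointProb ρ MA MB (u, v) : ℂ) := fun u v => by
    have := trace_opSqrt_conj hρ (MA u ⊗ₖ MB v)
    rw [trace_mul_eq_ofReal (kronecker_nonneg (hMA u) (hMB v)) hρ] at this
    exact this
  have h2 : ∀ u v, ∑ z, (P u v z : ℂ) = 1 := fun u v => by
    rw [← Complex.ofReal_sum, (hP u v).2, Complex.ofReal_one]
  ext ⟨u, v⟩ ⟨u', v'⟩
  simp only [reduceFst, reduceSnd, sigma3, Matrix.of_apply, Matrix.sum_apply,
    Matrix.kroneckerMap_apply, Matrix.smul_apply, Matrix.single_apply, smul_eq_mul]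
  by_cases h : (u, v) = (u', v')
  · obtain ⟨rfl, rfl⟩ := Prod.mk.inj h
    simp only [and_self, Prod.mk.injEq, ite_and, mul_ite, mul_one, mul_zero,
      Finset.sum_ite_irrel, Finset.sum_const_zero, Finset.sum_ite_eq', Finset.mem_univ, if_true,
      Matrix.diagonal_apply_eq]
    simp only [← Finset.sum_mul, h1, ← Finset.mul_sum, h2, mul_one]
  · rw [Matrix.diagonal_apply_ne _ h]
    refine Finset.sum_eq_zero fun z _ => Finset.sum_eq_zero fun k _ => Finset.sum_eq_zero
      fun x _ => Finset.sum_eq_zero fun y _ => Finset.sum_eq_zero fun t _ => ?_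
    rw [if_neg, mul_zero, mul_zero]
    rintro ⟨e1, e2⟩
    exact h ((congrArg Prod.fst e1).symm.trans (congrArg Prod.fst e2))

theorem mutualInfoUV_eq {ρ : Matrix (a × b) (a × b) ℂ} (hρ : 0 ≤ ρ) {MA : U → Matrix a a ℂ}
    {MB : V → Matrix b b ℂ} (hMA : ∀ x, 0 ≤ MA x) (hMA1 : ∑ x, MA x = 1) (hMB : ∀ x, 0 ≤ MB x)
    (hMB1 : ∑ x, MB x = 1) {P : U → V → Z → ℝ} (hP : IsStochastic P) :
    mutualInfoUV ρ MA MB P = shannon (outcomeProb (reduceFst ρ) MA) +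
      shannon (outcomeProb (reduceSnd ρ) MB) - shannon (jointProb ρ MA MB) := by
  have h1 : reduceFst (Matrix.diagonal fun w => (jointProb ρ MA MB w : ℂ)) =
      Matrix.diagonal fun u => (outcomeProb (reduceFst ρ) MA u : ℂ) := by
    ext i j
    by_cases h : i = j
    · subst h
      rw [Matrix.diagonal_apply_eq, marginal_fst hMB1, Complex.ofReal_sum]
      exact Finset.sum_congr rfl fun v _ => Matrix.diagonal_apply_eq _ _
    · simp [reduceFst, h]
  have h2 : reduceSnd (Matrix.diagonal fun w => (jointProb ρ MA MB w : ℂ)) =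
      Matrix.diagonal fun u => (outcomeProb (reduceSnd ρ) MB u : ℂ) := by
    ext i j
    by_cases h : i = j
    · subst h
      rw [Matrix.diagonal_apply_eq, marginal_snd hMA1, Complex.ofReal_sum]
      exact Finset.sum_congr rfl fun v _ => Matrix.diagonal_apply_eq _ _
    · simp [reduceSnd, h]
  rw [mutualInfoUV, reduce_sigma3 hρ hMA hMB hP, mutualInfo, h1, h2, entropy_diagonal,
    entropy_diagonal, entropy_diagonal]

end MutualInformation

/-! ### Expectations over random codes -/

section RandomCode

/-- Writing the integrand as a product over all coordinates lets the sum factor, and every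
coordinate other than i contributes total mass 1. -/
theorem sum_prod_mul_marginal {ι α : Type*} [Fintype ι] [DecidableEq ι] [Fintype α] {w : α → ℝ}
    (hw : ∑ a, w a = 1) (i : ι) (f : α → ℝ) :
    ∑ c : ι → α, (∏ k, w (c k)) * f (c i) = ∑ a, w a * f a := by
  have h : ∀ c : ι → α, (∏ k, w (c k)) * f (c i) =
      ∏ k, w (c k) * (if k = i then f (c k) else 1) := fun c => by
    rw [Finset.prod_mul_distrib, Finset.prod_ite_eq' Finset.univ i fun k => f (c k),
      if_pos (Finset.mem_univ i)]
  simp only [h]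
  rw [← Fintype.prod_sum fun (k : ι) a => w a * (if k = i then f a else 1),
    Finset.prod_eq_single i]
  · simp
  · intro k _ hk
    simp [hk, hw]
  · simp

theorem sum_prod_mul_marginal_pair {ι α : Type*} [Fintype ι] [DecidableEq ι] [Fintype α]
    {w : α → ℝ} (hw : ∑ a, w a = 1) {i j : ι} (hij : i ≠ j) (f g : α → ℝ) :
    ∑ c : ι → α, (∏ k, w (c k)) * (f (c i) * g (c j)) =
      (∑ a, w a * f a) * ∑ a, w a * g a := by
  have h : ∀ c : ι → α, (∏ k, w (c k)) * (f (c i) * g (c j)) =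
      ∏ k, w (c k) * ((if k = i then f (c k) else 1) * (if k = j then g (c k) else 1)) :=
    fun c => by
    rw [Finset.prod_mul_distrib, Finset.prod_mul_distrib,
      Finset.prod_ite_eq' Finset.univ i fun k => f (c k),
      Finset.prod_ite_eq' Finset.univ j fun k => g (c k),
      if_pos (Finset.mem_univ i), if_pos (Finset.mem_univ j)]
  simp only [h]
  rw [← Fintype.prod_sum fun (k : ι) a =>
    w a * ((if k = i then f a else 1) * (if k = j then g a else 1))]
  have h2 : ∀ k : ι, ∑ a, w a * ((if k = i then f a else 1) * (if k = j then g a else 1)) =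
      (if k = i then ∑ a, w a * f a else 1) * (if k = j then ∑ a, w a * g a else 1) := by
    intro k
    by_cases hi : k = i
    · subst hi
      simp [hij]
    · by_cases hj : k = j
      · subst hj
        simp [hi]
      · simp [hi, hj, hw]
  simp only [h2]
  rw [Finset.prod_mul_distrib, Finset.prod_ite_eq' Finset.univ i fun _ => ∑ a, w a * f a,
    Finset.prod_ite_eq' Finset.univ j fun _ => ∑ a, w a * g a,
    if_pos (Finset.mem_univ i), if_pos (Finset.mem_univ j)]

theorem sum_prod_eq_one {ι α : Type*} [Fintype ι] [DecidableEq ι] [Fintype α] {w : α → ℝ}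
    (hw : ∑ a, w a = 1) : ∑ c : ι → α, ∏ k, w (c k) = 1 := by
  rw [← Fintype.prod_sum fun (_ : ι) a => w a]
  simp [hw]

open scoped Classical in
/-- The number of occurrences of a sequence in a codebook. -/
def codeCount {α : Type*} {L : ℕ} (c : Fin L → α) (x : α) : ℝ := ∑ l, if c l = x then 1 else 0

open scoped Classical in
/-- The number of occurrences of `x'` in the codebook if `x'` is a different sequence with the same
bin index as `x`, and `0` otherwise. -/
def collisionCount {α : Type*} {L K : ℕ} (c : Fin L → α) (bin : α → Fin K) (x x' : α) : ℝ :=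
  if x ≠ x' ∧ bin x = bin x' then codeCount c x' else 0

theorem codeCount_nonneg {α : Type*} {L : ℕ} (c : Fin L → α) (x : α) : 0 ≤ codeCount c x :=
  Finset.sum_nonneg fun _ _ => by split_ifs <;> norm_num

theorem one_le_codeCount {α : Type*} {L : ℕ} {c : Fin L → α} {x : α} (h : ∃ l, c l = x) :
    1 ≤ codeCount c x := by
  classical
  obtain ⟨l, hl⟩ := h
  refine le_trans (le_of_eq ?_) (Finset.single_le_sum (f := fun l => if c l = x then (1 : ℝ) else 0)
    (fun _ _ => by split_ifs <;> norm_num) (Finset.mem_univ l))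
  simp [hl]

theorem codeCount_eq_zero {α : Type*} {L : ℕ} {c : Fin L → α} {x : α} (h : ¬ ∃ l, c l = x) :
    codeCount c x = 0 :=
  Finset.sum_eq_zero fun l _ => if_neg fun hl => h ⟨l, hl⟩

theorem collisionCount_nonneg {α : Type*} {L K : ℕ} (c : Fin L → α) (bin : α → Fin K)
    (x x' : α) : 0 ≤ collisionCount c bin x x' := by
  unfold collisionCount
  split_ifs
  · exact codeCount_nonneg c x'
  · exact le_rfl

theorem sum_prod_mul_codeCount {α : Type*} [Fintype α] {w : α → ℝ} (hw : ∑ a, w a = 1) (L : ℕ)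
    (x : α) : ∑ c : Fin L → α, (∏ l, w (c l)) * codeCount c x = L * w x := by
  classical
  simp only [codeCount, Finset.mul_sum]
  rw [Finset.sum_comm]
  simp only [sum_prod_mul_marginal hw _ fun a => if a = x then (1 : ℝ) else 0]
  simp

/-- Two different codeword positions are independent, and a single position cannot equal two
distinct sequences. This leaves L(L-1) ≤ L² pairs of positions. -/
theorem sum_prod_mul_codeCount_mul_le {α : Type*} [Fintype α] {w : α → ℝ} (hw0 : ∀ a, 0 ≤ w a)
    (hw : ∑ a, w a = 1) (L : ℕ) {x x' : α} (hx : x ≠ x') :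
    ∑ c : Fin L → α, (∏ l, w (c l)) * (codeCount c x * codeCount c x') ≤
      L ^ 2 * (w x * w x') := by
  classical
  have e : ∑ c : Fin L → α, (∏ l, w (c l)) * (codeCount c x * codeCount c x') =
      ∑ l, ∑ l', ∑ c : Fin L → α, (∏ l, w (c l)) *
        ((if c l = x then (1 : ℝ) else 0) * (if c l' = x' then (1 : ℝ) else 0)) := by
    simp only [codeCount, Finset.sum_mul_sum]
    simp only [Finset.mul_sum]
    rw [Finset.sum_comm]
    exact Finset.sum_congr rfl fun l _ => Finset.sum_comm
  have h : ∀ l l' : Fin L, ∑ c : Fin L → α, (∏ l, w (c l)) *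
      ((if c l = x then (1 : ℝ) else 0) * (if c l' = x' then (1 : ℝ) else 0)) ≤ w x * w x' := by
    intro l l'
    by_cases hl : l = l'
    · subst hl
      refine le_trans (le_of_eq (Finset.sum_eq_zero fun c _ => ?_)) (mul_nonneg (hw0 _) (hw0 _))
      by_cases h : c l = x
      · simp [h, hx]
      · simp [h]
    · rw [sum_prod_mul_marginal_pair hw hl (fun a => if a = x then (1 : ℝ) else 0)
        fun a => if a = x' then (1 : ℝ) else 0]
      simp
  rw [e]
  refine (Finset.sum_le_sum fun l _ => Finset.sum_le_sum fun l' _ => h l l').trans (le_of_eq ?_)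
  simp
  ring

theorem sum_prod_mul_bin {α : Type*} [Fintype α] [DecidableEq α] {K : ℕ} (hK : 0 < K) {x x' : α}
    (hx : x ≠ x') :
    ∑ b : α → Fin K, (∏ _x : α, (K : ℝ)⁻¹) * (if b x = b x' then (1 : ℝ) else 0) =
      (K : ℝ)⁻¹ := by
  have hK' : (K : ℝ) ≠ 0 := by exact_mod_cast hK.ne'
  have hw : ∑ _j : Fin K, (K : ℝ)⁻¹ = 1 := by simp [hK']
  -- Splitting the coincidence by the common bin value j reduces it to pairwise independence: K
  -- terms of size K⁻².
  have e : ∀ b : α → Fin K, (if b x = b x' then (1 : ℝ) else 0) =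
      ∑ j, (if b x = j then (1 : ℝ) else 0) * (if b x' = j then (1 : ℝ) else 0) := fun b => by
    simp [eq_comm]
  simp only [e, Finset.mul_sum]
  rw [Finset.sum_comm]
  rw [Finset.sum_congr rfl fun j _ => sum_prod_mul_marginal_pair (w := fun _ : Fin K => (K : ℝ)⁻¹)
    hw hx (fun a => if a = j then (1 : ℝ) else 0) fun a => if a = j then (1 : ℝ) else 0]
  simp [hK']

variable {X : Type*} [Fintype X] [DecidableEq X] {p : X → ℝ} {δ : ℝ} {n N L K : ℕ}

theorem choiceProb_nonneg (hp : ∀ x, 0 ≤ p x) (ω : Choices X n N L K) : 0 ≤ choiceProb p δ ω :=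
  mul_nonneg
    (Finset.prod_nonneg fun _ _ => Finset.prod_nonneg fun _ _ => prunedProb_nonneg hp δ _)
    (Finset.prod_nonneg fun _ _ => Finset.prod_nonneg fun _ _ => by positivity)

theorem sum_prunedProb (hm : 0 < typicalMass p δ n) : ∑ x : Fin n → X, prunedProb p δ x = 1 := by
  classical
  simp only [prunedProb, Finset.sum_ite_mem, Finset.univ_inter]
  rw [← Finset.sum_div]
  exact div_self hm.ne'

/-- All choices belonging to other values of the common randomness integrate to 1, which leaves a
single codebook and an independent single binning. -/
theorem sum_choiceProb_mul (hm : 0 < typicalMass p δ n) (hK : 0 < K) (μ : Fin N)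
    (f : (Fin L → Fin n → X) → ℝ) (g : ((Fin n → X) → Fin K) → ℝ) :
    ∑ ω : Choices X n N L K, choiceProb p δ ω * (f (ω.1 μ) * g (ω.2 μ)) =
      (∑ c, (∏ l, prunedProb p δ (c l)) * f c) * ∑ b, (∏ _x : Fin n → X, (K : ℝ)⁻¹) * g b := by
  have hK' : (K : ℝ) ≠ 0 := by exact_mod_cast hK.ne'
  have h1 : ∑ c : Fin L → Fin n → X, ∏ l, prunedProb p δ (c l) = 1 :=
    sum_prod_eq_one (sum_prunedProb hm)
  have h2 : ∑ _b : (Fin n → X) → Fin K, ∏ _x : Fin n → X, (K : ℝ)⁻¹ = 1 :=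
    sum_prod_eq_one (w := fun _ : Fin K => (K : ℝ)⁻¹) (by simp [hK'])
  have e1 := sum_prod_mul_marginal h1 μ f
  have e2 := sum_prod_mul_marginal (w := fun _ : (Fin n → X) → Fin K => ∏ _x : Fin n → X, (K : ℝ)⁻¹)
    h2 μ g
  rw [← e1, ← e2, Fintype.sum_prod_type, Finset.sum_mul_sum]
  refine Finset.sum_congr rfl fun c _ => Finset.sum_congr rfl fun b _ => ?_
  rw [choiceProb]
  ring

theorem expect_codeCount (hm : 0 < typicalMass p δ n) (hK : 0 < K) (μ : Fin N) (u : Fin n → X) :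
    ∑ ω : Choices X n N L K, choiceProb p δ ω * codeCount (ω.1 μ) u = L * prunedProb p δ u := by
  have h := sum_choiceProb_mul (L := L) hm hK μ (fun c => codeCount c u) fun _ => 1
  have hK' : (K : ℝ) ≠ 0 := by exact_mod_cast hK.ne'
  have h2 : ∑ _b : (Fin n → X) → Fin K, ∏ _x : Fin n → X, (K : ℝ)⁻¹ = 1 :=
    sum_prod_eq_one (w := fun _ : Fin K => (K : ℝ)⁻¹) (by simp [hK'])
  simp only [mul_one, h2] at h
  rw [h, sum_prod_mul_codeCount (sum_prunedProb hm)]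

/-- For distinct sequences the two counts contribute L² times the product of the probabilities, and
the independent binning contributes 1/K. For equal sequences the collision count is zero by
definition. -/
theorem expect_codeCount_mul_collisionCount_le (hp : ∀ x, 0 ≤ p x) (hm : 0 < typicalMass p δ n)
    (hK : 0 < K) (μ : Fin N) (u u' : Fin n → X) :
    ∑ ω : Choices X n N L K, choiceProb p δ ω *
      (codeCount (ω.1 μ) u * collisionCount (ω.1 μ) (ω.2 μ) u u') ≤
      (L * prunedProb p δ u) * (L / K * prunedProb p δ u') := by
  have hr : 0 ≤ (L * prunedProb p δ u) * (L / K * prunedProb p δ u') :=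
    mul_nonneg (mul_nonneg (by positivity) (prunedProb_nonneg hp δ u))
      (mul_nonneg (by positivity) (prunedProb_nonneg hp δ u'))
  by_cases hu : u = u'
  · refine le_trans (le_of_eq (Finset.sum_eq_zero fun ω _ => ?_)) hr
    simp [collisionCount, hu]
  · have e : ∀ ω : Choices X n N L K, choiceProb p δ ω *
        (codeCount (ω.1 μ) u * collisionCount (ω.1 μ) (ω.2 μ) u u') =
        choiceProb p δ ω * ((codeCount (ω.1 μ) u * codeCount (ω.1 μ) u') *
          (if ω.2 μ u = ω.2 μ u' then 1 else 0)) := fun ω => by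
      simp only [collisionCount, ne_eq, hu, not_false_eq_true, true_and]
      split_ifs <;> simp
    simp only [e]
    rw [sum_choiceProb_mul hm hK μ (fun c => codeCount c u * codeCount c u')
      fun b => if b u = b u' then 1 else 0, sum_prod_mul_bin hK hu]
    have h := sum_prod_mul_codeCount_mul_le (fun x => prunedProb_nonneg hp δ x)
      (sum_prunedProb hm) L hu
    refine (mul_le_mul_of_nonneg_right h (by positivity)).trans (le_of_eq ?_)
    ring

end RandomCode

/-! ### Union bound for decoding failure. -/

section DecodingFailure

variable {U V : Type*} [Fintype U] [DecidableEq U] [Fintype V] [DecidableEq V]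
  {n L₁ L₂ K₁ K₂ : ℕ}

open scoped Classical in
/-- The indicator of joint typicality. -/
def jointTypical (q : U × V → ℝ) (δ : ℝ) (u : Fin n → U) (v : Fin n → V) : ℝ :=
  if (fun k => (u k, v k)) ∈ typicalSet q δ n then 1 else 0

theorem jointTypical_nonneg (q : U × V → ℝ) (δ : ℝ) (u : Fin n → U) (v : Fin n → V) :
    0 ≤ jointTypical q δ u v := by
  unfold jointTypical; split_ifs <;> norm_num

theorem jointTypical_le_one (q : U × V → ℝ) (δ : ℝ) (u : Fin n → U) (v : Fin n → V) :
    jointTypical q δ u v ≤ 1 := by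
  unfold jointTypical; split_ifs <;> norm_num

/-- The union bound for the event that the pair `(u, v)` is not recovered from its bin indices. -/
def failureBound (q : U × V → ℝ) (δ : ℝ) (cU : Fin L₁ → Fin n → U) (cV : Fin L₂ → Fin n → V)
    (binU : (Fin n → U) → Fin K₁) (binV : (Fin n → V) → Fin K₂)
    (u : Fin n → U) (v : Fin n → V) : ℝ :=
  (1 - jointTypical q δ u v) +
    (∑ u', ∑ v', jointTypical q δ u' v' *
      (collisionCount cU binU u u' * collisionCount cV binV v v')) +
    (∑ v', jointTypical q δ u v' * collisionCount cV binV v v') +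
    ∑ u', jointTypical q δ u' v * collisionCount cU binU u u'

-- The codeword counts dispose of pairs outside the code. A jointly typical codeword pair is itself
-- a candidate in its bins, so failure forces a second candidate, which differs in both coordinates
-- or in exactly one; these cases are the three collision sums.
open scoped Classical in
theorem failure_le (q : U × V → ℝ) (δ : ℝ) (cU : Fin L₁ → Fin n → U) (cV : Fin L₂ → Fin n → V)
    (binU : (Fin n → U) → Fin K₁) (binV : (Fin n → V) → Fin K₂)
    (w₀ : (Fin n → U) × (Fin n → V)) (u : Fin n → U) (v : Fin n → V) :
    codeCount cU u * codeCount cV v *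
      (if reconstruct q δ cU cV binU binV w₀ (u, v) = (u, v) then 0 else 1) ≤
    codeCount cU u * codeCount cV v * failureBound q δ cU cV binU binV u v := by
  have hT := fun u v => jointTypical_nonneg (n := n) q δ u v
  have hCU := collisionCount_nonneg cU binU
  have hCV := collisionCount_nonneg cV binV
  have n1 : 0 ≤ 1 - jointTypical q δ u v := sub_nonneg.2 (jointTypical_le_one _ _ _ _)
  have n2' : ∀ u', 0 ≤ ∑ v', jointTypical q δ u' v' *
      (collisionCount cU binU u u' * collisionCount cV binV v v') := fun u' =>
    Finset.sum_nonneg fun v' _ => mul_nonneg (hT _ _) (mul_nonneg (hCU _ _) (hCV _ _))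
  have n2 : 0 ≤ ∑ u', ∑ v', jointTypical q δ u' v' *
      (collisionCount cU binU u u' * collisionCount cV binV v v') :=
    Finset.sum_nonneg fun u' _ => n2' u'
  have n3 : 0 ≤ ∑ v', jointTypical q δ u v' * collisionCount cV binV v v' :=
    Finset.sum_nonneg fun v' _ => mul_nonneg (hT _ _) (hCV _ _)
  have n4 : 0 ≤ ∑ u', jointTypical q δ u' v * collisionCount cU binU u u' :=
    Finset.sum_nonneg fun u' _ => mul_nonneg (hT _ _) (hCU _ _)
  by_cases hcu : ∃ l, cU l = u
  swap
  · simp [codeCount_eq_zero hcu]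
  by_cases hcv : ∃ l, cV l = v
  swap
  · simp [codeCount_eq_zero hcv]
  refine mul_le_mul_of_nonneg_left ?_ (mul_nonneg (codeCount_nonneg _ _) (codeCount_nonneg _ _))
  rw [failureBound]
  split_ifs with hrec
  · linarith
  by_cases ht : (fun k => (u k, v k)) ∈ typicalSet q δ n
  swap
  · have : jointTypical q δ u v = 0 := if_neg ht
    linarith
  have hin : InCode cU cV (u, v) := ⟨hcu, hcv⟩
  have hw : ∃ w : (Fin n → U) × (Fin n → V), (InCode cU cV w ∧
      (fun k => (w.1 k, w.2 k)) ∈ typicalSet q δ n ∧ binU w.1 = binU u ∧ binV w.2 = binV v) ∧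
      w ≠ (u, v) := by
    -- Without a competitor the pair is the unique candidate, and the decoder returns it.
    by_contra hno
    push Not at hno
    apply hrec
    have hex : ∃! w : (Fin n → U) × (Fin n → V), InCode cU cV w ∧
      (fun k => (w.1 k, w.2 k)) ∈ typicalSet q δ n ∧ binU w.1 = binU u ∧ binV w.2 = binV v :=
      ⟨(u, v), ⟨hin, ht, rfl, rfl⟩, fun w hw => hno w hw⟩
    rw [reconstruct, if_pos hin, decode, dif_pos hex]
    exact hno _ hex.choose_spec.1
  obtain ⟨⟨u', v'⟩, ⟨⟨hu', hv'⟩, ht', hbu, hbv⟩, hne⟩ := hw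
  have hT1 : jointTypical q δ u' v' = 1 := if_pos ht'
  have c1 : u ≠ u' → 1 ≤ collisionCount cU binU u u' := fun h => by
    rw [collisionCount, if_pos ⟨h, hbu.symm⟩]
    exact one_le_codeCount hu'
  have c2 : v ≠ v' → 1 ≤ collisionCount cV binV v v' := fun h => by
    rw [collisionCount, if_pos ⟨h, hbv.symm⟩]
    exact one_le_codeCount hv'
  by_cases hu : u = u'
  · have hv : v ≠ v' := fun h => hne (by rw [hu, h])
    subst hu
    have := Finset.single_le_sum (f := fun v' => jointTypical q δ u v' * collisionCount cV binV v v')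
      (fun v' _ => mul_nonneg (hT _ _) (hCV _ _)) (Finset.mem_univ v')
    simp only [hT1, one_mul] at this
    linarith [c2 hv]
  · by_cases hv : v = v'
    · subst hv
      have := Finset.single_le_sum
        (f := fun u' => jointTypical q δ u' v * collisionCount cU binU u u')
        (fun u' _ => mul_nonneg (hT _ _) (hCU _ _)) (Finset.mem_univ u')
      simp only [hT1, one_mul] at this
      linarith [c1 hu]
    · have h1 := Finset.single_le_sum (f := fun u' => ∑ v', jointTypical q δ u' v' *
        (collisionCount cU binU u u' * collisionCount cV binV v v'))
        (fun u' _ => n2' u') (Finset.mem_univ u')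
      have h2 := Finset.single_le_sum (f := fun v' => jointTypical q δ u' v' *
        (collisionCount cU binU u u' * collisionCount cV binV v v'))
        (fun v' _ => mul_nonneg (hT _ _) (mul_nonneg (hCU _ _) (hCV _ _))) (Finset.mem_univ v')
      simp only [hT1, one_mul] at h2
      have h3 := one_le_mul_of_one_le_of_one_le (c1 hu) (c2 hv)
      linarith

end DecodingFailure

/-! ### The binning error -/

section BinningErrorBound

open scoped MatrixOrder

variable {a b U V Z : Type*} [Fintype a] [DecidableEq a] [Fintype b] [DecidableEq b]
  [Fintype U] [DecidableEq U] [Fintype V] [DecidableEq V] [Fintype Z]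
  {ρ : Matrix (a × b) (a × b) ℂ} {MA : U → Matrix a a ℂ} {MB : V → Matrix b b ℂ}
  {P : U → V → Z → ℝ} {δ η : ℝ} {n N₁ N₂ L₁ L₂ K₁ K₂ : ℕ}

theorem seqStoch_nonneg (hP : IsStochastic P) (w : (Fin n → U) × (Fin n → V)) (z : Fin n → Z) :
    0 ≤ seqStoch P w z := Finset.prod_nonneg fun _ _ => (hP _ _).1 _

theorem sum_seqStoch (hP : IsStochastic P) (w : (Fin n → U) × (Fin n → V)) :
    ∑ z : Fin n → Z, seqStoch P w z = 1 := by
  simp only [seqStoch]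
  rw [← Fintype.prod_sum fun k z => P (w.1 k) (w.2 k) z]
  exact Finset.prod_eq_one fun k _ => (hP _ _).2

open scoped Classical in
theorem sum_abs_seqStoch_sub_le (hP : IsStochastic P) (w w' : (Fin n → U) × (Fin n → V)) :
    ∑ z : Fin n → Z, |seqStoch P w z - seqStoch P w' z| ≤ 2 * if w' = w then 0 else 1 := by
  split_ifs with h
  · simp [h]
  · calc ∑ z : Fin n → Z, |seqStoch P w z - seqStoch P w' z|
        ≤ ∑ z : Fin n → Z, (seqStoch P w z + seqStoch P w' z) := by
          refine Finset.sum_le_sum fun z _ => ?_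
          have h1 := seqStoch_nonneg hP w z
          have h2 := seqStoch_nonneg hP w' z
          rw [abs_le]
          constructor <;> linarith
      _ = 2 * 1 := by
          rw [Finset.sum_add_distrib, sum_seqStoch hP, sum_seqStoch hP]; norm_num

theorem traceNorm_nonneg {κ : Type*} [Fintype κ] [DecidableEq κ] (X : Matrix κ κ ℂ) :
    0 ≤ traceNorm X := trace_re_nonneg (opSqrt_nonneg _)

theorem codeCoeff_eq {X : Type*} [Fintype X] (p : X → ℝ) (δ η : ℝ) (c : Fin L₁ → Fin n → X)
    (x : Fin n → X) :
    codeCoeff p δ η c x = typicalMass p δ n / (1 + η) * ((L₁ : ℝ)⁻¹ * codeCount c x) := by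
  rw [codeCoeff, codeCount, Finset.sum_boole]
  congr!

theorem codeCoeff_nonneg {X : Type*} [Fintype X] {p : X → ℝ} (hm : 0 ≤ typicalMass p δ n)
    (hη : 0 < η) (c : Fin L₁ → Fin n → X) (x : Fin n → X) : 0 ≤ codeCoeff p δ η c x := by
  have := codeCount_nonneg c x
  rw [codeCoeff_eq]
  positivity

/-- Discarding the factor 1/(1+η) ≤ 1 is what makes the final bound uniform in η. -/
theorem codeCoeff_le {X : Type*} [Fintype X] {p : X → ℝ} (hm : 0 ≤ typicalMass p δ n)
    (hη : 0 < η) (c : Fin L₁ → Fin n → X) (x : Fin n → X) :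
    codeCoeff p δ η c x ≤ typicalMass p δ n * (L₁ : ℝ)⁻¹ * codeCount c x := by
  have := codeCount_nonneg c x
  rw [codeCoeff_eq, mul_assoc]
  refine mul_le_mul_of_nonneg_right ?_ (by positivity)
  exact div_le_self hm (by linarith)

theorem trace_codeOp_kronecker (hρ : 0 ≤ ρ) (cU : Fin L₁ → Fin n → U) (cV : Fin L₂ → Fin n → V)
    (u : Fin n → U) (v : Fin n → V) :
    (opSqrt (tensorPowPair n ρ) *
      (codeOp (reduceFst ρ) MA δ η cU u ⊗ₖ codeOp (reduceSnd ρ) MB δ η cV v) *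
      opSqrt (tensorPowPair n ρ)).trace.re =
    codeCoeff (outcomeProb (reduceFst ρ) MA) δ η cU u *
      codeCoeff (outcomeProb (reduceSnd ρ) MB) δ η cV v * overlap ρ MA MB δ u v := by
  rw [trace_opSqrt_conj (tensorPowPair_nonneg hρ), codeOp, codeOp, Matrix.smul_kronecker,
    Matrix.kronecker_smul, smul_smul, ← Complex.ofReal_mul, Matrix.smul_mul, trace_real_smul_re]
  rfl

-- The trace norm is split into positive operators. The sum over z is then a total variation
-- distance, at most 2 and zero when the pair is recovered; the trace of each operator is its two
-- code coefficients times the overlap.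
open scoped Classical in
theorem binningError_le (hρ : 0 ≤ ρ) (hMA : ∀ x, 0 ≤ MA x) (hMB : ∀ x, 0 ≤ MB x)
    (hP : IsStochastic P) (hη : 0 < η)
    (hA : 0 < typicalMass (outcomeProb (reduceFst ρ) MA) δ n)
    (hB : 0 < typicalMass (outcomeProb (reduceSnd ρ) MB) δ n)
    (w₀ : (Fin n → U) × (Fin n → V)) (ωA : Choices U n N₁ L₁ K₁) (ωB : Choices V n N₂ L₂ K₂) :
    binningError ρ MA MB P δ η w₀ ωA ωB ≤
      ∑ μ₁, ∑ μ₂, ∑ u ∈ typicalSet (outcomeProb (reduceFst ρ) MA) δ n,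
        ∑ v ∈ typicalSet (outcomeProb (reduceSnd ρ) MB) δ n,
          (((N₁ : ℝ) * N₂)⁻¹ * 2 * (typicalMass (outcomeProb (reduceFst ρ) MA) δ n * (L₁ : ℝ)⁻¹) *
            (typicalMass (outcomeProb (reduceSnd ρ) MB) δ n * (L₂ : ℝ)⁻¹) *
            overlap ρ MA MB δ u v) *
          (codeCount (ωA.1 μ₁) u * codeCount (ωB.1 μ₂) v *
            failureBound (jointProb ρ MA MB) δ (ωA.1 μ₁) (ωB.1 μ₂) (ωA.2 μ₁) (ωB.2 μ₂) u v) := by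
  set TU := typicalSet (outcomeProb (reduceFst ρ) MA) δ n with hTU
  set TV := typicalSet (outcomeProb (reduceSnd ρ) MB) δ n with hTV
  -- The four nested sums become one index set, so that the triangle inequality is applied only
  -- once.
  set s : Finset (Fin N₁ × Fin N₂ × (Fin n → U) × (Fin n → V)) :=
    Finset.univ ×ˢ Finset.univ ×ˢ TU ×ˢ TV with hs
  set rec' : Fin N₁ × Fin N₂ × (Fin n → U) × (Fin n → V) → (Fin n → U) × (Fin n → V) := fun i =>
    reconstruct (jointProb ρ MA MB) δ (ωA.1 i.1) (ωB.1 i.2.1) (ωA.2 i.1) (ωB.2 i.2.1) w₀ i.2.2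
    with hrec
  set c : (Fin n → Z) → Fin N₁ × Fin N₂ × (Fin n → U) × (Fin n → V) → ℝ := fun z i =>
    ((N₁ : ℝ) * N₂)⁻¹ * (seqStoch P i.2.2 z - seqStoch P (rec' i) z) with hc
  set T : Fin N₁ × Fin N₂ × (Fin n → U) × (Fin n → V) → Matrix _ _ ℂ := fun i =>
    opSqrt (tensorPowPair n ρ) *
      (codeOp (reduceFst ρ) MA δ η (ωA.1 i.1) i.2.2.1 ⊗ₖ
        codeOp (reduceSnd ρ) MB δ η (ωB.1 i.2.1) i.2.2.2) * opSqrt (tensorPowPair n ρ) with hT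
  have hcodeA : ∀ i u, 0 ≤ codeOp (reduceFst ρ) MA δ η (ωA.1 i) u := fun i u =>
    real_smul_nonneg (dressedOp_nonneg (reduceFst_nonneg hρ) hMA δ u)
      (codeCoeff_nonneg hA.le hη _ _)
  have hcodeB : ∀ i v, 0 ≤ codeOp (reduceSnd ρ) MB δ η (ωB.1 i) v := fun i v =>
    real_smul_nonneg (dressedOp_nonneg (reduceSnd_nonneg hρ) hMB δ v)
      (codeCoeff_nonneg hB.le hη _ _)
  have hT0 : ∀ i ∈ s, 0 ≤ T i := fun i _ =>
    opSqrt_conj_nonneg _ (kronecker_nonneg (hcodeA _ _) (hcodeB _ _))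
  have e1 : binningError ρ MA MB P δ η w₀ ωA ωB =
      ∑ z, traceNorm (∑ i ∈ s, (c z i : ℂ) • T i) := by
    rw [binningError]
    refine Finset.sum_congr rfl fun z _ => congrArg traceNorm ?_
    simp only [hs, Finset.sum_product, Finset.smul_sum]
    refine Finset.sum_congr rfl fun μ₁ _ => Finset.sum_congr rfl fun μ₂ _ =>
      Finset.sum_congr rfl fun u _ => Finset.sum_congr rfl fun v _ => ?_
    rw [smul_smul, hc]
    push_cast
    rfl
  have hTle : ∀ i ∈ s, 0 ≤ (T i).trace.re := fun i hi => trace_re_nonneg (hT0 i hi)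
  have hN : 0 ≤ ((N₁ : ℝ) * N₂)⁻¹ := by positivity
  calc binningError ρ MA MB P δ η w₀ ωA ωB
      ≤ ∑ z, ∑ i ∈ s, |c z i| * (T i).trace.re := by
        rw [e1]
        exact Finset.sum_le_sum fun z _ => traceNorm_sum_le s (c z) T hT0
    _ = ∑ i ∈ s, (((N₁ : ℝ) * N₂)⁻¹ * ∑ z, |seqStoch P i.2.2 z - seqStoch P (rec' i) z|) *
          (T i).trace.re := by
        rw [Finset.sum_comm]
        refine Finset.sum_congr rfl fun i _ => ?_
        rw [← Finset.sum_mul, Finset.mul_sum]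
        simp only [hc, abs_mul, abs_of_nonneg hN]
    _ ≤ ∑ i ∈ s, (((N₁ : ℝ) * N₂)⁻¹ * (2 * if rec' i = i.2.2 then 0 else 1)) *
          (T i).trace.re := by
        refine Finset.sum_le_sum fun i hi => mul_le_mul_of_nonneg_right ?_ (hTle i hi)
        exact mul_le_mul_of_nonneg_left (sum_abs_seqStoch_sub_le hP _ _) hN
    _ ≤ ∑ i ∈ s,
          (((N₁ : ℝ) * N₂)⁻¹ * 2 * (typicalMass (outcomeProb (reduceFst ρ) MA) δ n * (L₁ : ℝ)⁻¹) *
            (typicalMass (outcomeProb (reduceSnd ρ) MB) δ n * (L₂ : ℝ)⁻¹) *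
            overlap ρ MA MB δ i.2.2.1 i.2.2.2) *
          (codeCount (ωA.1 i.1) i.2.2.1 * codeCount (ωB.1 i.2.1) i.2.2.2 *
            failureBound (jointProb ρ MA MB) δ (ωA.1 i.1) (ωB.1 i.2.1) (ωA.2 i.1) (ωB.2 i.2.1)
              i.2.2.1 i.2.2.2) := by
        refine Finset.sum_le_sum fun i _ => ?_
        have h1 := trace_codeOp_kronecker (MA := MA) (MB := MB) (δ := δ) (η := η) hρ
          (ωA.1 i.1) (ωB.1 i.2.1) i.2.2.1 i.2.2.2
        have h2 := codeCoeff_le hA.le hη (ωA.1 i.1) i.2.2.1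
        have h3 := codeCoeff_le hB.le hη (ωB.1 i.2.1) i.2.2.2
        have h4 := codeCoeff_nonneg hB.le hη (ωB.1 i.2.1) i.2.2.2
        have h5 := overlap_nonneg hρ hMA hMB δ i.2.2.1 i.2.2.2
        have h6 := codeCount_nonneg (ωA.1 i.1) i.2.2.1
        have h7 := codeCount_nonneg (ωB.1 i.2.1) i.2.2.2
        have h8 := failure_le (jointProb ρ MA MB) δ (ωA.1 i.1) (ωB.1 i.2.1) (ωA.2 i.1)
          (ωB.2 i.2.1) w₀ i.2.2.1 i.2.2.2
        have h9 := mul_le_mul h2 h3 h4 (by positivity)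
        set F : ℝ := if rec' i = i.2.2 then 0 else 1 with hF
        have hF0 : 0 ≤ F := by rw [hF]; split_ifs <;> norm_num
        have e : (T i).trace.re = _ := h1
        rw [e]
        refine (mul_le_mul_of_nonneg_left (mul_le_mul_of_nonneg_right h9 h5)
          (by positivity)).trans ?_
        have h10 := mul_le_mul_of_nonneg_left h8 (show 0 ≤ ((N₁ : ℝ) * N₂)⁻¹ * 2 *
          (typicalMass (outcomeProb (reduceFst ρ) MA) δ n * (L₁ : ℝ)⁻¹) *
            (typicalMass (outcomeProb (reduceSnd ρ) MB) δ n * (L₂ : ℝ)⁻¹) *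
            overlap ρ MA MB δ i.2.2.1 i.2.2.2 by positivity)
        refine le_trans (le_of_eq ?_) h10
        ring
    _ = _ := by simp only [hs, Finset.sum_product]

/-- The expectation of a function of two independent random variables. -/
def pairExpect {α β : Type*} [Fintype α] [Fintype β] (w : α → ℝ) (w' : β → ℝ) (F : α → β → ℝ) : ℝ :=
  ∑ x, ∑ y, w x * w' y * F x y

section PairExpect

variable {α β ι : Type*} [Fintype α] [Fintype β] {w : α → ℝ} {w' : β → ℝ}

theorem pairExpect_add (F G : α → β → ℝ) :
    pairExpect w w' (fun x y => F x y + G x y) = pairExpect w w' F + pairExpect w w' G := by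
  simp only [pairExpect, mul_add, Finset.sum_add_distrib]

theorem pairExpect_const_mul (c : ℝ) (F : α → β → ℝ) :
    pairExpect w w' (fun x y => c * F x y) = c * pairExpect w w' F := by
  simp only [pairExpect, Finset.mul_sum]
  exact Finset.sum_congr rfl fun x _ => Finset.sum_congr rfl fun y _ => by ring

theorem pairExpect_sum (s : Finset ι) (F : ι → α → β → ℝ) :
    pairExpect w w' (fun x y => ∑ i ∈ s, F i x y) = ∑ i ∈ s, pairExpect w w' (F i) := by
  simp only [pairExpect, Finset.mul_sum]
  rw [Finset.sum_comm]
  conv_rhs => rw [Finset.sum_comm]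
  rw [Finset.sum_comm]
  exact Finset.sum_congr rfl fun x _ => Finset.sum_comm

theorem pairExpect_mul (f : α → ℝ) (g : β → ℝ) :
    pairExpect w w' (fun x y => f x * g y) = (∑ x, w x * f x) * ∑ y, w' y * g y := by
  rw [Finset.sum_mul_sum]
  exact Finset.sum_congr rfl fun x _ => Finset.sum_congr rfl fun y _ => by ring

theorem pairExpect_mono (hw : ∀ x, 0 ≤ w x) (hw' : ∀ y, 0 ≤ w' y) {F G : α → β → ℝ}
    (h : ∀ x y, F x y ≤ G x y) : pairExpect w w' F ≤ pairExpect w w' G :=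
  Finset.sum_le_sum fun x _ => Finset.sum_le_sum fun y _ =>
    mul_le_mul_of_nonneg_left (h x y) (mul_nonneg (hw x) (hw' y))

end PairExpect

/-- Conditioning on a set of mass at least 1/2 at most doubles probabilities, so estimates for the
unconditioned product law transfer to the codewords. -/
theorem prunedProb_le {X : Type*} [Fintype X] {p : X → ℝ} (hp : ∀ x, 0 ≤ p x)
    (hm : 1 / 2 ≤ typicalMass p δ n) (x : Fin n → X) : prunedProb p δ x ≤ 2 * seqProb p x := by
  have h := seqProb_nonneg hp x
  unfold prunedProb
  split_ifs
  · rw [div_le_iff₀ (by linarith)]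
    nlinarith
  · linarith

/-- The expected contribution of a pair `(u, v)`. -/
theorem expect_failure_le {q : U × V → ℝ} {pU : U → ℝ} {pV : V → ℝ} (hq : ∀ s, 0 ≤ q s)
    (hU : ∀ u, pU u = ∑ v, q (u, v)) (hV : ∀ v, pV v = ∑ u, q (u, v)) (hn : 0 < n)
    (hA : 1 / 2 ≤ typicalMass pU δ n) (hB : 1 / 2 ≤ typicalMass pV δ n) (hK₁ : 0 < K₁)
    (hK₂ : 0 < K₂) (μ₁ : Fin N₁) (μ₂ : Fin N₂) (u : Fin n → U) (v : Fin n → V) :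
    pairExpect (choiceProb (N := N₁) (L := L₁) (K := K₁) (n := n) pU δ)
      (choiceProb (N := N₂) (L := L₂) (K := K₂) (n := n) pV δ) (fun ωA ωB =>
        codeCount (ωA.1 μ₁) u * codeCount (ωB.1 μ₂) v *
          failureBound q δ (ωA.1 μ₁) (ωB.1 μ₂) (ωA.2 μ₁) (ωB.2 μ₂) u v) ≤
    (L₁ * prunedProb pU δ u) * (L₂ * prunedProb pV δ v) *
      ((1 - jointTypical q δ u v) +
        ((L₁ / K₁) * (L₂ / K₂) + L₂ / K₂ + L₁ / K₁) * (2 * packingBound q pU pV δ n)) := by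
  have hpU : ∀ u, 0 ≤ pU u := fun u => by rw [hU]; exact Finset.sum_nonneg fun v _ => hq _
  have hpV : ∀ v, 0 ≤ pV v := fun v => by rw [hV]; exact Finset.sum_nonneg fun u _ => hq _
  have hA0 : 0 < typicalMass pU δ n := by linarith
  have hB0 : 0 < typicalMass pV δ n := by linarith
  set wA : Choices U n N₁ L₁ K₁ → ℝ := choiceProb pU δ with hwA
  set wB : Choices V n N₂ L₂ K₂ → ℝ := choiceProb pV δ with hwB
  set β := packingBound q pU pV δ n with hβ
  have hβ0 : 0 ≤ β := packingBound_nonneg _ _ _ _ _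
  set A : ℝ := L₁ * prunedProb pU δ u with hAdef
  set B : ℝ := L₂ * prunedProb pV δ v with hBdef
  have hA' : 0 ≤ A := mul_nonneg (by positivity) (prunedProb_nonneg hpU δ u)
  have hB' : 0 ≤ B := mul_nonneg (by positivity) (prunedProb_nonneg hpV δ v)
  set J : (Fin n → U) → (Fin n → V) → ℝ := jointTypical q δ with hJ
  have hJ0 : ∀ u v, 0 ≤ J u v := fun u v => jointTypical_nonneg q δ u v
  set f : Choices U n N₁ L₁ K₁ → ℝ := fun ω => codeCount (ω.1 μ₁) u with hf
  set g : Choices V n N₂ L₂ K₂ → ℝ := fun ω => codeCount (ω.1 μ₂) v with hg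
  set f' : (Fin n → U) → Choices U n N₁ L₁ K₁ → ℝ := fun u' ω =>
    codeCount (ω.1 μ₁) u * collisionCount (ω.1 μ₁) (ω.2 μ₁) u u' with hf'
  set g' : (Fin n → V) → Choices V n N₂ L₂ K₂ → ℝ := fun v' ω =>
    codeCount (ω.1 μ₂) v * collisionCount (ω.1 μ₂) (ω.2 μ₂) v v' with hg'
  have ef : ∑ ω, wA ω * f ω = A := expect_codeCount hA0 hK₁ μ₁ u
  have eg : ∑ ω, wB ω * g ω = B := expect_codeCount hB0 hK₂ μ₂ v
  have ef' : ∀ u', ∑ ω, wA ω * f' u' ω ≤ A * (L₁ / K₁ * prunedProb pU δ u') := fun u' =>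
    expect_codeCount_mul_collisionCount_le hpU hA0 hK₁ μ₁ u u'
  have eg' : ∀ v', ∑ ω, wB ω * g' v' ω ≤ B * (L₂ / K₂ * prunedProb pV δ v') := fun v' =>
    expect_codeCount_mul_collisionCount_le hpV hB0 hK₂ μ₂ v v'
  have eg0 : ∀ v', 0 ≤ ∑ ω, wB ω * g' v' ω := fun v' => Finset.sum_nonneg fun ω _ =>
    mul_nonneg (choiceProb_nonneg hpV ω)
      (mul_nonneg (codeCount_nonneg _ _) (collisionCount_nonneg _ _ _ _))
  have hJv : ∀ u', ∑ v', J u' v' * prunedProb pV δ v' ≤ 2 * β := fun u' => by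
    refine le_trans ?_ (mul_le_mul_of_nonneg_left (sum_typical_snd_le hq hU hV δ hn u')
      zero_le_two)
    rw [Finset.mul_sum]
    refine Finset.sum_le_sum fun v' _ => ?_
    simp only [hJ, jointTypical]
    split_ifs
    · rw [one_mul]; exact prunedProb_le hpV hB v'
    · simp
  have hJu : ∀ v', ∑ u', J u' v' * prunedProb pU δ u' ≤ 2 * β := fun v' => by
    refine le_trans ?_ (mul_le_mul_of_nonneg_left (sum_typical_fst_le hq hU hV δ hn v')
      zero_le_two)
    rw [Finset.mul_sum]
    refine Finset.sum_le_sum fun u' _ => ?_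
    simp only [hJ, jointTypical]
    split_ifs
    · rw [one_mul]; exact prunedProb_le hpU hA u'
    · simp
  -- Each summand is rewritten as a function of the choices of A times a function of the choices of
  -- B, so that expectations factor by independence.
  have e : (fun (ωA : Choices U n N₁ L₁ K₁) (ωB : Choices V n N₂ L₂ K₂) =>
      codeCount (ωA.1 μ₁) u * codeCount (ωB.1 μ₂) v *
          failureBound q δ (ωA.1 μ₁) (ωB.1 μ₂) (ωA.2 μ₁) (ωB.2 μ₂) u v) =
      fun ωA ωB => (((1 - J u v) * (f ωA * g ωB) +
        ∑ u', ∑ v', J u' v' * (f' u' ωA * g' v' ωB)) +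
        ∑ v', J u v' * (f ωA * g' v' ωB)) + ∑ u', J u' v * (f' u' ωA * g ωB) := by
    ext ωA ωB
    simp only [failureBound, mul_add, Finset.mul_sum, hf, hg, hf', hg', ← hJ]
    refine congrArg₂ (· + ·) (congrArg₂ (· + ·) (congrArg₂ (· + ·) ?_ ?_) ?_) ?_
    · ring
    · exact Finset.sum_congr rfl fun u' _ => Finset.sum_congr rfl fun v' _ => by ring
    · exact Finset.sum_congr rfl fun v' _ => by ring
    · exact Finset.sum_congr rfl fun u' _ => by ring
  rw [e]
  simp only [pairExpect_add, pairExpect_sum, pairExpect_const_mul, pairExpect_mul, ef, eg]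
  -- The packing bound is spent on the sum over v' for each fixed u'; the sum over u' then only uses
  -- normalization.
  have t2 : ∑ u', ∑ v', J u' v' * ((∑ ω, wA ω * f' u' ω) * ∑ ω, wB ω * g' v' ω) ≤
      A * B * ((L₁ / K₁) * (L₂ / K₂) * (2 * β)) := by
    calc ∑ u', ∑ v', J u' v' * ((∑ ω, wA ω * f' u' ω) * ∑ ω, wB ω * g' v' ω)
        ≤ ∑ u', ∑ v', J u' v' * ((A * (L₁ / K₁ * prunedProb pU δ u')) *
            (B * (L₂ / K₂ * prunedProb pV δ v'))) :=
          Finset.sum_le_sum fun u' _ => Finset.sum_le_sum fun v' _ =>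
            mul_le_mul_of_nonneg_left (mul_le_mul (ef' u') (eg' v') (eg0 v')
              (mul_nonneg hA' (mul_nonneg (by positivity) (prunedProb_nonneg hpU δ u'))))
              (hJ0 _ _)
      _ = ∑ u', (A * B * ((L₁ / K₁) * (L₂ / K₂)) * prunedProb pU δ u') *
            ∑ v', J u' v' * prunedProb pV δ v' := by
          simp only [Finset.mul_sum]
          exact Finset.sum_congr rfl fun u' _ => Finset.sum_congr rfl fun v' _ => by ring
      _ ≤ ∑ u', (A * B * ((L₁ / K₁) * (L₂ / K₂)) * prunedProb pU δ u') * (2 * β) :=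
          Finset.sum_le_sum fun u' _ => mul_le_mul_of_nonneg_left (hJv u')
            (mul_nonneg (by positivity) (prunedProb_nonneg hpU δ u'))
      _ = _ := by
          rw [← Finset.sum_mul, ← Finset.mul_sum, sum_prunedProb hA0]
          ring
  have t3 : ∑ v', J u v' * (A * ∑ ω, wB ω * g' v' ω) ≤ A * B * (L₂ / K₂ * (2 * β)) := by
    calc ∑ v', J u v' * (A * ∑ ω, wB ω * g' v' ω)
        ≤ ∑ v', J u v' * (A * (B * (L₂ / K₂ * prunedProb pV δ v'))) :=
          Finset.sum_le_sum fun v' _ => mul_le_mul_of_nonneg_left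
            (mul_le_mul_of_nonneg_left (eg' v') hA') (hJ0 _ _)
      _ = A * B * (L₂ / K₂) * ∑ v', J u v' * prunedProb pV δ v' := by
          rw [Finset.mul_sum]
          exact Finset.sum_congr rfl fun v' _ => by ring
      _ ≤ A * B * (L₂ / K₂) * (2 * β) := mul_le_mul_of_nonneg_left (hJv u) (by positivity)
      _ = _ := by ring
  have t4 : ∑ u', J u' v * ((∑ ω, wA ω * f' u' ω) * B) ≤ A * B * (L₁ / K₁ * (2 * β)) := by
    calc ∑ u', J u' v * ((∑ ω, wA ω * f' u' ω) * B)
        ≤ ∑ u', J u' v * ((A * (L₁ / K₁ * prunedProb pU δ u')) * B) :=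
          Finset.sum_le_sum fun u' _ => mul_le_mul_of_nonneg_left
            (mul_le_mul_of_nonneg_right (ef' u') hB') (hJ0 _ _)
      _ = A * B * (L₁ / K₁) * ∑ u', J u' v * prunedProb pU δ u' := by
          rw [Finset.mul_sum]
          exact Finset.sum_congr rfl fun v' _ => by ring
      _ ≤ A * B * (L₁ / K₁) * (2 * β) := mul_le_mul_of_nonneg_left (hJu v) (by positivity)
      _ = _ := by ring
  linarith

end BinningErrorBound

/-! ### The expected binning error and its limit -/

section ExpectedError

open scoped MatrixOrder
open Filter Topology

variable {a b U V Z : Type*} [Fintype a] [DecidableEq a] [Fintype b] [DecidableEq b]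
  [Fintype U] [DecidableEq U] [Fintype V] [DecidableEq V] [Fintype Z]
  {ρ : Matrix (a × b) (a × b) ℂ} {MA : U → Matrix a a ℂ} {MB : V → Matrix b b ℂ}
  {P : U → V → Z → ℝ} {δ η : ℝ} {n N₁ N₂ L₁ L₂ K₁ K₂ : ℕ}

theorem sum_not_jointTypical_le {q : U × V → ℝ} (hq : ∀ s, 0 ≤ q s) (hq1 : ∑ s, q s = 1)
    (S : Finset (Fin n → U)) (T : Finset (Fin n → V)) :
    ∑ u ∈ S, ∑ v ∈ T, (1 - jointTypical q δ u v) * seqProb q (fun k => (u k, v k)) ≤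
      1 - typicalMass q δ n := by
  classical
  have hnn : ∀ u v, 0 ≤ (1 - jointTypical q δ u v) * seqProb q (fun k : Fin n => (u k, v k)) :=
    fun u v => mul_nonneg (sub_nonneg.2 (jointTypical_le_one _ _ _ _)) (seqProb_nonneg hq _)
  calc ∑ u ∈ S, ∑ v ∈ T, (1 - jointTypical q δ u v) * seqProb q (fun k => (u k, v k))
      ≤ ∑ u ∈ S, ∑ v, (1 - jointTypical q δ u v) * seqProb q (fun k => (u k, v k)) :=
        Finset.sum_le_sum fun u _ => Finset.sum_le_sum_of_subset_of_nonneg (Finset.subset_univ _)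
          fun v _ _ => hnn u v
    _ ≤ ∑ u, ∑ v, (1 - jointTypical q δ u v) * seqProb q (fun k => (u k, v k)) :=
        Finset.sum_le_sum_of_subset_of_nonneg (Finset.subset_univ _)
          fun u _ _ => Finset.sum_nonneg fun v _ => hnn u v
    _ = ∑ x : Fin n → U × V, (1 - if x ∈ typicalSet q δ n then 1 else 0) * seqProb q x := by
        rw [← (Equiv.arrowProdEquivProdArrow (Fin n) (fun _ => U) (fun _ => V)).symm.sum_comp,
          Fintype.sum_prod_type]
        refine Finset.sum_congr rfl fun u _ => Finset.sum_congr rfl fun v _ => ?_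
        unfold jointTypical
        congr!
    _ = 1 - typicalMass q δ n := by
        simp only [sub_mul, one_mul, Finset.sum_sub_distrib, sum_seqProb_eq_one hq1, ite_mul,
          zero_mul, Finset.sum_ite_mem, Finset.univ_inter, typicalMass]

/-- A bound for the expected binning error. -/
def expectedErrorBound (ρ : Matrix (a × b) (a × b) ℂ) (MA : U → Matrix a a ℂ)
    (MB : V → Matrix b b ℂ) (δ : ℝ) (n L₁ L₂ K₁ K₂ : ℕ) : ℝ :=
  2 * (16 * (1 - typicalMass (jointProb ρ MA MB) δ n) +
    (partyError (reduceFst ρ) MA δ n + 4 * partyError (reduceSnd ρ) MB δ n) +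
    ((L₁ / K₁ : ℝ) * (L₂ / K₂) + L₂ / K₂ + L₁ / K₁) *
      (2 * packingBound (jointProb ρ MA MB) (outcomeProb (reduceFst ρ) MA)
        (outcomeProb (reduceSnd ρ) MB) δ n))

theorem jointProb_nonneg (hρ : 0 ≤ ρ) (hMA : ∀ x, 0 ≤ MA x) (hMB : ∀ x, 0 ≤ MB x) (s : U × V) :
    0 ≤ jointProb ρ MA MB s :=
  outcomeProb_nonneg (M := fun w : U × V => MA w.1 ⊗ₖ MB w.2) hρ
    (fun _ => kronecker_nonneg (hMA _) (hMB _)) s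

theorem sum_jointProb (htr : ρ.trace.re = 1) (hMA1 : ∑ x, MA x = 1) (hMB1 : ∑ x, MB x = 1) :
    ∑ s, jointProb ρ MA MB s = 1 := by
  rw [Fintype.sum_prod_type]
  simp only [← marginal_fst hMB1]
  rw [sum_outcomeProb hMA1, trace_reduceFst, htr]

/-- The expected codeword counts cancel the codebook sizes, and the pruned probabilities times the
typical mass give back λ_u and λ_v. The part that is not jointly typical is then a test against the
POVMs, while the collision part is a constant times the total overlap. -/
theorem pairExpect_binningError_le (hρ : 0 ≤ ρ) (htr : ρ.trace.re = 1) (hMA : ∀ x, 0 ≤ MA x)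
    (hMA1 : ∑ x, MA x = 1) (hMB : ∀ x, 0 ≤ MB x) (hMB1 : ∑ x, MB x = 1) (hP : IsStochastic P)
    (hη : 0 < η) (hn : 0 < n)
    (hA : 1 / 2 ≤ typicalMass (outcomeProb (reduceFst ρ) MA) δ n)
    (hB : 1 / 2 ≤ typicalMass (outcomeProb (reduceSnd ρ) MB) δ n)
    (hN₁ : 0 < N₁) (hN₂ : 0 < N₂) (hL₁ : 0 < L₁) (hL₂ : 0 < L₂) (hK₁ : 0 < K₁) (hK₂ : 0 < K₂)
    (w₀ : (Fin n → U) × (Fin n → V)) :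
    pairExpect (choiceProb (N := N₁) (L := L₁) (K := K₁) (outcomeProb (reduceFst ρ) MA) δ)
      (choiceProb (N := N₂) (L := L₂) (K := K₂) (outcomeProb (reduceSnd ρ) MB) δ)
      (binningError ρ MA MB P δ η w₀) ≤ expectedErrorBound ρ MA MB δ n L₁ L₂ K₁ K₂ := by
  have hA0 : 0 < typicalMass (outcomeProb (reduceFst ρ) MA) δ n := by linarith
  have hB0 : 0 < typicalMass (outcomeProb (reduceSnd ρ) MB) δ n := by linarith
  have hpA := outcomeProb_nonneg (reduceFst_nonneg hρ) hMA
  have hpB := outcomeProb_nonneg (reduceSnd_nonneg hρ) hMB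
  have hq := jointProb_nonneg hρ hMA hMB
  refine (pairExpect_mono (choiceProb_nonneg hpA) (choiceProb_nonneg hpB) fun ωA ωB =>
    binningError_le hρ hMA hMB hP hη hA0 hB0 w₀ ωA ωB).trans ?_
  simp only [pairExpect_sum, pairExpect_const_mul]
  set γ : ℝ := ((L₁ / K₁ : ℝ) * (L₂ / K₂) + L₂ / K₂ + L₁ / K₁) *
      (2 * packingBound (jointProb ρ MA MB) (outcomeProb (reduceFst ρ) MA)
        (outcomeProb (reduceSnd ρ) MB) δ n) with hγ
  have hγ0 : 0 ≤ γ := mul_nonneg (by positivity)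
    (mul_nonneg zero_le_two (packingBound_nonneg _ _ _ _ _))
  have hN₁' : (N₁ : ℝ) ≠ 0 := by exact_mod_cast hN₁.ne'
  have hN₂' : (N₂ : ℝ) ≠ 0 := by exact_mod_cast hN₂.ne'
  have hL₁' : (L₁ : ℝ) ≠ 0 := by exact_mod_cast hL₁.ne'
  have hL₂' : (L₂ : ℝ) ≠ 0 := by exact_mod_cast hL₂.ne'
  set J : (Fin n → U) → (Fin n → V) → ℝ := jointTypical (jointProb ρ MA MB) δ with hJ
  have main : ∀ (μ₁ : Fin N₁) (μ₂ : Fin N₂),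
      ∀ u ∈ typicalSet (outcomeProb (reduceFst ρ) MA) δ n,
      ∀ v ∈ typicalSet (outcomeProb (reduceSnd ρ) MB) δ n,
      (((N₁ : ℝ) * N₂)⁻¹ * 2 * (typicalMass (outcomeProb (reduceFst ρ) MA) δ n * (L₁ : ℝ)⁻¹) *
            (typicalMass (outcomeProb (reduceSnd ρ) MB) δ n * (L₂ : ℝ)⁻¹) *
            overlap ρ MA MB δ u v) *
        pairExpect (choiceProb (N := N₁) (L := L₁) (K := K₁) (outcomeProb (reduceFst ρ) MA) δ)
          (choiceProb (N := N₂) (L := L₂) (K := K₂) (outcomeProb (reduceSnd ρ) MB) δ)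
          (fun ωA ωB => codeCount (ωA.1 μ₁) u * codeCount (ωB.1 μ₂) v *
            failureBound (jointProb ρ MA MB) δ (ωA.1 μ₁) (ωB.1 μ₂) (ωA.2 μ₁) (ωB.2 μ₂) u v) ≤
      ((N₁ : ℝ) * N₂)⁻¹ * (2 * (seqProb (outcomeProb (reduceFst ρ) MA) u *
        seqProb (outcomeProb (reduceSnd ρ) MB) v * overlap ρ MA MB δ u v * (1 - J u v) +
        γ * (seqProb (outcomeProb (reduceFst ρ) MA) u *
        seqProb (outcomeProb (reduceSnd ρ) MB) v * overlap ρ MA MB δ u v))) := by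
    intro μ₁ μ₂ u hu v hv
    have h1 := expect_failure_le (N₁ := N₁) (N₂ := N₂) (L₁ := L₁) (L₂ := L₂) hq
      (fun u => marginal_fst hMB1 u) (fun v => marginal_snd hMA1 v) hn hA hB hK₁ hK₂ μ₁ μ₂ u v
    have h2 := overlap_nonneg hρ hMA hMB δ u v
    refine (mul_le_mul_of_nonneg_left h1 (by positivity)).trans (le_of_eq ?_)
    rw [← typicalMass_mul_prunedProb hA0 hu, ← typicalMass_mul_prunedProb hB0 hv, ← hγ, ← hJ]
    field_simp
  refine (Finset.sum_le_sum fun μ₁ _ => Finset.sum_le_sum fun μ₂ _ => Finset.sum_le_sum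
    fun u hu => Finset.sum_le_sum fun v hv => main μ₁ μ₂ u hu v hv).trans ?_
  simp only [← Finset.mul_sum, Finset.sum_add_distrib, Finset.sum_const, Finset.card_univ,
    Fintype.card_fin, nsmul_eq_mul]
  have s1 := sum_overlap_mul_le (n := n) hρ htr hMA hMA1 hMB hMB1 hA0 hB0 (fun u v => 1 - J u v)
    (fun u v => sub_nonneg.2 (jointTypical_le_one _ _ _ _))
    (fun u v => sub_le_self _ (jointTypical_nonneg _ _ _ _))
  have s2 := sum_overlap_le_one (n := n) hρ htr hMA hMA1 hMB hMB1 hA0 hB0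
  have s3 := sum_not_jointTypical_le (δ := δ) hq (sum_jointProb htr hMA1 hMB1)
    (typicalSet (outcomeProb (reduceFst ρ) MA) δ n) (typicalSet (outcomeProb (reduceSnd ρ) MB) δ n)
  have s4 := mul_le_mul_of_nonneg_left s2 hγ0
  rw [expectedErrorBound, ← hγ]
  -- The summands no longer depend on μ₁, μ₂, so averaging over them cancels N₁ N₂.
  have hcancel : ∀ x y : ℝ, ((N₁ : ℝ) * N₂)⁻¹ * (2 * (N₂ * (N₁ * x) + γ * (N₂ * (N₁ * y)))) =
      2 * (x + γ * y) := fun x y => by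
    field_simp
  rw [hcancel]
  linarith

/-- Markov's inequality for the nonnegative binning error. -/
theorem binningErrorProb_le (hρ : 0 ≤ ρ) (hMA : ∀ x, 0 ≤ MA x) (hMB : ∀ x, 0 ≤ MB x)
    (w₀ : (Fin n → U) × (Fin n → V)) (t : ℝ) :
    t * binningErrorProb ρ MA MB P δ η n N₁ N₂ L₁ L₂ K₁ K₂ w₀ t ≤
      pairExpect (choiceProb (N := N₁) (L := L₁) (K := K₁) (outcomeProb (reduceFst ρ) MA) δ)
        (choiceProb (N := N₂) (L := L₂) (K := K₂) (outcomeProb (reduceSnd ρ) MB) δ)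
        (binningError ρ MA MB P δ η w₀) := by
  have hpA := outcomeProb_nonneg (reduceFst_nonneg hρ) hMA
  have hpB := outcomeProb_nonneg (reduceSnd_nonneg hρ) hMB
  rw [binningErrorProb, pairExpect, Finset.mul_sum]
  refine Finset.sum_le_sum fun ωA _ => ?_
  rw [Finset.mul_sum]
  refine Finset.sum_le_sum fun ωB _ => ?_
  have hw := mul_nonneg (choiceProb_nonneg (δ := δ) hpA ωA) (choiceProb_nonneg (δ := δ) hpB ωB)
  split_ifs with h
  · rw [mul_comm]
    exact mul_le_mul_of_nonneg_left h.le hw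
  · rw [mul_zero]
    exact mul_nonneg hw (Finset.sum_nonneg fun z _ => traceNorm_nonneg _)

theorem tendsto_partyError {κ X : Type*} [Fintype κ] [DecidableEq κ] [Fintype X]
    {ρ : Matrix κ κ ℂ} (hρ : 0 ≤ ρ) (htr : ρ.trace.re = 1) {M : X → Matrix κ κ ℂ}
    (hM : ∀ x, 0 ≤ M x) (hM1 : ∑ x, M x = 1) (hδ : 0 < δ) :
    Tendsto (fun n => partyError ρ M δ n) atTop (𝓝 0) := by
  have h1 := tendsto_atypicalWeight (Matrix.nonneg_iff_posSemidef.1 hρ) htr hδ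
  have h2 := tendsto_typicalMass (outcomeProb_nonneg hρ hM) ((sum_outcomeProb hM1).trans htr) hδ
  have h3 := (h1.const_mul 4).add ((h2.const_sub 1).const_mul 2)
  simpa [partyError] using h3

theorem one_le_two_rpow {R : ℝ} (hR : 0 ≤ R) (n : ℕ) : 1 ≤ (2 : ℝ) ^ ((n : ℝ) * R) :=
  Real.one_le_rpow (by norm_num) (by positivity)

theorem rateSize_pos {R : ℝ} (hR : 0 ≤ R) (n : ℕ) : 0 < rateSize n R :=
  Nat.floor_pos.2 (one_le_two_rpow hR n)

/-- The factor 2 pays for the floor in the denominator: an integer part that is at least 1 exceeds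
half of the number. -/
theorem rateSize_div_le {R R' : ℝ} (hR : 0 ≤ R) (n : ℕ) :
    (rateSize n R' : ℝ) / rateSize n R ≤ 2 * (2 : ℝ) ^ ((n : ℝ) * (R' - R)) := by
  have h1 : (rateSize n R' : ℝ) ≤ (2 : ℝ) ^ ((n : ℝ) * R') := Nat.floor_le (by positivity)
  have hpos : (0 : ℝ) < rateSize n R := by exact_mod_cast rateSize_pos hR n
  have hone : (1 : ℝ) ≤ rateSize n R := by exact_mod_cast rateSize_pos hR n
  have h2 : (2 : ℝ) ^ ((n : ℝ) * R) < rateSize n R + 1 := Nat.lt_floor_add_one _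
  rw [div_le_iff₀ hpos]
  have e : (2 : ℝ) ^ ((n : ℝ) * R') = 2 ^ ((n : ℝ) * (R' - R)) * 2 ^ ((n : ℝ) * R) := by
    rw [← Real.rpow_add (by norm_num)]
    ring_nf
  have hp : (0 : ℝ) < 2 ^ ((n : ℝ) * (R' - R)) := by positivity
  rw [e] at h1
  nlinarith

theorem tendsto_expectedErrorBound (hρ : 0 ≤ ρ) (htr : ρ.trace.re = 1) (hMA : ∀ x, 0 ≤ MA x)
    (hMA1 : ∑ x, MA x = 1) (hMB : ∀ x, 0 ≤ MB x) (hMB1 : ∑ x, MB x = 1) (hδ : 0 < δ)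
    {R₁ R₂ Rt₁ Rt₂ : ℝ} (hR₁ : 0 ≤ R₁) (hRt₁ : R₁ ≤ Rt₁) (hR₂ : 0 ≤ R₂) (hRt₂ : R₂ ≤ Rt₂)
    (hlt : Rt₁ + Rt₂ - R₁ - R₂ + δ * typicalityConst (jointProb ρ MA MB)
        (outcomeProb (reduceFst ρ) MA) (outcomeProb (reduceSnd ρ) MB) <
      shannon (outcomeProb (reduceFst ρ) MA) + shannon (outcomeProb (reduceSnd ρ) MB) -
        shannon (jointProb ρ MA MB)) :
    Tendsto (fun n => expectedErrorBound ρ MA MB δ n (rateSize n Rt₁) (rateSize n Rt₂)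
      (rateSize n R₁) (rateSize n R₂)) atTop (𝓝 0) := by
  have hA := tendsto_partyError (reduceFst_nonneg hρ) ((congrArg Complex.re
    (trace_reduceFst ρ)).trans htr) hMA hMA1 hδ
  have hB := tendsto_partyError (reduceSnd_nonneg hρ) ((congrArg Complex.re
    (trace_reduceSnd ρ)).trans htr) hMB hMB1 hδ
  have hq := tendsto_typicalMass (jointProb_nonneg hρ hMA hMB) (sum_jointProb htr hMA1 hMB1) hδ
  set c : ℝ := shannon (outcomeProb (reduceFst ρ) MA) + shannon (outcomeProb (reduceSnd ρ) MB) -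
        shannon (jointProb ρ MA MB) - δ * typicalityConst (jointProb ρ MA MB)
        (outcomeProb (reduceFst ρ) MA) (outcomeProb (reduceSnd ρ) MB) with hc
  -- The slack left in the exponent after the codeword excess of both parties; its positivity is the
  -- rate condition with the δ-correction.
  set r : ℝ := c - (Rt₁ - R₁) - (Rt₂ - R₂) with hr
  have hr0 : 0 < r := by rw [hr, hc]; linarith
  have hG : Tendsto (fun n : ℕ => (((rateSize n Rt₁ : ℝ) / rateSize n R₁) *
      (rateSize n Rt₂ / rateSize n R₂) + rateSize n Rt₂ / rateSize n R₂ +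
      rateSize n Rt₁ / rateSize n R₁) * (2 * packingBound (jointProb ρ MA MB)
        (outcomeProb (reduceFst ρ) MA) (outcomeProb (reduceSnd ρ) MB) δ n)) atTop (𝓝 0) := by
    have hgeo : Tendsto (fun n : ℕ => 16 * ((2 : ℝ) ^ (-r)) ^ n) atTop (𝓝 0) := by
      have := (tendsto_pow_atTop_nhds_zero_of_lt_one (r := (2 : ℝ) ^ (-r)) (by positivity)
        (Real.rpow_lt_one_of_one_lt_of_neg (by norm_num) (by linarith))).const_mul 16
      simpa using this
    refine squeeze_zero (fun n => mul_nonneg (by positivity) (mul_nonneg zero_le_two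
      (packingBound_nonneg _ _ _ _ _))) (fun n => ?_) hgeo
    have h1 := rateSize_div_le (R' := Rt₁) hR₁ n
    have h2 := rateSize_div_le (R' := Rt₂) hR₂ n
    set x := (rateSize n Rt₁ : ℝ) / rateSize n R₁ with hx
    set y := (rateSize n Rt₂ : ℝ) / rateSize n R₂ with hy
    have hx0 : 0 ≤ x := by positivity
    have hy0 : 0 ≤ y := by positivity
    have o1 := one_le_two_rpow (sub_nonneg.2 hRt₁) n
    have o2 := one_le_two_rpow (sub_nonneg.2 hRt₂) n
    set A := (2 : ℝ) ^ ((n : ℝ) * (Rt₁ - R₁)) with hA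
    set B := (2 : ℝ) ^ ((n : ℝ) * (Rt₂ - R₂)) with hB
    -- Since R̃ᵢ ≥ Rᵢ, both A and B are at least 1, so the one-sided collision terms are dominated
    -- by the two-sided one: 8 = 4 + 2 + 2. Doubling by the packing term gives the 16 above.
    have hxy : x * y + y + x ≤ 8 * (A * B) := by
      have := mul_le_mul h1 h2 hy0 (by positivity)
      nlinarith
    have e : ((2 : ℝ) ^ (-r)) ^ n = A * B * packingBound (jointProb ρ MA MB)
        (outcomeProb (reduceFst ρ) MA) (outcomeProb (reduceSnd ρ) MB) δ n := by
      rw [packingBound, hA, hB, ← Real.rpow_add (by norm_num), ← Real.rpow_add (by norm_num),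
        ← Real.rpow_natCast, ← Real.rpow_mul (by norm_num), ← hc, hr]
      ring_nf
    rw [e]
    have hβ := packingBound_nonneg (jointProb ρ MA MB)
        (outcomeProb (reduceFst ρ) MA) (outcomeProb (reduceSnd ρ) MB) δ n
    nlinarith [mul_le_mul_of_nonneg_right hxy hβ]
  have := ((((hq.const_sub 1).const_mul 16).add (hA.add (hB.const_mul 4))).add hG).const_mul 2
  simpa [expectedErrorBound] using this

end ExpectedError

end MutualPacking

end

/-! ### Conclusion: choice of the two functions and Markov's inequality. -/

open scoped MatrixOrder in
theorem mainTheorem7 {a b U V Z : Type*} [Fintype a] [DecidableEq a] [Fintype b] [DecidableEq b]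
    [Fintype U] [DecidableEq U] [Fintype V] [DecidableEq V] [Fintype Z] [DecidableEq Z]
    (ρ : Matrix (a × b) (a × b) ℂ) (hρ : MutualPacking.IsDensity ρ)
    (MA : U → Matrix a a ℂ) (hMA : MutualPacking.IsPOVM MA)
    (MB : V → Matrix b b ℂ) (hMB : MutualPacking.IsPOVM MB)
    (P : U → V → Z → ℝ) (hP : MutualPacking.IsStochastic P) :
    ∃ εS δS : ℝ → ℝ,
      MonotoneOn εS (Set.Ioi 0) ∧ Filter.Tendsto εS (nhdsWithin 0 (Set.Ioi 0)) (nhds 0) ∧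
      MonotoneOn δS (Set.Ioi 0) ∧ Filter.Tendsto δS (nhdsWithin 0 (Set.Ioi 0)) (nhds 0) ∧
      ∀ R₁ R₂ Rt₁ Rt₂ : ℝ, 0 ≤ R₁ → R₁ ≤ Rt₁ → 0 ≤ R₂ → R₂ ≤ Rt₂ →
        Rt₁ + Rt₂ - R₁ - R₂ < MutualPacking.mutualInfoUV ρ MA MB P →
        ∀ᶠ δ : ℝ in nhdsWithin 0 (Set.Ioi 0), ∀ᶠ n : ℕ in Filter.atTop,
          ∀ N₁ N₂ : ℕ, 0 < N₁ → 0 < N₂ → ∀ η : ℝ, 0 < η → η < 1 →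
          ∀ w₀ : (Fin n → U) × (Fin n → V),
            MutualPacking.binningErrorProb ρ MA MB P δ η n N₁ N₂
              (MutualPacking.rateSize n Rt₁) (MutualPacking.rateSize n Rt₂)
              (MutualPacking.rateSize n R₁) (MutualPacking.rateSize n R₂) w₀ (εS δ) ≤ δS δ := by
  have h0 : 0 ≤ ρ := hρ.1.nonneg
  have htr : ρ.trace.re = 1 := by rw [hρ.2, Complex.one_re]
  have hA0 : ∀ x, 0 ≤ MA x := fun x => (hMA.1 x).nonneg
  have hB0 : ∀ x, 0 ≤ MB x := fun x => (hMB.1 x).nonneg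
  have hid : Filter.Tendsto (fun t : ℝ => t) (nhdsWithin 0 (Set.Ioi 0)) (nhds 0) :=
    Filter.tendsto_id.mono_left nhdsWithin_le_nhds
  -- The expectation vanishes as n → ∞ at fixed δ, so any positive target is reached; the identity
  -- is the simplest monotone choice.
  refine ⟨fun t => t, fun t => t, fun _ _ _ _ h => h, hid, fun _ _ _ _ h => h, hid, ?_⟩
  intro R₁ R₂ Rt₁ Rt₂ hR₁ hRt₁ hR₂ hRt₂ hI
  rw [MutualPacking.mutualInfoUV_eq h0 hA0 hMA.2 hB0 hMB.2 hP] at hI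
  -- For small δ the loss δ · `typicalityConst` fits into the strict gap between the rates and the
  -- mutual information. Only this choice of δ depends on the rates.
  have hlim : Filter.Tendsto (fun t : ℝ => Rt₁ + Rt₂ - R₁ - R₂ + t *
      MutualPacking.typicalityConst (MutualPacking.jointProb ρ MA MB)
        (MutualPacking.outcomeProb (MutualPacking.reduceFst ρ) MA)
        (MutualPacking.outcomeProb (MutualPacking.reduceSnd ρ) MB))
      (nhdsWithin 0 (Set.Ioi 0)) (nhds (Rt₁ + Rt₂ - R₁ - R₂)) := by
    simpa using (hid.mul_const _).const_add (Rt₁ + Rt₂ - R₁ - R₂)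
  filter_upwards [hlim.eventually_lt_const hI, self_mem_nhdsWithin] with δ hδI hδ
  have hδ0 : 0 < δ := hδ
  have t1 := MutualPacking.tendsto_expectedErrorBound h0 htr hA0 hMA.2 hB0 hMB.2 hδ0
    hR₁ hRt₁ hR₂ hRt₂ hδI
  have hρA := MutualPacking.reduceFst_nonneg h0
  have hρB := MutualPacking.reduceSnd_nonneg h0
  have tA := MutualPacking.tendsto_typicalMass (MutualPacking.outcomeProb_nonneg hρA hA0)
    ((MutualPacking.sum_outcomeProb hMA.2).trans
      ((congrArg Complex.re (MutualPacking.trace_reduceFst ρ)).trans htr)) hδ0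
  have tB := MutualPacking.tendsto_typicalMass (MutualPacking.outcomeProb_nonneg hρB hB0)
    ((MutualPacking.sum_outcomeProb hMB.2).trans
      ((congrArg Complex.re (MutualPacking.trace_reduceSnd ρ)).trans htr)) hδ0
  -- An expectation of at most δ · δ makes the probability of exceeding δ at most δ by Markov. The
  -- lower bounds 1/2 on the typical masses are those needed to pass from pruned to product laws.
  filter_upwards [t1.eventually_le_const (show (0 : ℝ) < δ * δ by positivity),
    tA.eventually_const_le (show (1 / 2 : ℝ) < 1 by norm_num),
    tB.eventually_const_le (show (1 / 2 : ℝ) < 1 by norm_num),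
    Filter.eventually_gt_atTop 0] with n hn1 hnA hnB hn0
  intro N₁ N₂ hN₁ hN₂ η hη _ w₀
  have hE := MutualPacking.pairExpect_binningError_le h0 htr hA0 hMA.2 hB0 hMB.2 hP hη hn0 hnA hnB
    hN₁ hN₂ (MutualPacking.rateSize_pos (hR₁.trans hRt₁) n)
    (MutualPacking.rateSize_pos (hR₂.trans hRt₂) n) (MutualPacking.rateSize_pos hR₁ n)
    (MutualPacking.rateSize_pos hR₂ n) w₀
  have hM := MutualPacking.binningErrorProb_le (P := P) (δ := δ) (η := η) (N₁ := N₁) (N₂ := N₂)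
    (L₁ := MutualPacking.rateSize n Rt₁) (L₂ := MutualPacking.rateSize n Rt₂)
    (K₁ := MutualPacking.rateSize n R₁) (K₂ := MutualPacking.rateSize n R₂) h0 hA0 hB0 w₀ δ
  exact le_of_mul_le_mul_left (hM.trans (hE.trans hn1)) hδ0
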